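/- \textbf{Conventions.} Identify $\mathbb Z/2$ with $\{\pm1\}$; for $z\in\mathbb C$ write ${}^{0}z=z$, ${}^{1}z=\bar z$. A \emph{twist} of a group $Q$ is a triple $(\phi,c,\tau)$ with $\phi,c\in\mathrm{Hom}(Q,\mathbb Z/2)$ and a 2-cocycle $\tau:Q\times Q\to\mathbb T$ for the action $q\cdot t={}^{\phi(q)}t$. A \emph{$(\phi,c,\tau)$-twisted representation} on a $\mathbb Z/2$-graded Hilbert space $(H,\gamma)$ is a family of bijective isometries $U_q$, linear or antilinear according to $\phi(q)$, even or odd according to $c(q)$, with $U_qU_r=\tau(q,r)U_{qr}$. A bounded operator $S$ is \emph{$c$-twisted invariant} if $U_qSU_q^*=(-1)^{c(q)}S$ for all $q$. \textbf{K-theory.} Let $Q$ be finite, and let $A$ be a unital C*-algebra with a $\phi$-twisted $Q$-action $\alpha$ ($*$-ring automorphisms $\alpha_q$, linear or antilinear according to $\phi(q)$). For a finite-dimensional twisted representation $\mathscr V$ let $\mathscr F_{\mathscr V}(A)$ be the set of self-adjoint unitaries $s\in A\otimes\mathbb K(\mathscr V)$ with $(\alpha_q\otimes\mathrm{Ad}\,U_q)(s)=(-1)^{c(q)}s$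 for all $q$. Then ${}^{\phi}K^Q_{0,c,\tau}(A)$ is the set of pairs $(\mathscr V,s)$, $s\in\mathscr F_{\mathscr V}(A)$, modulo the equivalence relation generated by norm homotopy in $\mathscr F_{\mathscr V}(A)$ and by $(\mathscr V,s)\sim(\mathscr W,s\oplus\gamma_{\mathscr V^\perp})$ for every even equivariant isometric inclusion $\mathscr V\subset\mathscr W$. It is an abelian group under direct sum, functorial in $A$. \textbf{Setting.} Let $G$ be a countable discrete group whose finite subgroups have uniformly bounded order, $p:G\to Q$ a surjection onto a finite group, $\Pi=\ker p$, and let $(\phi,c,\tau)$ be a twist of $Q$, also viewed as a twist of $G$ by pull-back along $p$. Let $X$ be a discrete metric space with a proper isometric action of $G$. A \emph{uniformly finite $(\phi,c,\tau)$-twisted $(X,G)$-module} $(H,U,\pi)$ is a $\mathbb Z/2$-graded Hilbert space $H$ with a $(\phi,c,\tau)$-twisted representation $U$ of $G$ and a decomposition $H=\bigoplus_{x\in X}H_x$ into graded subspaces of uniformly bounded finite dimension with $U_gH_x=H_{gx}$; let $\pi(\delta_x)$ be the projection onto $H_x$. An operator $S$ on $H$ is \emph{controlled} if for some $R>0$ one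 has $\pi(\delta_y)S\pi(\delta_x)=0$ whenever $d(x,y)>R$, and \emph{locally compact} if all $\pi(\delta_x)S$ and $S\pi(\delta_x)$ are compact. Choose a base point $x_0$ in each $G$-orbit of $X$, let $\tilde X$ be the set of $(g,x)\in G\times X$ with $g\,x_0=x$, $x_0$ the base point of the orbit of $x$, with the free $G$-action $h(g,x)=(hg,hx)$; the fibre over $x$ is a torsor under the stabilizer $G_x$. Put $\mathcal H_{X,G}=\ell^2(\tilde X)=\bigoplus_{x}\ell^2(\text{fibre over }x)$, with $(U_gf)(y)={}^{\phi(g)}f(g^{-1}y)$. Let $C^*_{u,G}(X)^\Pi$ be the norm closure of the $*$-algebra of $\Pi$-invariant, controlled, locally compact operators on $\mathcal H_{X,G}$, let $c_b(X,\mathbb K(\mathcal H_{X,G}))^\Pi=\big(\prod_x\mathbb K((\mathcal H_{X,G})_x)\big)^\Pi$ be the algebra of $\Pi$-invariant bounded block diagonal operators, both with the $\phi$-twisted action of $Q=G/\Pi$ by conjugation with $U_g$, and let $\iota_u^X$ be the inclusion of the latter algebra into the former. \textbf{Topological phases.} A \emph{bulk quantum system} controlled at $X$ is $(H,U,\pi,h)$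 with $(H,U,\pi)$ a uniformly finite $(\phi,c,\tau)$-twisted $(X,G)$-module and $h$ a bounded, $c$-twisted $G$-invariant, controlled, self-adjoint operator whose spectrum misses $[-\varepsilon,\varepsilon]$ for some $\varepsilon>0$. $\mathrm{TP}(X;G,\phi,c,\tau)$ is the set of bulk quantum systems modulo the equivalence relation generated by: (1) isomorphisms of twisted $(X,G)$-modules (unitaries preserving grading, $U$ and $\pi$) carrying $h$ to $h'$; (2) norm-continuous paths of such operators $h_t$ on a fixed $(H,U,\pi)$; (3) $(H,U,\pi,h)\sim(H\oplus H',U\oplus U',\pi\oplus\pi',h\oplus h')$ whenever $h'$ commutes with $\pi'(c_0(X))$. Direct sum induces an addition on $\mathrm{TP}(X;G,\phi,c,\tau)$. \textbf{Proposition.} (a) For every proper discrete metric space $X$ with a proper isometric action of $G$ there is an additive bijection \[ \mathrm{TP}(X;G,\phi,c,\tau)\;\cong\;{}^{\phi}K^Q_{0,c,\tau}\big(C^*_{u,G}(X)^\Pi\big)\big/\mathrm{Im}\,(\iota_u^X)_* ; \] in particular $\mathrm{TP}(X;G,\phi,c,\tau)$ is an abelian group under direct sum. (b) Let $M$ be a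 metric space with a proper isometric $G$-action and let $X,Y\subset M$ be $G$-invariant Delone subsets (for some $r>0$ every closed $r$-ball of $M$ contains at most one point of the subset, and for some $R>0$ every closed $R$-ball contains at least one) of bounded geometry (for each $R$ the numbers of points in the $R$-balls of $X$, and of $Y$, are uniformly bounded). Then there is a group isomorphism $e:{}^{\phi}K^Q_{0,c,\tau}(C^*_{u,G}(X)^\Pi)\to{}^{\phi}K^Q_{0,c,\tau}(C^*_{u,G}(Y)^\Pi)$. Hence $\mathrm{TP}$ depends on the Delone subset only through the subgroup that is divided out: there are additive bijections \[ \mathrm{TP}(X;G,\phi,c,\tau)\cong {}^{\phi}K^Q_{0,c,\tau}\big(C^*_{u,G}(X)^\Pi\big)/\mathrm{Im}(\iota_u^X)_*,\qquad \mathrm{TP}(Y;G,\phi,c,\tau)\cong {}^{\phi}K^Q_{0,c,\tau}\big(C^*_{u,G}(X)^\Pi\big)/e^{-1}\big(\mathrm{Im}(\iota_u^Y)_*\big). \] -/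

import Mathlib

open scoped Matrix

universe u v w

noncomputable section

namespace CTP

/-! ### Twists -/

/-- For `e : ℤˣ = {1, -1} ≅ ℤ/2`, the map `z ↦ ᵉz`: the identity of `ℂ` if `e = 1` and complex
conjugation if `e = -1`. -/
def sg (e : ℤˣ) : ℂ →+* ℂ := if e = 1 then RingHom.id ℂ else starRingEnd ℂ

/-- The sign `(-1)^e` as a complex number. -/
def sgn (e : ℤˣ) : ℂ := ((e : ℤ) : ℂ)

@[simp] theorem sg_one (z : ℂ) : sg 1 z = z := by simp [sg]

@[simp] theorem sg_neg_one (z : ℂ) : sg (-1) z = star z := by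
  have h : (-1 : ℤˣ) ≠ 1 := by decide
  simp [sg, h]

theorem sg_sg (e f : ℤˣ) (z : ℂ) : sg e (sg f z) = sg (e * f) z := by
  rcases Int.units_eq_one_or e with rfl | rfl <;> rcases Int.units_eq_one_or f with rfl | rfl <;>
    simp

@[simp] theorem sg_self (e : ℤˣ) (z : ℂ) : sg e (sg e z) = z := by
  rw [sg_sg, Int.units_mul_self, sg_one]

theorem sg_star (e : ℤˣ) (z : ℂ) : sg e (star z) = star (sg e z) := by
  rcases Int.units_eq_one_or e with rfl | rfl <;> simp

@[simp] theorem norm_sg (e : ℤˣ) (z : ℂ) : ‖sg e z‖ = ‖z‖ := by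
  rcases Int.units_eq_one_or e with rfl | rfl <;> simp

@[simp] theorem sg_sgn (e f : ℤˣ) : sg e (sgn f) = sgn f := by simp [sgn]

@[simp] theorem sgn_one : sgn 1 = 1 := by simp [sgn]

theorem sgn_mul (e f : ℤˣ) : sgn (e * f) = sgn e * sgn f := by simp [sgn]

@[simp] theorem sgn_mul_self (e : ℤˣ) : sgn e * sgn e = 1 := by
  rcases Int.units_eq_one_or e with rfl | rfl <;> simp [sgn]

@[simp] theorem star_sgn (e : ℤˣ) : star (sgn e) = sgn e := by simp [sgn]

/-- A twist `(φ, c, τ)` of a group `G`; `φ, c ∈ Hom(G, ℤ/2)` and the class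
`τ ∈ H²(G; 𝕋_φ)` is given by a representing 2-cocycle. -/
structure Twist (G : Type v) [Group G] where
  φ : G →* ℤˣ
  c : G →* ℤˣ
  τ : G → G → Circle
  cocycle : ∀ g h k, (τ g h : ℂ) * (τ (g * h) k : ℂ) = sg (φ g) (τ h k : ℂ) * (τ g (h * k) : ℂ)

/-- The pull-back of a twist along a homomorphism. -/
def Twist.comap {G : Type v} {Q : Type w} [Group G] [Group Q] (T : Twist Q) (p : G →* Q) :
    Twist G where
  φ := T.φ.comp p
  c := T.c.comp p
  τ g h := T.τ (p g) (p h)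
  cocycle g h k := by simpa using T.cocycle (p g) (p h) (p k)

/-- The twist `(φ, 0, 0)`. -/
def Twist.phiOnly {G : Type v} [Group G] (T : Twist G) : Twist G where
  φ := T.φ
  c := 1
  τ _ _ := 1
  cocycle _ _ _ := by simp

/-! ### Twisted equivariant K-theory of unital C*-algebras -/

/-- A `φ`-twisted action of `Q` on a C*-algebra `A`: `Q` acts by `*`-ring automorphisms, `q` acting
linearly if `φ q = 0` and antilinearly if `φ q = 1`. -/
structure TwAction {Q : Type v} [Group Q] (φ : Q →* ℤˣ) (A : Type w) [CStarAlgebra A] where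
  act : Q → A → A
  one_act : ∀ a, act 1 a = a
  mul_act : ∀ q r a, act (q * r) a = act q (act r a)
  act_add : ∀ q a b, act q (a + b) = act q a + act q b
  act_mul : ∀ q a b, act q (a * b) = act q a * act q b
  act_star : ∀ q a, act q (star a) = star (act q a)
  act_smul : ∀ q (z : ℂ) a, act q (z • a) = sg (φ q) z • act q a

/-- A finite dimensional `(φ, c, τ)`-twisted representation of `Q`, written in an orthonormal
basis: `Γ` is the grading operator, and `q` acts on `ℂ^ι` by `v ↦ u q *ᵥ (sg (φ q) ∘ v)`. -/
structure MatRep {Q : Type v} [Group Q] (T : Twist Q) where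
  ι : Type
  [fin : Fintype ι]
  [dec : DecidableEq ι]
  Γ : Matrix ι ι ℂ
  u : Q → Matrix ι ι ℂ
  Γ_star : Γᴴ = Γ
  Γ_sq : Γ * Γ = 1
  u_unitary : ∀ q, u q * (u q)ᴴ = 1
  u_mul : ∀ q r, u q * (u r).map (sg (T.φ q)) = (T.τ q r : ℂ) • u (q * r)
  u_Γ : ∀ q, u q * Γ.map (sg (T.φ q)) = sgn (T.c q) • (Γ * u q)

attribute [instance] MatRep.fin MatRep.dec

namespace MatRep

variable {Q : Type v} [Group Q] {T : Twist Q}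

theorem fromBlocks_map_sg {l m n o : Type} (e : ℤˣ) (A : Matrix n l ℂ) (B : Matrix n m ℂ)
    (C : Matrix o l ℂ) (D : Matrix o m ℂ) :
    (Matrix.fromBlocks A B C D).map (sg e)
      = Matrix.fromBlocks (A.map (sg e)) (B.map (sg e)) (C.map (sg e)) (D.map (sg e)) :=
  Matrix.fromBlocks_map _ _ _ _ _

theorem zero_map_sg {m n : Type} (e : ℤˣ) : (0 : Matrix m n ℂ).map (sg e) = 0 := by
  ext; simp

theorem one_map_sg {n : Type} [DecidableEq n] (e : ℤˣ) : (1 : Matrix n n ℂ).map (sg e) = 1 := by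
  ext i j; by_cases h : i = j <;> simp [Matrix.one_apply, h]

/-- The direct sum of two twisted representations. -/
def dsum (V W : MatRep T) : MatRep T where
  ι := V.ι ⊕ W.ι
  Γ := Matrix.fromBlocks V.Γ 0 0 W.Γ
  u q := Matrix.fromBlocks (V.u q) 0 0 (W.u q)
  Γ_star := by simp [Matrix.fromBlocks_conjTranspose, V.Γ_star, W.Γ_star]
  Γ_sq := by simp [Matrix.fromBlocks_multiply, V.Γ_sq, W.Γ_sq]
  u_unitary q := by
    simp [Matrix.fromBlocks_conjTranspose, Matrix.fromBlocks_multiply, V.u_unitary, W.u_unitary]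
  u_mul q r := by
    simp [fromBlocks_map_sg, Matrix.fromBlocks_multiply, V.u_mul, W.u_mul,
      Matrix.fromBlocks_smul]
  u_Γ q := by
    simp [fromBlocks_map_sg, Matrix.fromBlocks_multiply, V.u_Γ, W.u_Γ,
      Matrix.fromBlocks_smul]

/-- The zero representation. -/
def zero : MatRep T where
  ι := Empty
  Γ := 0
  u _ := 0
  Γ_star := by ext i; exact i.elim
  Γ_sq := by ext i; exact i.elim
  u_unitary _ := by ext i; exact i.elim
  u_mul _ _ := by ext i; exact i.elim
  u_Γ _ := by ext i; exact i.elim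

/-- The representation with the opposite grading `-Γ` and with `q` acting by `(-1)^{c(q)} u q`
(isomorphic, through `Γ`, to the one with the opposite grading and the same action). -/
def op (V : MatRep T) : MatRep T where
  ι := V.ι
  Γ := -V.Γ
  u q := sgn (T.c q) • V.u q
  Γ_star := by simp [V.Γ_star]
  Γ_sq := by simp [V.Γ_sq]
  u_unitary q := by
    rw [Matrix.conjTranspose_smul, Matrix.smul_mul, Matrix.mul_smul, smul_smul, star_sgn,
      sgn_mul_self, one_smul, V.u_unitary]
  u_mul q r := by
    have h : (sgn (T.c r) • V.u r).map (sg (T.φ q)) = sgn (T.c r) • (V.u r).map (sg (T.φ q)) := by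
      ext i j; simp
    rw [h, Matrix.smul_mul, Matrix.mul_smul, V.u_mul, map_mul, sgn_mul, smul_smul, smul_smul,
      smul_smul]
    congr 1; ring
  u_Γ q := by
    have h : (-V.Γ).map (sg (T.φ q)) = -(V.Γ.map (sg (T.φ q))) := by ext i j; simp
    rw [h, Matrix.smul_mul, Matrix.mul_neg, V.u_Γ, Matrix.neg_mul, Matrix.mul_smul, smul_neg]

end MatRep

section K0

variable {Q : Type v} [Group Q] {T : Twist Q} {A : Type w} [CStarAlgebra A]

/-- A scalar matrix as a matrix over `A`: the operator `1 ⊗ M`. -/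
def lift (A : Type w) [CStarAlgebra A] {m n : Type} (M : Matrix m n ℂ) : Matrix m n A :=
  M.map (algebraMap ℂ A)

theorem lift_mul {l m n : Type} [Fintype m] (M : Matrix l m ℂ) (N : Matrix m n ℂ) :
    lift A (M * N) = lift A M * lift A N := by
  simp [lift, Matrix.map_mul]

theorem lift_star {m n : Type} (M : Matrix m n ℂ) : lift A Mᴴ = (lift A M)ᴴ := by
  ext i j; exact algebraMap_star_comm (M j i)

theorem lift_one {n : Type} [DecidableEq n] : lift A (1 : Matrix n n ℂ) = 1 := by
  simp [lift, Matrix.map_one]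

theorem lift_zero {m n : Type} : lift A (0 : Matrix m n ℂ) = 0 := by
  simp [lift, Matrix.map_zero]

theorem lift_neg {m n : Type} (M : Matrix m n ℂ) : lift A (-M) = -lift A M := by
  ext i j; simp [lift]

theorem lift_smul {m n : Type} (z : ℂ) (M : Matrix m n ℂ) : lift A (z • M) = z • lift A M := by
  ext i j; simp [lift, Algebra.smul_def]

theorem lift_fromBlocks {l m n o : Type} (a : Matrix n l ℂ) (b : Matrix n m ℂ)
    (c : Matrix o l ℂ) (d : Matrix o m ℂ) :
    lift A (Matrix.fromBlocks a b c d)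
      = Matrix.fromBlocks (lift A a) (lift A b) (lift A c) (lift A d) :=
  Matrix.fromBlocks_map _ _ _ _ _

namespace TwAction

variable (α : TwAction T.φ A)

theorem act_zero (q : Q) : α.act q 0 = 0 := by
  have h := α.act_smul q 0 0
  rwa [smul_zero, map_zero, zero_smul] at h

theorem act_one (q : Q) : α.act q 1 = 1 := by
  have h : α.act q (α.act q⁻¹ 1) = 1 := by rw [← α.mul_act, mul_inv_cancel, α.one_act]
  calc α.act q 1 = α.act q 1 * α.act q (α.act q⁻¹ 1) := by rw [h, mul_one]
    _ = 1 := by rw [← α.act_mul, one_mul, h]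

theorem act_neg (q : Q) (a : A) : α.act q (-a) = -α.act q a := by
  have h := α.act_smul q (-1) a
  simpa using h

theorem act_algebraMap (q : Q) (z : ℂ) :
    α.act q (algebraMap ℂ A z) = algebraMap ℂ A (sg (T.φ q) z) := by
  rw [Algebra.algebraMap_eq_smul_one, α.act_smul, α.act_one, Algebra.algebraMap_eq_smul_one]

theorem lift_map_act {m n : Type} (q : Q) (M : Matrix m n ℂ) :
    (lift A M).map (α.act q) = lift A (M.map (sg (T.φ q))) := by
  ext i j; simp [lift, α.act_algebraMap]

end TwAction

/-- The `c`-twisted `Q`-invariant symmetries (self-adjoint unitaries) in the algebra of `ι × ι`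
matrices over `A`, on which `q` acts by `α_q ⊗ Ad U_q`. -/
def symmSet (α : TwAction T.φ A) {ι : Type} [Fintype ι] [DecidableEq ι] (u : Q → Matrix ι ι ℂ) :
    Set (Matrix ι ι A) :=
  {s | sᴴ = s ∧ s * s = 1 ∧
    ∀ q, lift A (u q) * s.map (α.act q) * (lift A (u q))ᴴ = sgn (T.c q) • s}

/-- The space of `c`-twisted `Q`-invariant symmetries in `A ⊗ 𝕂(V)`, the algebra of
`V.ι × V.ι` matrices over `A`. -/
def Symm (α : TwAction T.φ A) (V : MatRep T) : Set (Matrix V.ι V.ι A) := symmSet α V.u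

/-- Pairs of a finite dimensional twisted representation `V` and an element of `Symm α V`. -/
def K0Gen (α : TwAction T.φ A) := Σ V : MatRep T, Symm α V

/-- `j` is an equivariant even isometric inclusion of a twisted representation `V = (Γ, u)` into a
twisted representation `W = (Γ', u')` that maps `s ∈ A ⊗ 𝕂(V)` to
`s' = s ⊕ γ ∈ A ⊗ 𝕂(W)`, where `γ` is the grading of `V^⊥ ⊆ W`. -/
structure IsIncl (T : Twist Q) {l m : Type} [Fintype l] [DecidableEq l] [Fintype m]
    [DecidableEq m] (Γ : Matrix l l ℂ) (u : Q → Matrix l l ℂ) (s : Matrix l l A)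
    (Γ' : Matrix m m ℂ) (u' : Q → Matrix m m ℂ) (s' : Matrix m m A) (j : Matrix m l ℂ) : Prop where
  isom : jᴴ * j = 1
  even : j * Γ = Γ' * j
  equiv : ∀ q, j * u q = u' q * j.map (sg (T.φ q))
  eq : s' = lift A j * s * (lift A j)ᴴ + lift A (Γ' * (1 - j * jᴴ))

/-- The relations defining the K-group: inclusions `V ⊆ W` identify `s` with `s ⊕ γ_{V^⊥}`, and
norm-homotopic symmetries are identified. -/
inductive K0Rel (α : TwAction T.φ A) : K0Gen α → K0Gen α → Prop
  | incl (V W : MatRep T) (s : Symm α V) (s' : Symm α W) (j : Matrix W.ι V.ι ℂ)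
      (h : IsIncl T V.Γ V.u s.1 W.Γ W.u s'.1 j) : K0Rel α ⟨V, s⟩ ⟨W, s'⟩
  | homotopy (V : MatRep T) (s s' : Symm α V) (h : JoinedIn (Symm α V) s.1 s'.1) :
      K0Rel α ⟨V, s⟩ ⟨V, s'⟩

/-- The twisted equivariant K-group `^φK^Q_{0,c,τ}(A)`. -/
def K0 (α : TwAction T.φ A) := Quot (K0Rel α)

variable {α : TwAction T.φ A}

theorem map_fromBlocks_act {l m n o : Type} (q : Q) (a : Matrix n l A) (b : Matrix n m A)
    (c : Matrix o l A) (d : Matrix o m A) :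
    (Matrix.fromBlocks a b c d).map (α.act q)
      = Matrix.fromBlocks (a.map (α.act q)) (b.map (α.act q)) (c.map (α.act q)) (d.map (α.act q)) :=
  Matrix.fromBlocks_map _ _ _ _ _

theorem zero_map_act {m n : Type} (q : Q) : (0 : Matrix m n A).map (α.act q) = 0 := by
  ext; simp [α.act_zero]

theorem dsum_mem {ι κ : Type} [Fintype ι] [DecidableEq ι] [Fintype κ] [DecidableEq κ]
    {u : Q → Matrix ι ι ℂ} {v : Q → Matrix κ κ ℂ} {s : Matrix ι ι A} {t : Matrix κ κ A}
    (hs : s ∈ symmSet α u) (ht : t ∈ symmSet α v) :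
    Matrix.fromBlocks s 0 0 t ∈ symmSet α (fun q => Matrix.fromBlocks (u q) 0 0 (v q)) := by
  refine ⟨?_, ?_, fun q => ?_⟩
  · simp [Matrix.fromBlocks_conjTranspose, hs.1, ht.1]
  · simp [Matrix.fromBlocks_multiply, hs.2.1, ht.2.1]
  · have h1 := hs.2.2 q
    have h2 := ht.2.2 q
    simp only [lift_fromBlocks, lift_zero, map_fromBlocks_act, zero_map_act,
      Matrix.fromBlocks_conjTranspose, Matrix.fromBlocks_multiply, Matrix.fromBlocks_smul,
      Matrix.conjTranspose_zero, Matrix.mul_zero, Matrix.zero_mul, add_zero, zero_add, smul_zero,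
      h1, h2]

/-- The direct sum of two generators. -/
def K0Gen.dsum (x y : K0Gen α) : K0Gen α :=
  ⟨x.1.dsum y.1, ⟨Matrix.fromBlocks x.2.1 0 0 y.2.1, dsum_mem x.2.2 y.2.2⟩⟩

theorem op_mem {ι : Type} [Fintype ι] [DecidableEq ι] {u : Q → Matrix ι ι ℂ}
    {s : Matrix ι ι A} (hs : s ∈ symmSet α u) :
    -s ∈ symmSet α (fun q => sgn (T.c q) • u q) := by
  refine ⟨?_, ?_, fun q => ?_⟩
  · rw [Matrix.conjTranspose_neg, hs.1]
  · rw [neg_mul_neg, hs.2.1]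
  · have h1 := hs.2.2 q
    have h2 : (-s).map (α.act q) = -(s.map (α.act q)) := by ext i j; simp [α.act_neg]
    rw [lift_smul, h2, Matrix.conjTranspose_smul, star_sgn]
    simp only [Matrix.smul_mul, Matrix.mul_smul, Matrix.mul_neg, Matrix.neg_mul]
    rw [smul_neg, smul_smul, sgn_mul_self, one_smul, h1, smul_neg]

/-- The generator representing the inverse. -/
def K0Gen.op (x : K0Gen α) : K0Gen α := ⟨x.1.op, ⟨-x.2.1, op_mem x.2.2⟩⟩

/-- The generator on the zero representation. -/
def K0Gen.zero : K0Gen α :=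
  ⟨MatRep.zero, ⟨0, by ext i; exact i.elim, by ext i; exact i.elim, fun q => by ext i; exact i.elim⟩⟩

/-! #### The group structure -/

section incl

variable {l m n : Type} [Fintype l] [DecidableEq l] [Fintype m] [DecidableEq m] [Fintype n]
  [DecidableEq n]

theorem IsIncl.blocks {Γ : Matrix l l ℂ} {u : Q → Matrix l l ℂ} {s : Matrix l l A}
    {Γ' : Matrix m m ℂ} {u' : Q → Matrix m m ℂ} {s' : Matrix m m A} {j : Matrix m l ℂ}
    (h : IsIncl T Γ u s Γ' u' s' j) (Γ₁ : Matrix n n ℂ) (u₁ : Q → Matrix n n ℂ)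
    (t : Matrix n n A) :
    IsIncl T (Matrix.fromBlocks Γ 0 0 Γ₁) (fun q => Matrix.fromBlocks (u q) 0 0 (u₁ q))
      (Matrix.fromBlocks s 0 0 t) (Matrix.fromBlocks Γ' 0 0 Γ₁)
      (fun q => Matrix.fromBlocks (u' q) 0 0 (u₁ q)) (Matrix.fromBlocks s' 0 0 t)
      (Matrix.fromBlocks j 0 0 1) where
  isom := by simp [Matrix.fromBlocks_conjTranspose, Matrix.fromBlocks_multiply, h.isom]
  even := by simp [Matrix.fromBlocks_multiply, h.even]
  equiv q := by simp [MatRep.fromBlocks_map_sg, Matrix.fromBlocks_multiply, h.equiv]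
  eq := by
    have h1 : (1 : Matrix (m ⊕ n) (m ⊕ n) ℂ) = Matrix.fromBlocks 1 0 0 1 :=
      Matrix.fromBlocks_one.symm
    rw [h.eq, h1]
    simp only [lift_fromBlocks, lift_zero, lift_one, Matrix.fromBlocks_conjTranspose,
      Matrix.fromBlocks_multiply, Matrix.fromBlocks_add, Matrix.fromBlocks_neg, sub_eq_add_neg,
      Matrix.conjTranspose_zero, Matrix.conjTranspose_one, Matrix.mul_zero, Matrix.zero_mul,
      mul_one, one_mul, add_zero, zero_add, neg_zero, add_neg_cancel]

theorem IsIncl.op {Γ : Matrix l l ℂ} {u : Q → Matrix l l ℂ} {s : Matrix l l A}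
    {Γ' : Matrix m m ℂ} {u' : Q → Matrix m m ℂ} {s' : Matrix m m A} {j : Matrix m l ℂ}
    (h : IsIncl T Γ u s Γ' u' s' j) :
    IsIncl T (-Γ) (fun q => sgn (T.c q) • u q) (-s) (-Γ') (fun q => sgn (T.c q) • u' q) (-s') j where
  isom := h.isom
  even := by rw [Matrix.mul_neg, Matrix.neg_mul, h.even]
  equiv q := by rw [Matrix.mul_smul, Matrix.smul_mul, h.equiv]
  eq := by
    rw [h.eq, Matrix.neg_mul, lift_neg, Matrix.mul_neg, Matrix.neg_mul, neg_add]

/-- The permutation matrix of a bijection. -/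
def permMat (e : l ≃ m) : Matrix m l ℂ := (1 : Matrix m m ℂ).submatrix id e

theorem isIncl_perm (e : l ≃ m) {Γ : Matrix l l ℂ} {u : Q → Matrix l l ℂ} {s : Matrix l l A}
    {Γ' : Matrix m m ℂ} {u' : Q → Matrix m m ℂ} {s' : Matrix m m A}
    (hΓ : Γ'.submatrix e e = Γ) (hu : ∀ q, (u' q).submatrix e e = u q)
    (hs : s'.submatrix e e = s) : IsIncl T Γ u s Γ' u' s' (permMat e) := by
  have eval : ∀ (i : m) (k : l), permMat e i k = if i = e k then 1 else 0 := fun i k => by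
    simp [permMat, Matrix.one_apply]
  have eval' : ∀ (i : m) (k : l), permMat e i k = if e.symm i = k then 1 else 0 := fun i k => by
    rw [eval]; congr 1; rw [Equiv.symm_apply_eq]
  have surj : permMat e * (permMat e)ᴴ = 1 := by
    ext i k
    simp [Matrix.mul_apply, eval', Matrix.one_apply, eq_comm]
  have left : ∀ {B : Type w} [CStarAlgebra B] (M : Matrix l l B) (i : m) (k : l),
      (lift B (permMat e) * M) i k = M (e.symm i) k := fun M i k => by
    simp [Matrix.mul_apply, lift, eval', apply_ite (algebraMap ℂ _)]
  have left' : ∀ (M : Matrix l l ℂ) (i : m) (k : l),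
      (permMat e * M) i k = M (e.symm i) k := fun M i k => by
    simp [Matrix.mul_apply, eval']
  refine ⟨?_, ?_, fun q => ?_, ?_⟩
  · ext i k
    simp [Matrix.mul_apply, eval, Matrix.one_apply, eq_comm]
  · ext i k
    rw [left', ← hΓ]
    simp [Matrix.mul_apply, eval]
  · have h : (permMat e).map (sg (T.φ q)) = permMat e := by
      ext i k
      by_cases h : i = e k <;> simp [eval, h]
    rw [h]
    ext i k
    rw [left', ← hu]
    simp [Matrix.mul_apply, eval]
  · rw [surj, sub_self, mul_zero, lift_zero, add_zero]
    ext i k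
    have h : ∀ x, (lift A (permMat e))ᴴ x k = if e.symm k = x then 1 else 0 := fun x => by
      simp [lift, eval', apply_ite (algebraMap ℂ A), apply_ite (star : A → A)]
    simp only [Matrix.mul_apply (M := lift A (permMat e) * s), left, h]
    simp [← hs]

end incl

theorem continuous_blocks {l m : Type} (t : Matrix m m A) :
    Continuous fun a : Matrix l l A => Matrix.fromBlocks a 0 0 t :=
  Continuous.matrix_fromBlocks continuous_id continuous_const continuous_const continuous_const

theorem K0Rel.dsum_right {x y : K0Gen α} (h : K0Rel α x y) (z : K0Gen α) :
    K0Rel α (x.dsum z) (y.dsum z) := by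
  obtain ⟨Z, t⟩ := z
  cases h with
  | incl V W s s' j h => exact K0Rel.incl (V.dsum Z) (W.dsum Z) _ _ _ (h.blocks Z.Γ Z.u t.1)
  | homotopy V s s' h =>
    refine K0Rel.homotopy (V.dsum Z) _ _ ?_
    obtain ⟨γ, hγ⟩ := h
    exact ⟨γ.map (continuous_blocks t.1), fun r => dsum_mem (hγ r) t.2⟩

theorem K0Rel.permStep {x y : K0Gen α} (e : x.1.ι ≃ y.1.ι) (even : y.1.Γ.submatrix e e = x.1.Γ)
    (equiv : ∀ q, (y.1.u q).submatrix e e = x.1.u q) (h : y.2.1.submatrix e e = x.2.1) :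
    K0Rel α x y :=
  K0Rel.incl _ _ _ _ _ (isIncl_perm e even equiv h)

theorem K0Rel.dsum_comm (x y : K0Gen α) : K0Rel α (x.dsum y) (y.dsum x) := by
  refine K0Rel.permStep (Equiv.sumComm x.1.ι y.1.ι) ?_ (fun q => ?_) ?_ <;>
  · ext i k
    rcases i with i | i <;> rcases k with k | k <;> rfl

theorem K0Rel.dsum_assoc (x y z : K0Gen α) :
    K0Rel α ((x.dsum y).dsum z) (x.dsum (y.dsum z)) := by
  refine K0Rel.permStep (Equiv.sumAssoc x.1.ι y.1.ι z.1.ι) ?_ (fun q => ?_) ?_ <;>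
  · ext i k
    rcases i with (i | i) | i <;> rcases k with (k | k) | k <;> rfl

theorem K0Rel.zero_dsum (x : K0Gen α) : K0Rel α (K0Gen.zero.dsum x) x := by
  refine K0Rel.permStep (Equiv.emptySum Empty x.1.ι) ?_ (fun q => ?_) ?_ <;>
  · ext i k
    rcases i with i | i
    · exact i.elim
    · rcases k with k | k
      · exact k.elim
      · rfl

theorem K0Rel.op {x y : K0Gen α} (h : K0Rel α x y) : K0Rel α x.op y.op := by
  cases h with
  | incl V W s s' j h => exact K0Rel.incl V.op W.op _ _ j h.op
  | homotopy V s s' h =>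
    refine K0Rel.homotopy V.op _ _ ?_
    obtain ⟨γ, hγ⟩ := h
    have hc : Continuous fun a : Matrix V.ι V.ι A => -a := continuous_neg
    exact ⟨γ.map hc, fun r => op_mem (hγ r)⟩

/-- The off-diagonal rotation path through which `s ⊕ (-s)` is homotopic to a scalar symmetry. -/
def rot {ι : Type} [DecidableEq ι] (s : Matrix ι ι A) (a b : ℝ) : Matrix (ι ⊕ ι) (ι ⊕ ι) A :=
  Matrix.fromBlocks ((a : ℂ) • s) ((b : ℂ) • 1) ((b : ℂ) • 1) (-((a : ℂ) • s))

theorem rot_mem {ι : Type} [Fintype ι] [DecidableEq ι] {u : Q → Matrix ι ι ℂ} {s : Matrix ι ι A}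
    (hu : ∀ q, u q * (u q)ᴴ = 1) (hs : s ∈ symmSet α u) (a b : ℝ) (hab : a * a + b * b = 1) :
    rot s a b ∈ symmSet α (fun q => Matrix.fromBlocks (u q) 0 0 (sgn (T.c q) • u q)) := by
  have hab' : (a : ℂ) * a + (b : ℂ) * b = 1 := by exact_mod_cast hab
  have hab'' : (b : ℂ) * b + (a : ℂ) * a = 1 := by rw [add_comm]; exact hab'
  have real_map : ∀ (r : ℝ) (q : Q) (m : Matrix ι ι A),
      ((r : ℂ) • m).map (α.act q) = (r : ℂ) • m.map (α.act q) := by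
    intro r q m
    ext i k
    have h : sg (T.φ q) (r : ℂ) = r := by
      rcases Int.units_eq_one_or (T.φ q) with h | h <;> simp [h]
    rw [Matrix.map_apply, Matrix.smul_apply, α.act_smul, h, Matrix.smul_apply, Matrix.map_apply]
  have neg_map : ∀ (q : Q) (m : Matrix ι ι A), (-m).map (α.act q) = -m.map (α.act q) := by
    intro q m; ext i k; simp [α.act_neg]
  have one_map : ∀ q : Q, (1 : Matrix ι ι A).map (α.act q) = 1 := by
    intro q; ext i k
    by_cases h : i = k <;> simp [Matrix.one_apply, h, α.act_one, α.act_zero]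
  refine ⟨?_, ?_, fun q => ?_⟩
  · simp [rot, Matrix.fromBlocks_conjTranspose, Matrix.conjTranspose_smul, hs.1]
  · rw [rot, Matrix.fromBlocks_multiply, ← Matrix.fromBlocks_one]
    congr 1
    · simp only [Matrix.smul_mul, Matrix.mul_smul, hs.2.1, smul_smul, mul_one, ← add_smul, hab',
        one_smul]
    · simp [smul_smul, mul_comm]
    · simp [smul_smul, mul_comm]
    · rw [neg_mul_neg]
      simp only [Matrix.smul_mul, Matrix.mul_smul, hs.2.1,
        smul_smul, mul_one, ← add_smul, hab'', one_smul]
  · have h1 := hs.2.2 q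
    have h2 : lift A (u q) * (lift A (u q))ᴴ = 1 := by
      rw [← lift_star, ← lift_mul, hu, lift_one]
    simp only [rot, lift_fromBlocks, lift_zero, lift_smul, map_fromBlocks_act, real_map, neg_map,
      one_map, Matrix.fromBlocks_conjTranspose, Matrix.fromBlocks_multiply, Matrix.fromBlocks_smul,
      Matrix.conjTranspose_zero, Matrix.conjTranspose_smul, star_sgn, Matrix.mul_zero,
      Matrix.zero_mul, add_zero, zero_add, smul_zero, neg_zero, Matrix.smul_mul, Matrix.mul_smul,
      Matrix.mul_neg, Matrix.neg_mul, mul_one, h1, h2]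
    congr 1
    · rw [smul_comm]
    · rw [smul_comm]
    · rw [smul_smul, smul_smul]
      congr 2
      have hc : (a : ℂ) * sgn (T.c q) * sgn (T.c q) = a := by
        linear_combination (a : ℂ) * sgn_mul_self (T.c q)
      exact congrArg (fun z : ℂ => z • s) hc

theorem K0Gen.op_dsum (x : K0Gen α) :
    ∃ y : K0Gen α, K0Rel α (x.dsum x.op) y ∧ K0Rel α K0Gen.zero y := by
  obtain ⟨V, s⟩ := x
  have hγ : lift A V.Γ ∈ symmSet α V.u := by
    refine ⟨?_, ?_, fun q => ?_⟩
    · rw [← lift_star, V.Γ_star]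
    · rw [← lift_mul, V.Γ_sq, lift_one]
    · rw [α.lift_map_act, ← lift_star, ← lift_mul, ← lift_mul, V.u_Γ, Matrix.smul_mul,
        Matrix.mul_assoc, V.u_unitary, mul_one, lift_smul]
  have path : ∀ t : Matrix V.ι V.ι A, t ∈ symmSet α V.u →
      JoinedIn (Symm α (V.dsum V.op)) (Matrix.fromBlocks t 0 0 (-t)) (rot t 0 1) := by
    intro t ht
    refine ⟨⟨⟨fun r => rot t (Real.cos (Real.pi / 2 * r)) (Real.sin (Real.pi / 2 * r)), ?_⟩,
      ?_, ?_⟩, fun r => rot_mem V.u_unitary ht _ _ ?_⟩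
    · refine Continuous.matrix_fromBlocks ?_ ?_ ?_ ?_ <;> fun_prop
    · simp [rot]; rfl
    · simp [rot]; rfl
    · have := Real.cos_sq_add_sin_sq (Real.pi / 2 * r); nlinarith
  have hrot : ∀ t t' : Matrix V.ι V.ι A, rot t 0 1 = rot t' 0 1 := by
    intro t t'; simp [rot]
  refine ⟨K0Gen.dsum ⟨V, ⟨lift A V.Γ, hγ⟩⟩ (K0Gen.op ⟨V, ⟨lift A V.Γ, hγ⟩⟩), ?_, ?_⟩
  · refine K0Rel.homotopy (V.dsum V.op) _ _ ?_
    refine (path s.1 s.2).trans ?_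
    rw [hrot s.1 (lift A V.Γ)]
    exact (path _ hγ).symm
  · refine K0Rel.incl MatRep.zero (V.dsum V.op) _ _
      (0 : Matrix (V.ι ⊕ V.ι) Empty ℂ) ⟨?_, ?_, fun q => ?_, ?_⟩
    · ext i; exact i.elim
    · ext i k; exact k.elim
    · ext i k; exact k.elim
    · change Matrix.fromBlocks (lift A V.Γ) 0 0 (-lift A V.Γ) =
        lift A (0 : Matrix (V.ι ⊕ V.ι) Empty ℂ) * (0 : Matrix Empty Empty A)
          * (lift A (0 : Matrix (V.ι ⊕ V.ι) Empty ℂ))ᴴ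
        + lift A (Matrix.fromBlocks V.Γ 0 0 (-V.Γ) * ((1 : Matrix (V.ι ⊕ V.ι) (V.ι ⊕ V.ι) ℂ)
          - (0 : Matrix (V.ι ⊕ V.ι) Empty ℂ) * (0 : Matrix (V.ι ⊕ V.ι) Empty ℂ)ᴴ))
      rw [Matrix.mul_zero, Matrix.zero_mul, Matrix.zero_mul, sub_zero, mul_one, zero_add,
        lift_fromBlocks, lift_neg, lift_zero]

namespace K0

/-- The class of a symmetry. -/
def mk (α : TwAction T.φ A) (V : MatRep T) (s : Symm α V) : K0 α := Quot.mk _ ⟨V, s⟩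

instance : Zero (K0 α) := ⟨Quot.mk _ K0Gen.zero⟩

/-- Addition in the K-group is direct sum. -/
instance : Add (K0 α) :=
  ⟨Quot.lift₂ (fun x y => Quot.mk _ (x.dsum y))
    (fun z x y h => by
      rw [Quot.sound (K0Rel.dsum_comm z x), Quot.sound (K0Rel.dsum_comm z y)]
      exact Quot.sound (h.dsum_right z))
    (fun _ _ z h => Quot.sound (h.dsum_right z))⟩

instance : Neg (K0 α) := ⟨Quot.map K0Gen.op fun _ _ h => h.op⟩

instance : AddCommGroup (K0 α) where
  add_assoc := by
    rintro ⟨x⟩ ⟨y⟩ ⟨z⟩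
    exact Quot.sound (K0Rel.dsum_assoc x y z)
  zero_add := by
    rintro ⟨x⟩
    exact Quot.sound (K0Rel.zero_dsum x)
  add_zero := by
    rintro ⟨x⟩
    exact (Quot.sound (K0Rel.dsum_comm x K0Gen.zero)).trans (Quot.sound (K0Rel.zero_dsum x))
  add_comm := by
    rintro ⟨x⟩ ⟨y⟩
    exact Quot.sound (K0Rel.dsum_comm x y)
  neg_add_cancel := by
    rintro ⟨x⟩
    obtain ⟨y, h1, h2⟩ := K0Gen.op_dsum x
    exact ((Quot.sound (K0Rel.dsum_comm x.op x)).trans (Quot.sound h1)).trans (Quot.sound h2).symm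
  nsmul := nsmulRec
  zsmul := zsmulRec

section map

variable {B : Type w} [CStarAlgebra B] {β : TwAction T.φ B}

theorem lift_map_hom (f : A →⋆ₐ[ℂ] B) {m n : Type} (M : Matrix m n ℂ) :
    (lift A M).map f = lift B M := by
  ext i k; exact AlgHomClass.commutes f (M i k)

theorem map_mem (f : A →⋆ₐ[ℂ] B) (hf : ∀ q a, f (α.act q a) = β.act q (f a)) {ι : Type}
    [Fintype ι] [DecidableEq ι] {u : Q → Matrix ι ι ℂ} {s : Matrix ι ι A}
    (hs : s ∈ symmSet α u) : s.map f ∈ symmSet β u := by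
  have hstar : ∀ M : Matrix ι ι A, (M.map f)ᴴ = Mᴴ.map f := fun M => by
    ext i k; simp [map_star]
  refine ⟨?_, ?_, fun q => ?_⟩
  · rw [hstar, hs.1]
  · rw [← Matrix.map_mul, hs.2.1, Matrix.map_one _ (map_zero f) (map_one f)]
  · have h : (s.map f).map (β.act q) = (s.map (α.act q)).map f := by
      ext i k; simp [hf]
    rw [h, ← lift_map_hom f, hstar, ← Matrix.map_mul, ← Matrix.map_mul, hs.2.2 q]
    ext i k; simp

/-- The homomorphism of K-groups induced by an equivariant unital `*`-homomorphism. -/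
def map (f : A →⋆ₐ[ℂ] B) (hf : ∀ q a, f (α.act q a) = β.act q (f a)) : K0 α →+ K0 β where
  toFun := Quot.map (fun x => ⟨x.1, ⟨x.2.1.map f, map_mem f hf x.2.2⟩⟩) (by
    rintro _ _ (⟨V, W, s, s', j, h⟩ | ⟨V, s, s', h⟩)
    · refine K0Rel.incl V W _ _ j ⟨h.isom, h.even, h.equiv, ?_⟩
      have hstar : (lift B j)ᴴ = ((lift A j)ᴴ).map f := by
        rw [← lift_star, ← lift_star, lift_map_hom]
      change s'.1.map f = _
      rw [h.eq, Matrix.map_add _ (map_add f), Matrix.map_mul, Matrix.map_mul, hstar,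
        lift_map_hom, lift_map_hom]
    · refine K0Rel.homotopy V _ _ ?_
      obtain ⟨γ, hγ⟩ := h
      have hc : Continuous fun M : Matrix V.ι V.ι A => M.map f :=
        continuous_id.matrix_map
        (AddMonoidHomClass.continuous_of_bound f 1 fun a => by
          simpa using NonUnitalStarAlgHom.norm_apply_le f a)
      exact ⟨γ.map hc, fun r => map_mem f hf (hγ r)⟩)
  map_zero' := Quot.sound (K0Rel.permStep (Equiv.refl _)
    (by ext i; exact i.elim) (fun q => by ext i; exact i.elim) (by ext i; exact i.elim))
  map_add' := by
    rintro ⟨x⟩ ⟨y⟩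
    refine congrArg (Quot.mk _) (Sigma.ext rfl (heq_of_eq (Subtype.ext ?_)))
    change (Matrix.fromBlocks x.2.1 0 0 y.2.1).map f
      = Matrix.fromBlocks (x.2.1.map f) 0 0 (y.2.1.map f)
    rw [Matrix.fromBlocks_map, Matrix.map_zero _ (map_zero f), Matrix.map_zero _ (map_zero f)]

end map

end K0

end K0

/-! ### Twisted `(X, G)`-modules -/

/-- A uniformly finite `(φ, c, τ)`-twisted `(X, G)`-module: a `ℤ/2`-graded Hilbert space `H` with
grading operator `γ`, a `(φ, c, τ)`-twisted representation `U` of `G` on `H` (`U g` is a bijective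
isometry, linear or antilinear according to `φ g`, even or odd according to `c g`, and
`U g * U h = τ(g, h) * U (g * h)`), and a `G`-equivariant representation `π` of `c₀(X)` by even
operators, given by the projections `proj x = π(δ_x)` onto the summands of the decomposition
`H = ⨁ H_x`, whose ranks are uniformly bounded. -/
structure UFModule {G : Type u} [Group G] (T : Twist G) (X : Type u) [MulAction G X] where
  H : Type u
  [ng : NormedAddCommGroup H]
  [ip : InnerProductSpace ℂ H]
  [cs : CompleteSpace H]
  γ : H →L[ℂ] H
  γ_star : IsSelfAdjoint γ
  γ_sq : γ * γ = 1
  U : G → H ≃+ H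
  U_norm : ∀ g v, ‖U g v‖ = ‖v‖
  U_smul : ∀ g (z : ℂ) v, U g (z • v) = sg (T.φ g) z • U g v
  U_mul : ∀ g h v, U g (U h v) = (T.τ g h : ℂ) • U (g * h) v
  U_γ : ∀ g v, U g (γ v) = sgn (T.c g) • γ (U g v)
  proj : X → H →L[ℂ] H
  proj_star : ∀ x, IsStarProjection (proj x)
  proj_orth : ∀ x y, x ≠ y → proj x * proj y = 0
  proj_total : ∀ v, (∀ x, proj x v = 0) → v = 0
  proj_γ : ∀ x, Commute γ (proj x)
  U_proj : ∀ g x v, U g (proj x v) = proj (g • x) (U g v)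
  uniformlyFinite : ∃ N : ℕ, ∀ x,
    FiniteDimensional ℂ (LinearMap.range (proj x : H →ₗ[ℂ] H)) ∧
      Module.finrank ℂ (LinearMap.range (proj x : H →ₗ[ℂ] H)) ≤ N

attribute [instance] UFModule.ng UFModule.ip UFModule.cs

namespace UFModule

section basic

variable {G : Type u} [Group G] {T : Twist G} {X : Type u} [MulAction G X] (M : UFModule T X)

/-- Finite propagation. -/
def Controlled [MetricSpace X] (S : M.H →L[ℂ] M.H) : Prop :=
  ∃ R : ℝ, 0 < R ∧ ∀ x y, R < dist x y → M.proj y * S * M.proj x = 0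

/-- Local compactness. -/
def LocallyCompact (S : M.H →L[ℂ] M.H) : Prop :=
  ∀ x, IsCompactOperator (M.proj x * S) ∧ IsCompactOperator (S * M.proj x)

/-- `S` is `c`-twisted `G`-invariant: `U_g S U_g^* = (-1)^{c(g)} S`. -/
def TwInvariant (S : M.H →L[ℂ] M.H) : Prop :=
  ∀ g v, M.U g (S v) = sgn (T.c g) • S (M.U g v)

/-- `S` has a spectral gap at `[-ε, ε]` for some `ε > 0`. -/
def Gapped (S : M.H →L[ℂ] M.H) : Prop :=
  ∃ ε : ℝ, 0 < ε ∧ ∀ t ∈ Set.Icc (-ε) ε, (t : ℂ) ∉ spectrum ℂ S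

theorem U_symm_smul (g : G) (z : ℂ) (v : M.H) :
    (M.U g).symm (z • v) = sg (T.φ g) z • (M.U g).symm v := by
  apply (M.U g).injective
  rw [M.U_smul, sg_self, AddEquiv.apply_symm_apply, AddEquiv.apply_symm_apply]

theorem U_symm_norm (g : G) (v : M.H) : ‖(M.U g).symm v‖ = ‖v‖ := by
  rw [← M.U_norm g, AddEquiv.apply_symm_apply]

theorem inner_U (g : G) (v w : M.H) :
    inner ℂ (M.U g v) (M.U g w) = sg (T.φ g) (inner ℂ v w) := by
  have h1 : ∀ a b : M.H, ‖M.U g a + M.U g b‖ = ‖a + b‖ := fun a b => by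
    rw [← map_add, M.U_norm]
  have h2 : ∀ a b : M.H, ‖M.U g a - M.U g b‖ = ‖a - b‖ := fun a b => by
    rw [← map_sub, M.U_norm]
  have h3 := M.U_smul g Complex.I w
  rw [inner_eq_sum_norm_sq_div_four (𝕜 := ℂ) (M.U g v) (M.U g w),
    inner_eq_sum_norm_sq_div_four (𝕜 := ℂ) v w]
  rcases Int.units_eq_one_or (T.φ g) with h | h
  · rw [h, sg_one] at h3
    simp only [RCLike.I_to_complex, ← h3, h1, h2, h, sg_one]
  · rw [h, sg_neg_one] at h3
    have h4 : Complex.I • M.U g w = M.U g (-(Complex.I • w)) := by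
      rw [map_neg, h3]; simp
    simp only [RCLike.I_to_complex, h4, h1, h2, h, sg_neg_one, ← sub_eq_add_neg, sub_neg_eq_add]
    simp
    ring

/-- The conjugation action `S ↦ U_g S U_g^*` on bounded operators. -/
def ad (g : G) (S : M.H →L[ℂ] M.H) : M.H →L[ℂ] M.H :=
  LinearMap.mkContinuous
    { toFun := fun v => M.U g (S ((M.U g).symm v))
      map_add' := fun v w => by simp
      map_smul' := fun z v => by
        rw [M.U_symm_smul, map_smul, M.U_smul, sg_self, RingHom.id_apply] }
    ‖S‖ (fun v => by
      change ‖M.U g (S ((M.U g).symm v))‖ ≤ _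
      rw [M.U_norm, ← M.U_symm_norm g v]
      exact S.le_opNorm _)

theorem ad_apply (g : G) (S : M.H →L[ℂ] M.H) (v : M.H) :
    M.ad g S v = M.U g (S ((M.U g).symm v)) := rfl

theorem ad_norm_le (g : G) (S : M.H →L[ℂ] M.H) : ‖M.ad g S‖ ≤ ‖S‖ :=
  LinearMap.mkContinuous_norm_le _ (norm_nonneg _) _

theorem ad_add (g : G) (S S' : M.H →L[ℂ] M.H) : M.ad g (S + S') = M.ad g S + M.ad g S' := by
  ext v; simp [ad_apply]

theorem ad_smul (g : G) (z : ℂ) (S : M.H →L[ℂ] M.H) :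
    M.ad g (z • S) = sg (T.φ g) z • M.ad g S := by
  ext v; simp [ad_apply, M.U_smul]

theorem ad_times (g : G) (S S' : M.H →L[ℂ] M.H) : M.ad g (S * S') = M.ad g S * M.ad g S' := by
  ext v; simp [ad_apply]

theorem ad_id (g : G) : M.ad g 1 = 1 := by
  ext v; simp [ad_apply]

theorem ad_star (g : G) (S : M.H →L[ℂ] M.H) : M.ad g (star S) = star (M.ad g S) := by
  refine (ContinuousLinearMap.eq_adjoint_iff _ _).2 fun v w => ?_
  obtain ⟨v, rfl⟩ := (M.U g).surjective v
  obtain ⟨w, rfl⟩ := (M.U g).surjective w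
  rw [ad_apply, ad_apply, AddEquiv.symm_apply_apply, AddEquiv.symm_apply_apply, inner_U, inner_U,
    ContinuousLinearMap.star_eq_adjoint, ContinuousLinearMap.adjoint_inner_left]

theorem ad_mul (g h : G) (S : M.H →L[ℂ] M.H) : M.ad (g * h) S = M.ad g (M.ad h S) := by
  ext v
  obtain ⟨w, rfl⟩ := (M.U g).surjective v
  obtain ⟨w, rfl⟩ := (M.U h).surjective w
  rw [ad_apply, ad_apply, ad_apply, AddEquiv.symm_apply_apply, AddEquiv.symm_apply_apply, M.U_mul,
    M.U_mul, M.U_symm_smul, AddEquiv.symm_apply_apply, map_smul, M.U_smul, sg_self]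

theorem ad_one (S : M.H →L[ℂ] M.H) : M.ad 1 S = S := by
  have h := fun S => M.ad_mul 1 1 S
  simp only [mul_one] at h
  ext v
  have h1 := congrArg (fun S : M.H →L[ℂ] M.H => S (M.U 1 v)) (h S)
  simp only [ad_apply, AddEquiv.symm_apply_apply] at h1
  have h2 := (M.U 1).injective h1
  rw [← ad_apply] at h2
  exact h2.symm

theorem ad_continuous (g : G) : Continuous (M.ad g) :=
  AddMonoidHomClass.continuous_of_bound
    (AddMonoidHom.mk' (M.ad g) (M.ad_add g)) 1 fun S => by
      rw [one_mul]; exact M.ad_norm_le g S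

theorem ad_proj (g : G) (x : X) : M.ad g (M.proj x) = M.proj (g • x) := by
  ext v; rw [ad_apply, M.U_proj, AddEquiv.apply_symm_apply]

theorem proj_compact (x : X) : IsCompactOperator (M.proj x) := by
  obtain ⟨N, hN⟩ := M.uniformlyFinite
  have : FiniteDimensional ℂ (LinearMap.range (M.proj x : M.H →ₗ[ℂ] M.H)) := (hN x).1
  have : ProperSpace (LinearMap.range (M.proj x : M.H →ₗ[ℂ] M.H)) := FiniteDimensional.proper ℂ _
  have h : IsCompactOperator ((M.proj x).codRestrict
      (LinearMap.range (M.proj x : M.H →ₗ[ℂ] M.H)) fun v => ⟨v, rfl⟩) :=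
    isCompactOperator_of_locallyCompactSpace_dom
    ((M.proj x).codRestrict (LinearMap.range (M.proj x : M.H →ₗ[ℂ] M.H)) fun v => ⟨v, rfl⟩)
  exact h.clm_comp (LinearMap.range (M.proj x : M.H →ₗ[ℂ] M.H)).subtypeL

theorem locallyCompact (S : M.H →L[ℂ] M.H) : M.LocallyCompact S := fun x =>
  ⟨(M.proj_compact x).comp_clm S, (M.proj_compact x).clm_comp S⟩

variable {M}

theorem Controlled.star [MetricSpace X] {S : M.H →L[ℂ] M.H} (h : M.Controlled S) :
    M.Controlled (star S) := by
  obtain ⟨R, hR, h⟩ := h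
  refine ⟨R, hR, fun x y hxy => ?_⟩
  have h1 := congrArg Star.star (h y x (by rwa [dist_comm]))
  rwa [star_mul, star_mul, star_zero, (M.proj_star x).isSelfAdjoint.star_eq,
    (M.proj_star y).isSelfAdjoint.star_eq, ← mul_assoc] at h1

theorem Controlled.ad [MetricSpace X] [IsIsometricSMul G X] {S : M.H →L[ℂ] M.H}
    (h : M.Controlled S) (g : G) : M.Controlled (M.ad g S) := by
  obtain ⟨R, hR, h⟩ := h
  refine ⟨R, hR, fun x y hxy => ?_⟩
  have h1 := h (g⁻¹ • x) (g⁻¹ • y) (by rwa [dist_smul])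
  have h2 := congrArg (M.ad g) h1
  rw [ad_times, ad_times, ad_proj, ad_proj, smul_inv_smul, smul_inv_smul] at h2
  rw [h2]
  ext v; simp [ad_apply]

theorem Controlled.add [MetricSpace X] {S S' : M.H →L[ℂ] M.H} (h : M.Controlled S)
    (h' : M.Controlled S') : M.Controlled (S + S') := by
  obtain ⟨R, hR, h⟩ := h
  obtain ⟨R', hR', h'⟩ := h'
  refine ⟨max R R', lt_max_of_lt_left hR, fun x y hxy => ?_⟩
  rw [mul_add, add_mul, h x y ((le_max_left _ _).trans_lt hxy),
    h' x y ((le_max_right _ _).trans_lt hxy), add_zero]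

theorem inner_eq_zero {a b : M.H} (h : ∀ z, M.proj z a = 0 ∨ M.proj z b = 0) :
    inner ℂ a b = 0 := by
  let W : Submodule ℂ M.H := ⨅ z : {z // M.proj z b = 0}, LinearMap.ker (M.proj z.1 : M.H →ₗ[ℂ] M.H)
  have memW : ∀ v, v ∈ W ↔ ∀ z, M.proj z b = 0 → M.proj z v = 0 := fun v => by
    simp [W, Submodule.mem_iInf]
  have hcl : IsClosed (W : Set M.H) := by
    have : (W : Set M.H) = ⋂ z : {z // M.proj z b = 0}, M.proj z.1 ⁻¹' {0} := by
      ext v; simp [memW]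
    rw [this]
    exact isClosed_iInter fun z => isClosed_singleton.preimage (M.proj z.1).continuous
  have : CompleteSpace W := hcl.completeSpace_coe
  obtain ⟨a₁, h₁, a₂, h₂, rfl⟩ := W.exists_add_mem_mem_orthogonal a
  have hz : ∀ z, M.proj z b ≠ 0 → M.proj z a₂ = 0 := by
    intro z hz
    refine ext_inner_left ℂ fun v => ?_
    have hmem : M.proj z v ∈ W := (memW _).2 fun z' hz' => by
      have hne : z' ≠ z := fun e => hz (e ▸ hz')
      exact congrArg (fun A : M.H →L[ℂ] M.H => A v) (M.proj_orth z' z hne)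
    have h0 := h₂ _ hmem
    rw [← ContinuousLinearMap.adjoint_inner_right, ← ContinuousLinearMap.star_eq_adjoint,
      (M.proj_star z).isSelfAdjoint.star_eq] at h0
    rw [h0, inner_zero_right]
  have h0 : a₁ = 0 := by
    refine M.proj_total _ fun z => ?_
    by_cases hb : M.proj z b = 0
    · exact (memW _).1 h₁ z hb
    · have := (h z).resolve_right hb
      rwa [map_add, hz z hb, add_zero] at this
  rw [h0, zero_add]
  exact (Submodule.mem_orthogonal' W a₂).1 h₂ b ((memW b).2 fun _ hz => hz)

theorem Controlled.mul [MetricSpace X] {S S' : M.H →L[ℂ] M.H} (h : M.Controlled S)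
    (h' : M.Controlled S') : M.Controlled (S * S') := by
  obtain ⟨R, hR, h⟩ := h
  obtain ⟨R', hR', h'⟩ := h'
  refine ⟨R + R', add_pos hR hR', fun x y hxy => ?_⟩
  ext v
  refine ext_inner_left ℂ fun w => ?_
  have e : (M.proj y * (S * S') * M.proj x) v = (M.proj y * S) (S' (M.proj x v)) := rfl
  rw [e, ← ContinuousLinearMap.adjoint_inner_left, zero_apply,
    inner_zero_right]
  refine inner_eq_zero fun z => ?_
  by_cases hz : R' < dist x z
  · exact Or.inr (congrArg (fun A : M.H →L[ℂ] M.H => A v) (h' x z hz))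
  · left
    have hz' : R < dist z y := by
      have := dist_triangle x z y
      have := not_lt.1 hz
      linarith
    have h1 := congrArg Star.star (h z y hz')
    rw [star_mul, star_zero, (M.proj_star z).isSelfAdjoint.star_eq] at h1
    exact congrArg (fun A : M.H →L[ℂ] M.H => A w) h1

theorem controlled_of_commute [MetricSpace X] {S : M.H →L[ℂ] M.H}
    (h : ∀ x, Commute (M.proj x) S) : M.Controlled S := by
  refine ⟨1, one_pos, fun x y hxy => ?_⟩
  have hne : y ≠ x := by rintro rfl; rw [dist_self] at hxy; linarith
  rw [(h y).eq, mul_assoc, M.proj_orth y x hne, mul_zero]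

end basic

/-! ### Invariant Roe algebras of uniformly finite modules -/

section roe

variable {G : Type u} [Group G] {Q : Type v} [Group Q] {T : Twist Q} {X : Type u} [MulAction G X]
  {p : G →* Q} (M : UFModule (T.comap p) X)

/-- The `*`-algebra of operators that are invariant under `Π = ker p`. -/
def invAlg : StarSubalgebra ℂ (M.H →L[ℂ] M.H) where
  carrier := {S | ∀ g, p g = 1 → M.ad g S = S}
  mul_mem' hS hS' g hg := by rw [ad_times, hS g hg, hS' g hg]
  add_mem' hS hS' g hg := by rw [ad_add, hS g hg, hS' g hg]
  algebraMap_mem' z g hg := by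
    have h : (T.comap p).φ g = 1 := by simp [Twist.comap, hg]
    rw [Algebra.algebraMap_eq_smul_one, ad_smul, h, sg_one, ad_id]
  star_mem' hS g hg := by rw [ad_star, hS g hg]

theorem isClosed_invAlg : IsClosed (M.invAlg : Set (M.H →L[ℂ] M.H)) := by
  have : (M.invAlg : Set (M.H →L[ℂ] M.H)) = ⋂ g, ⋂ (_ : p g = 1), {S | M.ad g S = S} := by
    ext S; simp [invAlg]
  rw [this]
  exact isClosed_iInter fun g => isClosed_iInter fun _ =>
    isClosed_eq (M.ad_continuous g) continuous_id

theorem ad_mem_invAlg (g : G) {S : M.H →L[ℂ] M.H} (hS : S ∈ M.invAlg) : M.ad g S ∈ M.invAlg := by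
  intro h hh
  have e : h * g = g * (g⁻¹ * h * g) := by group
  rw [← ad_mul, e, ad_mul, hS _ (by simp [hh])]

/-- The `*`-algebra of `Π`-invariant, controlled and locally compact operators, `Π = ker p`. -/
def algRoe [MetricSpace X] : StarSubalgebra ℂ (M.H →L[ℂ] M.H) where
  carrier := {S | S ∈ M.invAlg ∧ M.Controlled S ∧ M.LocallyCompact S}
  mul_mem' hS hS' := ⟨mul_mem hS.1 hS'.1, hS.2.1.mul hS'.2.1, M.locallyCompact _⟩
  add_mem' hS hS' := ⟨add_mem hS.1 hS'.1, hS.2.1.add hS'.2.1, M.locallyCompact _⟩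
  algebraMap_mem' z := ⟨algebraMap_mem _ z,
    controlled_of_commute fun x => (Algebra.commutes z (M.proj x)).symm, M.locallyCompact _⟩
  star_mem' hS := ⟨star_mem hS.1, hS.2.1.star, M.locallyCompact _⟩

/-- The `Π`-invariant Roe algebra `C*_H(X)^Π` of the module, `Π = ker p`. -/
def roe [MetricSpace X] : StarSubalgebra ℂ (M.H →L[ℂ] M.H) := M.algRoe.topologicalClosure

/-- The algebra `c_b(X, 𝕂(H))^Π = (∏ₓ 𝕂(Hₓ))^Π` of bounded `Π`-invariant families of operators on the
(finite dimensional) spaces `H_x`, that is, of `Π`-invariant block diagonal operators on `H`. -/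
def diag : StarSubalgebra ℂ (M.H →L[ℂ] M.H) where
  carrier := {S | S ∈ M.invAlg ∧ ∀ x, Commute (M.proj x) S}
  mul_mem' hS hS' := ⟨mul_mem hS.1 hS'.1, fun x => (hS.2 x).mul_right (hS'.2 x)⟩
  add_mem' hS hS' := ⟨add_mem hS.1 hS'.1, fun x => (hS.2 x).add_right (hS'.2 x)⟩
  algebraMap_mem' z := ⟨algebraMap_mem _ z, fun x => (Algebra.commutes z (M.proj x)).symm⟩
  star_mem' hS := ⟨star_mem hS.1, fun x => by
    have h := (hS.2 x).star_star
    rwa [(M.proj_star x).isSelfAdjoint.star_eq] at h⟩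

instance [MetricSpace X] : IsClosed (M.roe : Set (M.H →L[ℂ] M.H)) :=
  StarSubalgebra.isClosed_topologicalClosure _

instance : IsClosed (M.diag : Set (M.H →L[ℂ] M.H)) := by
  have : (M.diag : Set (M.H →L[ℂ] M.H))
      = (M.invAlg : Set (M.H →L[ℂ] M.H)) ∩ ⋂ x, {S | M.proj x * S = S * M.proj x} := by
    ext S; simp [diag, ← SetLike.mem_coe, Commute, SemiconjBy]
  rw [this]
  exact M.isClosed_invAlg.inter (isClosed_iInter fun x =>
    isClosed_eq (continuous_const.mul continuous_id) (continuous_id.mul continuous_const))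

theorem roe_le_invAlg [MetricSpace X] : M.roe ≤ M.invAlg :=
  StarSubalgebra.topologicalClosure_minimal (fun _ h => h.1) M.isClosed_invAlg

theorem diag_le_invAlg : M.diag ≤ M.invAlg := fun _ h => h.1

theorem diag_le_roe [MetricSpace X] : M.diag ≤ M.roe := fun S h =>
  StarSubalgebra.le_topologicalClosure _
    (show S ∈ M.algRoe from ⟨h.1, controlled_of_commute h.2, M.locallyCompact S⟩)

theorem ad_mem_roe [MetricSpace X] [IsIsometricSMul G X] (g : G) {S : M.H →L[ℂ] M.H}
    (hS : S ∈ M.roe) : M.ad g S ∈ M.roe := by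
  have h : Set.MapsTo (M.ad g) (M.algRoe : Set (M.H →L[ℂ] M.H)) (M.algRoe : Set _) :=
    fun S hS => ⟨M.ad_mem_invAlg g hS.1, hS.2.1.ad g, M.locallyCompact _⟩
  exact h.closure (M.ad_continuous g) hS

theorem ad_mem_diag (g : G) {S : M.H →L[ℂ] M.H} (hS : S ∈ M.diag) : M.ad g S ∈ M.diag := by
  refine ⟨M.ad_mem_invAlg g hS.1, fun x => ?_⟩
  have h := congrArg (M.ad g) (hS.2 (g⁻¹ • x)).eq
  rwa [ad_times, ad_times, ad_proj, smul_inv_smul] at h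

/-- The `φ`-twisted action of `Q = G/Π` on a `G`-invariant closed `*`-algebra of `Π`-invariant
operators: `q = p g` acts by `S ↦ U_g S U_g^*`. -/
def qAction (hp : Function.Surjective p) (A : StarSubalgebra ℂ (M.H →L[ℂ] M.H))
    [IsClosed (A : Set (M.H →L[ℂ] M.H))] (hA : A ≤ M.invAlg)
    (had : ∀ g {S}, S ∈ A → M.ad g S ∈ A) : TwAction T.φ A where
  act q S := ⟨M.ad (Function.surjInv hp q) S, had _ S.2⟩
  one_act S := Subtype.ext (hA S.2 _ (Function.surjInv_eq hp 1))
  mul_act q r S := by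
    refine Subtype.ext ?_
    set g := Function.surjInv hp q
    set h := Function.surjInv hp r
    set k := Function.surjInv hp (q * r)
    have hg : p g = q := Function.surjInv_eq hp q
    have hh : p h = r := Function.surjInv_eq hp r
    have hk : p k = q * r := Function.surjInv_eq hp _
    have e : k = g * h * ((g * h)⁻¹ * k) := by group
    change M.ad k S = M.ad g (M.ad h S)
    rw [e, ad_mul, hA S.2 _ (by simp [hg, hh, hk]), ad_mul]
  act_add q S S' := Subtype.ext (M.ad_add _ _ _)
  act_mul q S S' := Subtype.ext (M.ad_times _ _ _)
  act_star q S := Subtype.ext (M.ad_star _ _)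
  act_smul q z S := Subtype.ext (by
    have h : (T.comap p).φ (Function.surjInv hp q) = T.φ q := by
      simp [Twist.comap, Function.surjInv_eq hp q]
    have h' := M.ad_smul (Function.surjInv hp q) z S
    rwa [h] at h')

/-- The Real `Q`-C*-algebra structure of `C*_H(X)^Π`. -/
def roeAction [MetricSpace X] [IsIsometricSMul G X] (hp : Function.Surjective p) :
    TwAction T.φ M.roe :=
  M.qAction hp M.roe M.roe_le_invAlg fun g _ => M.ad_mem_roe g

/-- The Real `Q`-C*-algebra structure of `c_b(X, 𝕂(H))^Π`. -/
def diagAction (hp : Function.Surjective p) : TwAction T.φ M.diag :=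
  M.qAction hp M.diag M.diag_le_invAlg fun g _ => M.ad_mem_diag g

end roe

end UFModule

/-! ### The module `ℋ_{X,G}` -/

/-- The orders of the finite subgroups of `G` are uniformly bounded. -/
class BoundedFiniteSubgroups (G : Type u) [Group G] : Prop where
  out : ∃ N : ℕ, ∀ F : Subgroup G, Finite F → Nat.card F ≤ N

section HXG

variable (G : Type u) [Group G] (X : Type u) [MulAction G X]

/-- A chosen base point of the orbit of `x`. -/
def basePt {G X : Type u} [Group G] [MulAction G X] (x : X) : X :=
  (Quotient.mk (MulAction.orbitRel G X) x).out

theorem basePt_smul {G X : Type u} [Group G] [MulAction G X] (g : G) (x : X) :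
    basePt (G := G) (g • x) = basePt (G := G) x := by
  have h : (Quotient.mk (MulAction.orbitRel G X) (g • x)) = Quotient.mk _ x :=
    Quotient.sound ⟨g, rfl⟩
  rw [basePt, h, basePt]

theorem exists_smul_basePt {G X : Type u} [Group G] [MulAction G X] (x : X) :
    ∃ g : G, g • basePt (G := G) x = x := by
  have h : (MulAction.orbitRel G X) (basePt (G := G) x) x := Quotient.mk_out (s := MulAction.orbitRel G X) x
  obtain ⟨g, hg⟩ := (MulAction.orbitRel G X).symm h
  exact ⟨g, hg⟩

/-- The free `G`-space `X̃` over `X`, whose fibre over `x` is the coset `{g | g • x₀ = x}` of the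
stabilizer of the base point `x₀` of the orbit of `x`, a torsor under the stabilizer `G_x`. -/
@[ext] structure XTilde where
  elt : G
  pt : X
  smul_basePt : elt • basePt (G := G) pt = pt

variable {G X}

/-- The free action of `G` on `X̃`, over the action on `X`. -/
instance : MulAction G (XTilde G X) where
  smul g y := ⟨g * y.elt, g • y.pt, by rw [basePt_smul, mul_smul, y.smul_basePt]⟩
  one_smul y := XTilde.ext (one_mul _) (one_smul _ _)
  mul_smul g h y := XTilde.ext (mul_assoc _ _ _) (mul_smul _ _ _)

theorem XTilde.pt_smul (g : G) (y : XTilde G X) : (g • y).pt = g • y.pt := rfl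

/-- `ℓ²(X̃)`. -/
abbrev L2 (Y : Type u) := lp (fun _ : Y => ℂ) 2

theorem L2.summable {Y : Type u} (f : L2 Y) : Summable fun y => ‖f y‖ ^ (2 : ℝ) := by
  simpa using (lp.memℓp f).summable (by simp)

theorem L2.mem {Y : Type u} {f : Y → ℂ} (h : Summable fun y => ‖f y‖ ^ (2 : ℝ)) :
    Memℓp (E := fun _ : Y => ℂ) f 2 := by
  refine (memℓp_gen_iff (by simp)).2 ?_
  simpa using h

theorem L2.norm_sq {Y : Type u} (f : L2 Y) : ‖f‖ ^ (2 : ℝ) = ∑' y, ‖f y‖ ^ (2 : ℝ) := by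
  simpa using lp.norm_rpow_eq_tsum (p := 2) (by simp) f

/-- The action of `g` on functions on `X̃`: `(U_g f)(y) = ^{e}f(g⁻¹ • y)`. -/
def L2.act {Y : Type u} [MulAction G Y] (e : ℤˣ) (g : G) (f : L2 Y) : L2 Y :=
  ⟨fun y => sg e (f (g⁻¹ • y)), L2.mem (by
    simp only [norm_sg]
    exact (L2.summable f).comp_injective (MulAction.injective g⁻¹))⟩

theorem L2.act_apply {Y : Type u} [MulAction G Y] (e : ℤˣ) (g : G) (f : L2 Y) (y : Y) :
    L2.act e g f y = sg e (f (g⁻¹ • y)) := rfl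

theorem L2.act_norm {Y : Type u} [MulAction G Y] (e : ℤˣ) (g : G) (f : L2 Y) :
    ‖L2.act e g f‖ = ‖f‖ := by
  have h : ‖L2.act e g f‖ ^ (2 : ℝ) = ‖f‖ ^ (2 : ℝ) := by
    rw [L2.norm_sq, L2.norm_sq]
    simp only [L2.act_apply, norm_sg]
    exact (MulAction.toPerm g⁻¹).tsum_eq fun y => ‖f y‖ ^ (2 : ℝ)
  exact (Real.rpow_left_inj (norm_nonneg _) (norm_nonneg _) two_ne_zero).1 h

open Classical in
theorem L2.cut_le {Y : Type u} (s : Set Y) (f : L2 Y) (y : Y) :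
    ‖(if y ∈ s then f y else 0 : ℂ)‖ ^ (2 : ℝ) ≤ ‖f y‖ ^ (2 : ℝ) := by
  by_cases h : y ∈ s
  · simp [h]
  · simp [h]

open Classical in
theorem L2.cut_summable {Y : Type u} (s : Set Y) (f : L2 Y) :
    Summable fun y => ‖(if y ∈ s then f y else 0 : ℂ)‖ ^ (2 : ℝ) :=
  Summable.of_nonneg_of_le (fun y => by positivity) (L2.cut_le s f) (L2.summable f)

open Classical in
/-- The projection of `ℓ²(Y)` onto the functions supported in `s`. -/
def L2.cut {Y : Type u} (s : Set Y) : L2 Y →L[ℂ] L2 Y :=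
  LinearMap.mkContinuous
    { toFun := fun f => ⟨fun y => if y ∈ s then f y else 0, L2.mem (L2.cut_summable s f)⟩
      map_add' := fun f f' => by
        ext y
        change (if y ∈ s then f y + f' y else 0) = (if y ∈ s then f y else 0) +
          (if y ∈ s then f' y else 0)
        by_cases h : y ∈ s <;> simp [h]
      map_smul' := fun z f => by
        ext y
        change (if y ∈ s then z • f y else 0) = z • (if y ∈ s then f y else 0)
        by_cases h : y ∈ s <;> simp [h] }
    1 (fun f => by
      rw [one_mul]
      refine (Real.rpow_le_rpow_iff (norm_nonneg _) (norm_nonneg _) two_pos).1 ?_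
      rw [L2.norm_sq, L2.norm_sq]
      exact Summable.tsum_le_tsum (L2.cut_le s f) (L2.cut_summable s f) (L2.summable f))

open Classical in
theorem L2.cut_apply {Y : Type u} (s : Set Y) (f : L2 Y) (y : Y) :
    L2.cut s f y = if y ∈ s then f y else 0 := rfl

theorem L2.cut_star {Y : Type u} (s : Set Y) : IsStarProjection (L2.cut s) where
  isIdempotentElem := by
    refine ContinuousLinearMap.ext fun f => ?_
    ext y
    change L2.cut s (L2.cut s f) y = _
    by_cases h : y ∈ s <;> simp [L2.cut_apply, h]
  isSelfAdjoint := by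
    refine (ContinuousLinearMap.isSelfAdjoint_iff_isSymmetric).2 fun f f' => ?_
    change inner ℂ (L2.cut s f) f' = inner ℂ f (L2.cut s f')
    rw [lp.inner_eq_tsum, lp.inner_eq_tsum]
    refine tsum_congr fun y => ?_
    by_cases h : y ∈ s <;> simp [L2.cut_apply, h]

theorem finite_stabilizer [TopologicalSpace G] [DiscreteTopology G] [TopologicalSpace X]
    [ProperSMul G X] (x : X) : Finite (MulAction.stabilizer G x) := by
  have h := (ProperSMul.isProperMap_smul_pair (G := G) (X := X)).isCompact_preimage
    (isCompact_singleton (x := (x, x)))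
  have h2 := h.image continuous_fst
  have h3 : Prod.fst '' ((fun gx : G × X => (gx.1 • gx.2, gx.2)) ⁻¹' {(x, x)})
      = (MulAction.stabilizer G x : Set G) := by
    ext g; simp [MulAction.mem_stabilizer_iff]
  rw [h3] at h2
  exact h2.finite_of_discrete

theorem fibre_bound [BoundedFiniteSubgroups G] [TopologicalSpace G] [DiscreteTopology G]
    [TopologicalSpace X] [ProperSMul G X] :
    ∃ N : ℕ, ∀ x : X, Finite {y : XTilde G X // y.pt = x} ∧
      Nat.card {y : XTilde G X // y.pt = x} ≤ N := by
  obtain ⟨N, hN⟩ := BoundedFiniteSubgroups.out (G := G)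
  refine ⟨N, fun x => ?_⟩
  obtain ⟨g, hg⟩ := exists_smul_basePt (G := G) x
  have hfin : Finite (MulAction.stabilizer G x) := finite_stabilizer x
  let F : {y : XTilde G X // y.pt = x} → MulAction.stabilizer G x := fun y =>
    ⟨y.1.elt * g⁻¹, by
      have h1 := y.1.smul_basePt
      rw [y.2] at h1
      rw [MulAction.mem_stabilizer_iff, mul_smul, inv_smul_eq_iff.2 hg.symm, h1]⟩
  have hF : Function.Injective F := fun y z h => by
    have h1 : y.1.elt = z.1.elt := mul_right_cancel (congrArg Subtype.val h)
    exact Subtype.ext (XTilde.ext h1 (y.2.trans z.2.symm))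
  exact ⟨Finite.of_injective F hF, (Nat.card_le_card_of_injective F hF).trans (hN _ hfin)⟩

variable {Q : Type v} [Group Q]

/-- The uniformly finite Real `(X, G)`-module `ℋ_{X,G} = ℓ²(X̃) = ⨁ₓ ℓ²(G_x)`, with trivial grading.
The unitary representation of `G` and the Real structure (complex conjugation) are combined into the
`φ`-linear action `(U_g f)(y) = ^{φ(g)}f(g⁻¹ • y)`. -/
def HXG (T : Twist Q) (p : G →* Q) (X : Type u) [MulAction G X] [BoundedFiniteSubgroups G]
    [TopologicalSpace G] [DiscreteTopology G] [TopologicalSpace X] [ProperSMul G X] :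
    UFModule (T.phiOnly.comap p) X where
  H := L2 (XTilde G X)
  γ := 1
  γ_star := IsSelfAdjoint.one _
  γ_sq := one_mul 1
  U g :=
    { toFun := L2.act (T.φ (p g)) g
      invFun := L2.act (T.φ (p g)) g⁻¹
      left_inv := fun f => by
        ext y; simp [L2.act_apply]
      right_inv := fun f => by
        ext y; simp [L2.act_apply]
      map_add' := fun f f' => by
        ext y; simp [L2.act_apply] }
  U_norm g f := L2.act_norm _ g f
  U_smul g z f := by
    ext y
    change sg _ ((z • f : L2 (XTilde G X)) _) = _
    rw [lp.coeFn_smul, Pi.smul_apply, smul_eq_mul, map_mul]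
    rfl
  U_mul g h f := by
    ext y
    change sg _ (sg _ (f _)) = ((1 : Circle) : ℂ) • sg _ (f _)
    rw [sg_sg, ← map_mul, ← map_mul, mul_inv_rev, mul_smul, Circle.coe_one, one_smul]
  U_γ g f := by
    ext y
    change _ = (sgn 1 • L2.act (T.φ (p g)) g f : L2 (XTilde G X)) y
    rw [sgn_one, one_smul]
    rfl
  proj x := L2.cut {y | y.pt = x}
  proj_star x := L2.cut_star _
  proj_orth x x' hx := by
    refine ContinuousLinearMap.ext fun f => ?_
    ext y
    change L2.cut _ (L2.cut _ f) y = 0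
    rw [L2.cut_apply, L2.cut_apply]
    by_cases h : y ∈ {y : XTilde G X | y.pt = x}
    · have h' : y ∉ {y : XTilde G X | y.pt = x'} := fun h' => hx (h.symm.trans h')
      rw [if_neg h', ite_self]
    · rw [if_neg h]
  proj_total f hf := by
    ext y
    have h : L2.cut {z : XTilde G X | z.pt = y.pt} f y = 0 := by rw [hf]; rfl
    rw [L2.cut_apply] at h
    simpa using h
  proj_γ x := Commute.one_left _
  U_proj g x f := by
    ext y
    change sg _ (L2.cut _ f (g⁻¹ • y)) = L2.cut _ (L2.act _ g f) y
    rw [L2.cut_apply, L2.cut_apply]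
    have h : g⁻¹ • y ∈ {z : XTilde G X | z.pt = x} ↔ y ∈ {z : XTilde G X | z.pt = g • x} := by
      simp only [Set.mem_ofPred_eq, XTilde.pt_smul, inv_smul_eq_iff]
    by_cases hy : g⁻¹ • y ∈ {z : XTilde G X | z.pt = x}
    · rw [if_pos hy, if_pos (h.1 hy)]; rfl
    · rw [if_neg hy, if_neg (mt h.2 hy), map_zero]
  uniformlyFinite := by
    obtain ⟨N, hN⟩ := fibre_bound (G := G) (X := X)
    refine ⟨N, fun x => ?_⟩
    have := (hN x).1
    have := Fintype.ofFinite {y : XTilde G X // y.pt = x}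
    set R := LinearMap.range (L2.cut {y : XTilde G X | y.pt = x} :
      L2 (XTilde G X) →ₗ[ℂ] L2 (XTilde G X))
    let e : R →ₗ[ℂ] ({y : XTilde G X // y.pt = x} → ℂ) :=
      { toFun := fun f y => f.1 y.1
        map_add' := fun f f' => rfl
        map_smul' := fun z f => rfl }
    have he : Function.Injective e := by
      rw [injective_iff_map_eq_zero]
      rintro ⟨_, f, rfl⟩ hf
      refine Subtype.ext ?_
      ext y
      change L2.cut _ f y = 0
      by_cases hy : y.pt = x
      · exact congrFun hf ⟨y, hy⟩
      · rw [L2.cut_apply]; exact if_neg hy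
    refine ⟨FiniteDimensional.of_injective e he, ?_⟩
    refine (LinearMap.finrank_le_finrank_of_injective he).trans ?_
    rw [Module.finrank_fintype_fun_eq_card, ← Nat.card_eq_fintype_card]
    exact (hN x).2

end HXG

/-! ### Direct sums of modules -/

section opSum

theorem wext {E F : Type u} {v w : WithLp 2 (E × F)} (h₁ : v.fst = w.fst) (h₂ : v.snd = w.snd) : v = w :=
  WithLp.ofLp_injective 2 (Prod.ext h₁ h₂)

variable {E F : Type u} [NormedAddCommGroup E] [InnerProductSpace ℂ E] [NormedAddCommGroup F]
  [InnerProductSpace ℂ F]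

/-- The operator `S ⊕ S'` on the Hilbert space direct sum. -/
def opSum (S : E →L[ℂ] E) (S' : F →L[ℂ] F) : WithLp 2 (E × F) →L[ℂ] WithLp 2 (E × F) :=
  (WithLp.prodContinuousLinearEquiv 2 ℂ E F).symm.toContinuousLinearMap ∘L (S.prodMap S') ∘L
    (WithLp.prodContinuousLinearEquiv 2 ℂ E F).toContinuousLinearMap

theorem opSum_ext {S S' : WithLp 2 (E × F) →L[ℂ] WithLp 2 (E × F)}
    (h₁ : ∀ v, (S v).fst = (S' v).fst) (h₂ : ∀ v, (S v).snd = (S' v).snd) : S = S' :=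
  ContinuousLinearMap.ext fun v => wext (h₁ v) (h₂ v)

theorem opSum_fst (S : E →L[ℂ] E) (S' : F →L[ℂ] F) (v : WithLp 2 (E × F)) :
    (opSum S S' v).fst = S v.fst := rfl

theorem opSum_snd (S : E →L[ℂ] E) (S' : F →L[ℂ] F) (v : WithLp 2 (E × F)) :
    (opSum S S' v).snd = S' v.snd := rfl

theorem opSum_mul (S R : E →L[ℂ] E) (S' R' : F →L[ℂ] F) :
    opSum S S' * opSum R R' = opSum (S * R) (S' * R') := rfl

theorem opSum_one : opSum (1 : E →L[ℂ] E) (1 : F →L[ℂ] F) = 1 := rfl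

theorem opSum_zero : opSum (0 : E →L[ℂ] E) (0 : F →L[ℂ] F) = 0 := rfl

theorem opSum_selfAdjoint [CompleteSpace E] [CompleteSpace F] {S : E →L[ℂ] E} {S' : F →L[ℂ] F}
    (h : IsSelfAdjoint S) (h' : IsSelfAdjoint S') : IsSelfAdjoint (opSum S S') := by
  rw [ContinuousLinearMap.isSelfAdjoint_iff_isSymmetric] at h h' ⊢
  intro v w
  change inner ℂ (opSum S S' v) w = inner ℂ v (opSum S S' w)
  rw [WithLp.prod_inner_apply, WithLp.prod_inner_apply]
  exact congrArg₂ _ (h v.fst w.fst) (h' v.snd w.snd)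

theorem opSum_continuous (S' : F →L[ℂ] F) : Continuous fun S : E →L[ℂ] E => opSum S S' := by
  have h : ∀ S : E →L[ℂ] E, opSum S S' =
      ((WithLp.prodContinuousLinearEquiv 2 ℂ E F).symm.toContinuousLinearMap ∘L
        (ContinuousLinearMap.inl ℂ E F)) ∘L S ∘L
        ((ContinuousLinearMap.fst ℂ E F) ∘L
          (WithLp.prodContinuousLinearEquiv 2 ℂ E F).toContinuousLinearMap) + opSum 0 S' := by
    intro S
    refine opSum_ext (fun v => ?_) fun v => ?_
    · change S v.fst = S v.fst + 0
      rw [add_zero]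
    · change S' v.snd = 0 + S' v.snd
      rw [zero_add]
  refine Continuous.congr ?_ fun S => (h S).symm
  exact (continuous_const.clm_comp (continuous_id.clm_comp continuous_const)).add continuous_const

theorem opSum_notMem_spectrum {S : E →L[ℂ] E} {S' : F →L[ℂ] F} {z : ℂ} (a : z ∉ spectrum ℂ S)
    (b : z ∉ spectrum ℂ S') : z ∉ spectrum ℂ (opSum S S') := by
  rw [spectrum.notMem_iff] at a b ⊢
  obtain ⟨B, hB, hB'⟩ := isUnit_iff_exists.1 a
  obtain ⟨C, hC, hC'⟩ := isUnit_iff_exists.1 b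
  have h : algebraMap ℂ _ z - opSum S S' = opSum (algebraMap ℂ _ z - S) (algebraMap ℂ _ z - S') :=
    rfl
  rw [h]
  exact isUnit_iff_exists.2 ⟨opSum B C, by rw [opSum_mul, hB, hC, opSum_one],
    by rw [opSum_mul, hB', hC', opSum_one]⟩

end opSum

section bulk

variable {G : Type u} [Group G] {T : Twist G} {X : Type u} [MulAction G X]

/-- The direct sum `(H ⊕ H', U ⊕ U', π ⊕ π')` of two modules. -/
def UFModule.dsum (M M' : UFModule T X) : UFModule T X where
  H := WithLp 2 (M.H × M'.H)
  γ := opSum M.γ M'.γ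
  γ_star := opSum_selfAdjoint M.γ_star M'.γ_star
  γ_sq := by rw [opSum_mul, M.γ_sq, M'.γ_sq, opSum_one]
  U g :=
    { toFun := fun v => WithLp.toLp 2 (M.U g v.fst, M'.U g v.snd)
      invFun := fun v => WithLp.toLp 2 ((M.U g).symm v.fst, (M'.U g).symm v.snd)
      left_inv := fun v => wext (by simp) (by simp)
      right_inv := fun v => wext (by simp) (by simp)
      map_add' := fun v w => wext (by simp) (by simp) }
  U_norm g v := by
    have h : ‖WithLp.toLp 2 (M.U g v.fst, M'.U g v.snd)‖ ^ 2 = ‖v‖ ^ 2 := by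
      rw [WithLp.prod_norm_sq_eq_of_L2, WithLp.prod_norm_sq_eq_of_L2]
      simp [M.U_norm, M'.U_norm]
    exact (pow_left_inj₀ (norm_nonneg _) (norm_nonneg _) two_ne_zero).1 h
  U_smul g z v := wext (M.U_smul g z v.fst) (M'.U_smul g z v.snd)
  U_mul g h v := wext (M.U_mul g h v.fst) (M'.U_mul g h v.snd)
  U_γ g v := wext (M.U_γ g v.fst) (M'.U_γ g v.snd)
  proj x := opSum (M.proj x) (M'.proj x)
  proj_star x := ⟨by
    rw [IsIdempotentElem, opSum_mul, (M.proj_star x).isIdempotentElem.eq,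
      (M'.proj_star x).isIdempotentElem.eq],
    opSum_selfAdjoint (M.proj_star x).isSelfAdjoint (M'.proj_star x).isSelfAdjoint⟩
  proj_orth x y h := by rw [opSum_mul, M.proj_orth x y h, M'.proj_orth x y h, opSum_zero]
  proj_total v hv := wext
    (M.proj_total _ fun x => congrArg WithLp.fst (hv x))
    (M'.proj_total _ fun x => congrArg WithLp.snd (hv x))
  proj_γ x := by
    rw [Commute, SemiconjBy, opSum_mul, opSum_mul, (M.proj_γ x).eq, (M'.proj_γ x).eq]
  U_proj g x v := wext (M.U_proj g x v.fst) (M'.U_proj g x v.snd)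
  uniformlyFinite := by
    obtain ⟨N, hN⟩ := M.uniformlyFinite
    obtain ⟨N', hN'⟩ := M'.uniformlyFinite
    refine ⟨N + N', fun x => ?_⟩
    have := (hN x).1
    have := (hN' x).1
    let e : LinearMap.range (opSum (M.proj x) (M'.proj x) :
          WithLp 2 (M.H × M'.H) →ₗ[ℂ] WithLp 2 (M.H × M'.H)) →ₗ[ℂ]
        LinearMap.range (M.proj x : M.H →ₗ[ℂ] M.H) × LinearMap.range (M'.proj x : M'.H →ₗ[ℂ] M'.H) :=
      { toFun := fun v => (⟨v.1.fst, by obtain ⟨_, w, rfl⟩ := v; exact ⟨w.fst, rfl⟩⟩,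
          ⟨v.1.snd, by obtain ⟨_, w, rfl⟩ := v; exact ⟨w.snd, rfl⟩⟩)
        map_add' := fun _ _ => rfl
        map_smul' := fun _ _ => rfl }
    have he : Function.Injective e := fun v w h =>
      Subtype.ext (wext (congrArg (fun a => a.1.1) h) (congrArg (fun a => a.2.1) h))
    refine ⟨FiniteDimensional.of_injective e he,
      (LinearMap.finrank_le_finrank_of_injective he).trans ?_⟩
    rw [Module.finrank_prod]
    exact add_le_add (hN x).2 (hN' x).2

/-! ### Bulk quantum systems and topological phases -/

/-- The admissible Hamiltonians on a module: `c`-twisted `G`-invariant controlled self-adjoint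
operators with a spectral gap at `[-ε, ε]` for some `ε > 0`. -/
def UFModule.Hamiltonians [MetricSpace X] (M : UFModule T X) : Set (M.H →L[ℂ] M.H) :=
  {h | M.TwInvariant h ∧ M.Controlled h ∧ IsSelfAdjoint h ∧ M.Gapped h}

theorem opSum_mem [MetricSpace X] {M M' : UFModule T X} {h : M.H →L[ℂ] M.H} {h' : M'.H →L[ℂ] M'.H}
    (hh : h ∈ M.Hamiltonians) (hh' : h' ∈ M'.Hamiltonians) :
    opSum h h' ∈ (M.dsum M').Hamiltonians := by
  obtain ⟨h1, ⟨R, hR, h2⟩, h3, ⟨ε, hε, h4⟩⟩ := hh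
  obtain ⟨h1', ⟨R', hR', h2'⟩, h3', ⟨ε', hε', h4'⟩⟩ := hh'
  refine ⟨fun g v => wext (h1 g v.fst) (h1' g v.snd),
    ⟨max R R', lt_max_of_lt_left hR, fun x y hxy => ?_⟩, opSum_selfAdjoint h3 h3',
    ⟨min ε ε', lt_min hε hε', fun t ht => ?_⟩⟩
  · change opSum (M.proj y) (M'.proj y) * opSum h h' * opSum (M.proj x) (M'.proj x) = 0
    rw [opSum_mul, opSum_mul, h2 x y ((le_max_left _ _).trans_lt hxy),
      h2' x y ((le_max_right _ _).trans_lt hxy), opSum_zero]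
  · have a := h4 t ⟨(neg_le_neg (min_le_left ε ε')).trans ht.1, ht.2.trans (min_le_left _ _)⟩
    have b := h4' t ⟨(neg_le_neg (min_le_right ε ε')).trans ht.1, ht.2.trans (min_le_right _ _)⟩
    exact opSum_notMem_spectrum a b

/-- Bulk quantum systems `(H, U, π, ham)` controlled at `X` with a given symmetry class. -/
structure BulkSystem (T : Twist G) (X : Type u) [MetricSpace X] [MulAction G X] where
  M : UFModule T X
  ham : M.H →L[ℂ] M.H
  mem : ham ∈ M.Hamiltonians

variable [MetricSpace X]

/-- Direct sum of bulk quantum systems. -/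
def BulkSystem.dsum (S S' : BulkSystem T X) : BulkSystem T X :=
  ⟨S.M.dsum S'.M, opSum S.ham S'.ham, opSum_mem S.mem S'.mem⟩

/-- `V` is an isomorphism of twisted `(X, G)`-modules. -/
structure UFModule.IsIso (M M' : UFModule T X) (V : M.H ≃ₗᵢ[ℂ] M'.H) : Prop where
  map_γ : ∀ v, V (M.γ v) = M'.γ (V v)
  map_U : ∀ g v, V (M.U g v) = M'.U g (V v)
  map_proj : ∀ x v, V (M.proj x v) = M'.proj x (V v)

/-- The relations generating the equivalence of bulk quantum systems: isomorphism, norm-homotopy of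
the Hamiltonian, and addition of a system whose Hamiltonian commutes with `π(c₀(X))`. -/
inductive BulkRel : BulkSystem T X → BulkSystem T X → Prop
  | iso (S S' : BulkSystem T X) (V : S.M.H ≃ₗᵢ[ℂ] S'.M.H) (hV : S.M.IsIso S'.M V)
      (h : ∀ v, V (S.ham v) = S'.ham (V v)) : BulkRel S S'
  | homotopy (M : UFModule T X) (h₀ h₁ : M.H →L[ℂ] M.H) (mem₀ : h₀ ∈ M.Hamiltonians)
      (mem₁ : h₁ ∈ M.Hamiltonians) (path : JoinedIn M.Hamiltonians h₀ h₁) :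
      BulkRel ⟨M, h₀, mem₀⟩ ⟨M, h₁, mem₁⟩
  | stab (S S' : BulkSystem T X) (h : ∀ x, Commute (S'.M.proj x) S'.ham) : BulkRel S (S.dsum S')

variable (T X) in
/-- The set of controlled bulk topological phases: bulk quantum systems modulo the equivalence
relation generated by `BulkRel`. -/
def TP := Quot (BulkRel (T := T) (X := X))

/-- Exchange of summands. -/
def swapIso (E F : Type u) [NormedAddCommGroup E] [InnerProductSpace ℂ E] [NormedAddCommGroup F]
    [InnerProductSpace ℂ F] : WithLp 2 (E × F) ≃ₗᵢ[ℂ] WithLp 2 (F × E) where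
  toFun v := WithLp.toLp 2 (v.snd, v.fst)
  invFun v := WithLp.toLp 2 (v.snd, v.fst)
  left_inv _ := rfl
  right_inv _ := rfl
  map_add' _ _ := rfl
  map_smul' _ _ := rfl
  norm_map' v := by
    refine (pow_left_inj₀ (norm_nonneg _) (norm_nonneg _) two_ne_zero).1 ?_
    rw [WithLp.prod_norm_sq_eq_of_L2, WithLp.prod_norm_sq_eq_of_L2]
    exact add_comm _ _

theorem BulkRel.swap (S S' : BulkSystem T X) : BulkRel (S.dsum S') (S'.dsum S) :=
  BulkRel.iso _ _ (swapIso S.M.H S'.M.H) ⟨fun _ => rfl, fun _ _ => rfl, fun _ _ => rfl⟩ fun _ => rfl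

/-- The sum of an isometry with the identity. -/
def sumIso {E F : Type u} (D : Type u) [NormedAddCommGroup E] [InnerProductSpace ℂ E]
    [NormedAddCommGroup F] [InnerProductSpace ℂ F] [NormedAddCommGroup D] [InnerProductSpace ℂ D]
    (V : E ≃ₗᵢ[ℂ] F) : WithLp 2 (E × D) ≃ₗᵢ[ℂ] WithLp 2 (F × D) where
  toFun v := WithLp.toLp 2 (V v.fst, v.snd)
  invFun v := WithLp.toLp 2 (V.symm v.fst, v.snd)
  left_inv _ := wext (V.symm_apply_apply _) rfl
  right_inv _ := wext (V.apply_symm_apply _) rfl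
  map_add' _ _ := wext (map_add V _ _) rfl
  map_smul' _ _ := wext (map_smul V _ _) rfl
  norm_map' v := by
    refine (pow_left_inj₀ (norm_nonneg _) (norm_nonneg _) two_ne_zero).1 ?_
    rw [WithLp.prod_norm_sq_eq_of_L2, WithLp.prod_norm_sq_eq_of_L2]
    exact congrArg (fun t => t ^ 2 + ‖v.snd‖ ^ 2) (V.norm_map v.fst)

/-- Associativity of the direct sum of Hilbert spaces, with the last two summands exchanged. -/
def shuffleIso (E F D : Type u) [NormedAddCommGroup E] [InnerProductSpace ℂ E]
    [NormedAddCommGroup F] [InnerProductSpace ℂ F] [NormedAddCommGroup D] [InnerProductSpace ℂ D] :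
    WithLp 2 (WithLp 2 (E × D) × F) ≃ₗᵢ[ℂ] WithLp 2 (WithLp 2 (E × F) × D) where
  toFun v := WithLp.toLp 2 (WithLp.toLp 2 (v.fst.fst, v.snd), v.fst.snd)
  invFun v := WithLp.toLp 2 (WithLp.toLp 2 (v.fst.fst, v.snd), v.fst.snd)
  left_inv _ := rfl
  right_inv _ := rfl
  map_add' _ _ := rfl
  map_smul' _ _ := rfl
  norm_map' v := by
    refine (pow_left_inj₀ (norm_nonneg _) (norm_nonneg _) two_ne_zero).1 ?_
    rw [WithLp.prod_norm_sq_eq_of_L2, WithLp.prod_norm_sq_eq_of_L2 v,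
      WithLp.prod_norm_sq_eq_of_L2 v.fst]
    have h := WithLp.prod_norm_sq_eq_of_L2 (WithLp.toLp 2 (v.fst.fst, v.snd))
    refine (congrArg (· + _) h).trans ?_
    exact add_right_comm _ _ _

theorem BulkRel.dsum_right {S S' : BulkSystem T X} (h : BulkRel S S') (R : BulkSystem T X) :
    (Quot.mk _ (S.dsum R) : TP T X) = Quot.mk _ (S'.dsum R) := by
  cases h with
  | iso _ _ V hV h =>
    exact Quot.sound (BulkRel.iso _ _ (sumIso R.M.H V)
      ⟨fun v => wext (hV.map_γ v.fst) rfl, fun g v => wext (hV.map_U g v.fst) rfl,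
        fun x v => wext (hV.map_proj x v.fst) rfl⟩ fun v => wext (h v.fst) rfl)
  | homotopy M h₀ h₁ mem₀ mem₁ path =>
    refine Quot.sound (BulkRel.homotopy (M.dsum R.M) _ _ _ _ ?_)
    obtain ⟨c, hc⟩ := path
    exact ⟨c.map (opSum_continuous R.ham), fun r => opSum_mem (hc r) R.mem⟩
  | stab _ P h =>
    refine (Quot.sound (BulkRel.stab (S.dsum R) P h)).trans (Quot.sound ?_)
    exact BulkRel.iso _ _ (shuffleIso S.M.H P.M.H R.M.H)
      ⟨fun _ => rfl, fun _ _ => rfl, fun _ _ => rfl⟩ fun _ => rfl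

/-- Addition of topological phases is the direct sum of systems. -/
instance : Add (TP T X) :=
  ⟨Quot.lift₂ (fun S S' => Quot.mk _ (S.dsum S'))
    (fun R S S' h => by
      rw [Quot.sound (BulkRel.swap R S), Quot.sound (BulkRel.swap R S')]
      exact h.dsum_right R)
    (fun _ _ R h => h.dsum_right R)⟩

end bulk

/-! ### Delone subsets and the K-groups of the uniform Roe algebra -/

/-- Delone subsets: uniformly discrete and relatively dense. -/
def IsDelone {M : Type u} [MetricSpace M] (X : Set M) : Prop :=
  (∃ r : ℝ, 0 < r ∧ ∀ m, (Metric.closedBall m r ∩ X).Subsingleton) ∧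
    ∃ R : ℝ, 0 < R ∧ ∀ m, (Metric.closedBall m R ∩ X).Nonempty

/-- Bounded geometry of a discrete metric space: the balls of each radius have uniformly bounded
cardinality. -/
def BoundedGeometry (X : Type u) [MetricSpace X] : Prop :=
  ∀ R : ℝ, ∃ N : ℕ, ∀ x : X, (Metric.closedBall x R).encard ≤ N

instance {G M : Type u} [Group G] [MetricSpace M] [MulAction G M] [IsIsometricSMul G M]
    (X : SubMulAction G M) : IsIsometricSMul G X :=
  ⟨fun g x y => isometry_smul M g x.1 y.1⟩

instance {G M : Type u} [Group G] [TopologicalSpace G] [MetricSpace M] [MulAction G M]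
    [ProperSMul G M] (X : SubMulAction G M) : ProperSMul G X where
  isProperMap_smul_pair := by
    have hc : Continuous fun gx : G × X => (gx.1, (gx.2 : M)) := by fun_prop
    have hf := ProperSMul.isProperMap_smul_pair (G := G) (X := M)
    rw [isProperMap_iff_ultrafilter] at hf ⊢
    have hcont : Continuous fun gx : G × X => (gx.1 • gx.2, gx.2) := by
      refine Continuous.prodMk (Continuous.subtype_mk (hf.1.fst.comp hc) _) continuous_snd
    refine ⟨hcont, fun 𝒰 y hy => ?_⟩
    obtain ⟨⟨g, m⟩, h1, h2⟩ := hf.2 (𝒰 := 𝒰.map fun gx : G × X => (gx.1, (gx.2 : M)))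
      (y := ((y.1 : M), (y.2 : M))) (by
        have hv : Continuous fun z : X × X => ((z.1 : M), (z.2 : M)) := by fun_prop
        exact (hv.tendsto y).comp hy)
    obtain ⟨e1, e2⟩ := Prod.ext_iff.1 h1
    obtain rfl : m = y.2 := e2
    refine ⟨(g, y.2), Prod.ext (Subtype.ext e1) rfl, ?_⟩
    have hi : Topology.IsInducing fun gx : G × X => (gx.1, (gx.2 : M)) :=
      Topology.IsInducing.id.prodMap Topology.IsInducing.subtypeVal
    rw [hi.nhds_eq_comap]
    exact Filter.tendsto_iff_comap.1 h2

section final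

variable {G : Type u} [Group G] [TopologicalSpace G] [DiscreteTopology G] [BoundedFiniteSubgroups G]
  {Q : Type v} [Group Q] {p : G →* Q} (hp : Function.Surjective p) (T : Twist Q)
  (X : Type u) [MetricSpace X] [MulAction G X] [IsIsometricSMul G X] [ProperSMul G X]

/-- The `G`-invariant uniform Roe algebra `C*_{u,G}(X)^Π`, `Π = ker p`. -/
abbrev uRoe (p : G →* Q) : StarSubalgebra ℂ ((HXG T p X).H →L[ℂ] (HXG T p X).H) := (HXG T p X).roe

/-- The algebra `c_b(X, 𝕂(ℋ_{X,G}))^Π`. -/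
abbrev cb (p : G →* Q) : StarSubalgebra ℂ ((HXG T p X).H →L[ℂ] (HXG T p X).H) := (HXG T p X).diag

/-- The `φ`-twisted action of `Q = G/Π` on `C*_{u,G}(X)^Π`. -/
abbrev uRoeAct : TwAction T.φ (uRoe T X p) := (HXG T p X).roeAction hp

/-- The `φ`-twisted action of `Q = G/Π` on `c_b(X, 𝕂(ℋ_{X,G}))^Π`. -/
abbrev cbAct : TwAction T.φ (cb T X p) := (HXG T p X).diagAction hp

/-- `^φK^Q_{0,c,τ}(C*_{u,G}(X)^Π)`. -/
abbrev K0Roe := K0 (T := T) (uRoeAct hp T X)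

/-- `^φK^Q_{0,c,τ}(c_b(X, 𝕂(ℋ_{X,G}))^Π)`. -/
abbrev K0Diag := K0 (T := T) (cbAct hp T X)

/-- The homomorphism `(ι_u)_*` induced by the inclusion `c_b(X, 𝕂(ℋ_{X,G}))^Π → C*_{u,G}(X)^Π`. -/
def iotaStar : K0Diag hp T X →+ K0Roe hp T X :=
  K0.map (StarSubalgebra.inclusion (HXG T p X).diag_le_roe) fun _ _ => rfl

end final

end CTP

end

set_option linter.unusedSectionVars false

noncomputable section

namespace CTP

open ContinuousLinearMap (adjoint)

/-! ### Operators of finite propagation between modules -/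

namespace UFModule

section propagation

variable {G : Type u} [Group G] {T T' T'' : Twist G} {X : Type u} [MulAction G X]
  (M : UFModule T X) (M' : UFModule T' X) (M'' : UFModule T'' X)

/-! The proof replaces the single algebra `C*_{u,G}(X)^Π` by all uniformly finite twisted modules at
once. Write `N` for `ℋ_{X,G}`. Matrices over the Roe algebra of `N`, indexed by a representation
`V`, are the elements of the Roe algebra of the module `N ⊗ V`, and the equivariance conditions
agree. So K-theory classes are represented by twisted invariant symmetries in the Roe algebras of
the modules `N ⊗ V`.

An even equivariant isometry `e : M → M'` of finite propagation (`Emb`) transports a symmetry `S` of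
`M` to `e S e* + γ(1 - e e*)` on `M'` (`Emb.push`). This contains the K-theoretic relation for `V ⊂
W` and the stabilisation of phases by a grading as special cases. Two isometries with orthogonal
ranges are joined by the rotation `cos t · a + sin t · b`. Call `N` absorbing if every twisted
module embeds into some `N ⊗ V`. Any two such embeddings become orthogonal in `N ⊗ (V ⊕ W)`, so
every symmetry of every module has a well-defined class (`fcls`), invariant under `push` and
additive. In particular, two absorbing modules over one space have isomorphic K-groups (`kEquiv`).

Absorption is proved in `exists_isometry`. Suitably weighted functionals on a module over `Z`,
attached to the base points of the orbits in `X`, are translated by `G` to the points of the free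
space `X̃`; the resulting coefficients form an isometry into a multiple of `ℓ²(X̃)`, tensored with a
multiple of the twisted regular representation of `Q` to absorb `c` and `τ`. The isometry is
supported in any prescribed `G`-invariant relation between `X` and `Z` with nonempty finite
sections, uniformly bounded on one side.

For (a), a Hamiltonian is sent to the class of its sign. Conversely a symmetry of the Roe algebra is
approximated by a controlled operator, averaged over `Q`; all Hamiltonians at distance less than one
from it lie in one phase (`aprx`). These constructions recover a Hamiltonian's phase from its class.
With the equality relation the isometry is block diagonal, which shows that the classes of block
diagonal symmetries of arbitrary modules are exactly the image of `ι_u` (`mem_range_iotaStar`).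
Those are the classes that stabilisation kills, and the quotient follows (`tpEquiv`).

For (b), `ℋ_{X,G}` and `ℋ_{Y,G}` are regarded as modules over `X ∪ Y`. This changes neither
operators nor Roe algebras. With the relation of being at distance at most `R`, where `R` is the
covering radius, both are absorbing over `X ∪ Y`, so their K-groups are isomorphic. -/

/-- The operator `A : M → M'` has propagation at most `R`. -/
def Propagation [MetricSpace X] (R : ℝ) (A : M.H →L[ℂ] M'.H) : Prop :=
  ∀ x y v, R < dist x y → M'.proj y (A (M.proj x v)) = 0

theorem controlled_iff [MetricSpace X] {S : M.H →L[ℂ] M.H} :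
    M.Controlled S ↔ ∃ R, M.Propagation M R S := by
  constructor
  · rintro ⟨R, -, h⟩
    exact ⟨R, fun x y v hxy => congrArg (fun A : M.H →L[ℂ] M.H => A v) (h x y hxy)⟩
  · rintro ⟨R, h⟩
    exact ⟨max R 1, lt_max_of_lt_right one_pos, fun x y hxy =>
      ContinuousLinearMap.ext fun v => h x y v ((le_max_left _ _).trans_lt hxy)⟩

theorem inner_proj (x : X) (v w : M.H) : inner ℂ (M.proj x v) w = inner ℂ v (M.proj x w) := by
  rw [← ContinuousLinearMap.adjoint_inner_right, ← ContinuousLinearMap.star_eq_adjoint,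
    (M.proj_star x).isSelfAdjoint.star_eq]

theorem inner_γ (v w : M.H) : inner ℂ (M.γ v) w = inner ℂ v (M.γ w) := by
  rw [← ContinuousLinearMap.adjoint_inner_right, ← ContinuousLinearMap.star_eq_adjoint,
    M.γ_star.star_eq]

theorem γ_γ (v : M.H) : M.γ (M.γ v) = v := congrArg (fun A : M.H →L[ℂ] M.H => A v) M.γ_sq

theorem γ_proj (x : X) (v : M.H) : M.γ (M.proj x v) = M.proj x (M.γ v) :=
  congrArg (fun A : M.H →L[ℂ] M.H => A v) (M.proj_γ x).eq

theorem proj_proj (x : X) (v : M.H) : M.proj x (M.proj x v) = M.proj x v :=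
  congrArg (fun A : M.H →L[ℂ] M.H => A v) (M.proj_star x).isIdempotentElem.eq

theorem proj_proj_of_ne {x y : X} (h : x ≠ y) (v : M.H) : M.proj x (M.proj y v) = 0 :=
  congrArg (fun A : M.H →L[ℂ] M.H => A v) (M.proj_orth x y h)

variable {M M' M''}

section metric
variable [MetricSpace X]

theorem Propagation.adjoint {R : ℝ} {A : M.H →L[ℂ] M'.H} (h : M.Propagation M' R A) :
    M'.Propagation M R (adjoint A) := by
  intro x y v hxy
  refine ext_inner_left ℂ fun w => ?_
  rw [← inner_proj, ContinuousLinearMap.adjoint_inner_right, ← inner_proj,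
    h y x w (by rwa [dist_comm]), inner_zero_left, inner_zero_right]

/-- A matrix coefficient of `B A` is the inner product of `B* w` with `A v`. If `x` and `y` are more
than `R + R'` apart, no `z` supports both vectors, so the coefficient vanishes by `inner_eq_zero`,
without expanding the product as a sum over `z`. -/
theorem Propagation.comp {R R' : ℝ} {A : M.H →L[ℂ] M'.H} {B : M'.H →L[ℂ] M''.H}
    (hB : M'.Propagation M'' R' B) (hA : M.Propagation M' R A) :
    M.Propagation M'' (R + R') (B ∘L A) := by
  intro x y v hxy
  refine ext_inner_left ℂ fun w => ?_
  rw [← inner_proj, ContinuousLinearMap.comp_apply, ← ContinuousLinearMap.adjoint_inner_left,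
    inner_zero_right]
  refine inner_eq_zero fun z => ?_
  by_cases hz : R < dist x z
  · exact Or.inr (hA x z v hz)
  · refine Or.inl (hB.adjoint y z w ?_)
    have := dist_triangle x z y
    have := not_lt.1 hz
    rw [dist_comm]
    linarith

theorem Propagation.mono {R R' : ℝ} (hR : R ≤ R') {A : M.H →L[ℂ] M'.H}
    (h : M.Propagation M' R A) : M.Propagation M' R' A :=
  fun x y v hxy => h x y v (hR.trans_lt hxy)

theorem Propagation.add {R R' : ℝ} {A B : M.H →L[ℂ] M'.H} (hA : M.Propagation M' R A)
    (hB : M.Propagation M' R' B) : M.Propagation M' (max R R') (A + B) := by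
  intro x y v hxy
  rw [add_apply, map_add, hA.mono (le_max_left _ _) x y v hxy,
    hB.mono (le_max_right _ _) x y v hxy, add_zero]

theorem Propagation.smul {R : ℝ} {A : M.H →L[ℂ] M'.H} (z : ℂ) (hA : M.Propagation M' R A) :
    M.Propagation M' R (z • A) := by
  intro x y v hxy
  rw [smul_apply, map_smul, hA x y v hxy, smul_zero]

theorem Controlled.smul {S : M.H →L[ℂ] M.H} (z : ℂ) (h : M.Controlled S) : M.Controlled (z • S) := by
  obtain ⟨R, h⟩ := M.controlled_iff.1 h
  exact M.controlled_iff.2 ⟨R, h.smul z⟩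

theorem controlled_γ : M.Controlled M.γ :=
  controlled_of_commute fun x => (M.proj_γ x).symm

theorem controlled_one : M.Controlled 1 := controlled_of_commute fun _ => Commute.one_right _

end metric

theorem twInvariant_iff {S : M.H →L[ℂ] M.H} :
    M.TwInvariant S ↔ ∀ g, M.ad g S = sgn (T.c g) • S := by
  constructor
  · intro h g
    ext v
    rw [ad_apply, h, AddEquiv.apply_symm_apply]; rfl
  · intro h g v
    have := congrArg (fun A : M.H →L[ℂ] M.H => A (M.U g v)) (h g)
    simpa [ad_apply] using this

theorem sg_ofReal (e : ℤˣ) (r : ℝ) : sg e (r : ℂ) = r := by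
  rcases Int.units_eq_one_or e with rfl | rfl <;> simp

theorem ad_ofReal_smul (g : G) (r : ℝ) (S : M.H →L[ℂ] M.H) :
    M.ad g ((r : ℂ) • S) = (r : ℂ) • M.ad g S := by
  rw [ad_smul, sg_ofReal]

end propagation

end UFModule

/-! ### Controlled equivariant isometries -/

section emb

variable {G : Type u} [Group G] {T : Twist G} {X : Type u} [MulAction G X] [MetricSpace X]

/-- Even equivariant isometries of finite propagation. -/
structure Emb (M M' : UFModule T X) where
  j : M.H →L[ℂ] M'.H
  isom : ∀ v, adjoint j (j v) = v
  even : ∀ v, j (M.γ v) = M'.γ (j v)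
  equiv : ∀ g v, j (M.U g v) = M'.U g (j v)
  ctl : ∃ R, M.Propagation M' R j

namespace Emb

variable {M M' M'' M₁ M₁' : UFModule T X} (e : Emb M M')

theorem adj_even (v : M'.H) : adjoint e.j (M'.γ v) = M.γ (adjoint e.j v) := by
  refine ext_inner_left ℂ fun w => ?_
  rw [ContinuousLinearMap.adjoint_inner_right, ← M'.inner_γ, ← e.even,
    ← ContinuousLinearMap.adjoint_inner_right, M.inner_γ]

theorem adj_equiv (g : G) (v : M'.H) : adjoint e.j (M'.U g v) = M.U g (adjoint e.j v) := by
  refine ext_inner_left ℂ fun w => ?_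
  obtain ⟨w, rfl⟩ := (M.U g).surjective w
  rw [ContinuousLinearMap.adjoint_inner_right, e.equiv, M'.inner_U, M.inner_U,
    ContinuousLinearMap.adjoint_inner_right]

/-- The extension of an operator on `M` to an operator on `M'`, by the grading of the orthogonal
complement. -/
def push (S : M.H →L[ℂ] M.H) : M'.H →L[ℂ] M'.H :=
  e.j ∘L S ∘L adjoint e.j + M'.γ ∘L (1 - e.j ∘L adjoint e.j)

theorem push_apply (S : M.H →L[ℂ] M.H) (v : M'.H) :
    e.push S v = e.j (S (adjoint e.j v)) + M'.γ (v - e.j (adjoint e.j v)) := rfl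

theorem push_continuous : Continuous e.push :=
  (continuous_const.clm_comp (continuous_id.clm_comp continuous_const)).add continuous_const

/-- `push` is not multiplicative: on the complement of the range a product of two extensions is `γ²
= 1`. Hence precisely relations of the form `S S' = 1` are inherited, which suffices for symmetries
and for invertibility. -/
theorem push_mul_eq_one {S S' : M.H →L[ℂ] M.H} (h : S * S' = 1) : e.push S * e.push S' = 1 := by
  ext v
  have h' : ∀ v, S (S' v) = v := fun v => congrArg (fun A : M.H →L[ℂ] M.H => A v) h
  change e.push S (e.push S' v) = v
  rw [push_apply, push_apply]
  simp [e.isom, h', e.adj_even, M'.γ_γ]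

theorem push_isUnit {S : M.H →L[ℂ] M.H} (h : IsUnit S) : IsUnit (e.push S) := by
  obtain ⟨B, h1, h2⟩ := isUnit_iff_exists.1 h
  exact isUnit_iff_exists.2 ⟨e.push B, e.push_mul_eq_one h1, e.push_mul_eq_one h2⟩

theorem push_selfAdjoint {S : M.H →L[ℂ] M.H} (h : IsSelfAdjoint S) : IsSelfAdjoint (e.push S) := by
  rw [ContinuousLinearMap.isSelfAdjoint_iff_isSymmetric] at h ⊢
  intro v w
  change inner ℂ (e.push S v) w = inner ℂ v (e.push S w)
  have h' : ∀ a b, inner ℂ (S a) b = inner ℂ a (S b) := h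
  have h1 : ∀ a b, inner ℂ (e.j a) b = inner ℂ a (adjoint e.j b) := fun a b =>
    (ContinuousLinearMap.adjoint_inner_right _ _ _).symm
  have h2 : ∀ a b, inner ℂ a (e.j b) = inner ℂ (adjoint e.j a) b := fun a b =>
    (ContinuousLinearMap.adjoint_inner_left _ _ _).symm
  rw [push_apply, push_apply, inner_add_left, inner_add_right, M'.inner_γ, map_sub, inner_sub_left,
    inner_sub_right, ← e.even, h1, h1, h2, h2, h', e.adj_even]

theorem push_twInvariant {S : M.H →L[ℂ] M.H} (h : M.TwInvariant S) : M'.TwInvariant (e.push S) := by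
  intro g v
  rw [push_apply, push_apply, map_add, ← e.equiv, h, e.adj_equiv, M'.U_γ, map_sub, ← e.equiv,
    map_smul, smul_add]

theorem push_controlled {S : M.H →L[ℂ] M.H} (h : M.Controlled S) : M'.Controlled (e.push S) := by
  obtain ⟨R, h⟩ := M.controlled_iff.1 h
  obtain ⟨R', h'⟩ := e.ctl
  have h1 : M'.Controlled (e.j ∘L S ∘L adjoint e.j) :=
    M'.controlled_iff.2 ⟨_, h'.comp (h.comp h'.adjoint)⟩
  have h2 : M'.Controlled (e.j ∘L adjoint e.j) := M'.controlled_iff.2 ⟨_, h'.comp h'.adjoint⟩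
  have h3 : (1 - e.j ∘L adjoint e.j) = 1 + (-1 : ℂ) • (e.j ∘L adjoint e.j) := by
    rw [neg_one_smul, sub_eq_add_neg]
  exact h1.add (UFModule.controlled_γ.mul (h3 ▸ UFModule.controlled_one.add (h2.smul _)))

/-- The grading on the complement cancels, so `push` is affine. It does not increase distances,
which lets approximations by Hamiltonians be transported. -/
theorem push_sub (S S' : M.H →L[ℂ] M.H) : e.push S - e.push S' = e.j ∘L (S - S') ∘L adjoint e.j := by
  ext v; simp [push_apply]

theorem norm_j_le : ‖e.j‖ ≤ 1 := by
  refine ContinuousLinearMap.opNorm_le_bound _ zero_le_one fun v => ?_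
  have h : ‖e.j v‖ ^ 2 = ‖v‖ ^ 2 := by
    have := inner_self_eq_norm_sq_to_K (𝕜 := ℂ) (e.j v)
    rw [← ContinuousLinearMap.adjoint_inner_right, e.isom, inner_self_eq_norm_sq_to_K] at this
    exact_mod_cast this.symm
  rw [one_mul, (pow_left_inj₀ (norm_nonneg _) (norm_nonneg _) two_ne_zero).1 h]

theorem norm_push_sub_le (S S' : M.H →L[ℂ] M.H) : ‖e.push S - e.push S'‖ ≤ ‖S - S'‖ := by
  rw [push_sub]
  have h1 := e.norm_j_le
  have h2 : ‖adjoint e.j‖ ≤ 1 := by rw [LinearIsometryEquiv.norm_map]; exact h1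
  calc _ ≤ ‖e.j‖ * (‖S - S'‖ * ‖adjoint e.j‖) :=
        (ContinuousLinearMap.opNorm_comp_le _ _).trans
          (mul_le_mul_of_nonneg_left (ContinuousLinearMap.opNorm_comp_le _ _) (norm_nonneg _))
    _ ≤ 1 * (‖S - S'‖ * 1) := by gcongr
    _ = _ := by ring

/-- The composite of two isometries. -/
def comp (f : Emb M' M'') (e : Emb M M') : Emb M M'' where
  j := f.j ∘L e.j
  isom v := by
    rw [ContinuousLinearMap.adjoint_comp]
    simp [f.isom, e.isom]
  even v := by simp [e.even, f.even]
  equiv g v := by simp [e.equiv, f.equiv]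
  ctl := by
    obtain ⟨R, h⟩ := e.ctl
    obtain ⟨R', h'⟩ := f.ctl
    exact ⟨_, h'.comp h⟩

/-- The complement of the range of `f e` is the complement of the range of `f` plus the image under
`f` of the complement of the range of `e`; since `f` is even, the gradings on the two pieces fit
together. -/
theorem comp_push (f : Emb M' M'') (e : Emb M M') (S : M.H →L[ℂ] M.H) :
    (f.comp e).push S = f.push (e.push S) := by
  ext v
  have h : adjoint (f.comp e).j v = adjoint e.j (adjoint f.j v) := by
    change adjoint (f.j ∘L e.j) v = _
    rw [ContinuousLinearMap.adjoint_comp]; rfl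
  have h' : ∀ v, (f.comp e).j v = f.j (e.j v) := fun _ => rfl
  simp only [push_apply, h, h', map_add, map_sub, ← f.even]
  abel

/-- The identity. -/
def refl (M : UFModule T X) : Emb M M where
  j := 1
  isom v := by
    change adjoint (1 : M.H →L[ℂ] M.H) v = v
    rw [← ContinuousLinearMap.star_eq_adjoint, star_one]; rfl
  even _ := rfl
  equiv _ _ := rfl
  ctl := M.controlled_iff.1 UFModule.controlled_one

theorem refl_push (S : M.H →L[ℂ] M.H) : (refl M).push S = S := by
  ext v
  have h : ∀ v, adjoint (refl M).j v = v := (refl M).isom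
  have h' : ∀ v, (refl M).j v = v := fun _ => rfl
  rw [push_apply, h, h', h', sub_self, map_zero, add_zero]

/-- An isomorphism of modules. -/
def ofIso (V : M.H ≃ₗᵢ[ℂ] M'.H) (hV : M.IsIso M' V) : Emb M M' where
  j := V.toLinearIsometry.toContinuousLinearMap
  isom v := by
    refine ext_inner_left ℂ fun w => ?_
    rw [ContinuousLinearMap.adjoint_inner_right]
    exact V.inner_map_map w v
  even := hV.map_γ
  equiv := hV.map_U
  ctl := ⟨0, fun x y v hxy => by
    change M'.proj y (V (M.proj x v)) = 0
    rw [hV.map_proj, M'.proj_proj_of_ne]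
    rintro rfl
    rw [dist_self] at hxy; exact lt_irrefl _ hxy⟩

theorem ofIso_push (V : M.H ≃ₗᵢ[ℂ] M'.H) (hV : M.IsIso M' V) (S : M.H →L[ℂ] M.H) (v : M.H) :
    (ofIso V hV).push S (V v) = V (S v) := by
  have h : adjoint (ofIso V hV).j (V v) = v := (ofIso V hV).isom v
  have h' : ∀ v, (ofIso V hV).j v = V v := fun _ => rfl
  rw [push_apply, h, h', h', sub_self, map_zero, add_zero]

/-- The inclusion of the first summand. -/
def inl (M M' : UFModule T X) : Emb M (M.dsum M') where
  j := (WithLp.prodContinuousLinearEquiv 2 ℂ M.H M'.H).symm.toContinuousLinearMap ∘L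
        (ContinuousLinearMap.inl ℂ M.H M'.H)
  isom v := by
    refine ext_inner_left ℂ fun w => ?_
    rw [ContinuousLinearMap.adjoint_inner_right]
    refine (WithLp.prod_inner_apply _ _).trans ?_
    change inner ℂ w v + inner ℂ (0 : M'.H) 0 = _
    rw [inner_zero_left, add_zero]
  even v := wext rfl (map_zero M'.γ).symm
  equiv g v := wext rfl (map_zero (M'.U g)).symm
  ctl := ⟨0, fun x y v hxy => by
    have hne : y ≠ x := by rintro rfl; rw [dist_self] at hxy; exact lt_irrefl _ hxy
    exact wext (M.proj_proj_of_ne hne v) (map_zero (M'.proj y))⟩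

/-- The inclusion of the second summand. -/
def inr (M M' : UFModule T X) : Emb M' (M.dsum M') where
  j := (WithLp.prodContinuousLinearEquiv 2 ℂ M.H M'.H).symm.toContinuousLinearMap ∘L
        (ContinuousLinearMap.inr ℂ M.H M'.H)
  isom v := by
    refine ext_inner_left ℂ fun w => ?_
    rw [ContinuousLinearMap.adjoint_inner_right]
    refine (WithLp.prod_inner_apply _ _).trans ?_
    change inner ℂ (0 : M.H) 0 + inner ℂ w v = _
    rw [inner_zero_left, zero_add]
  even v := wext (map_zero M.γ).symm rfl
  equiv g v := wext (map_zero (M.U g)).symm rfl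
  ctl := ⟨0, fun x y v hxy => by
    have hne : y ≠ x := by rintro rfl; rw [dist_self] at hxy; exact lt_irrefl _ hxy
    exact wext (map_zero (M.proj y)) (M'.proj_proj_of_ne hne v)⟩

theorem inl_adj (v : (M.dsum M').H) : adjoint (inl M M').j v = v.fst := by
  refine ext_inner_left ℂ fun w => ?_
  rw [ContinuousLinearMap.adjoint_inner_right]
  refine (WithLp.prod_inner_apply _ _).trans ?_
  change inner ℂ w v.fst + inner ℂ (0 : M'.H) v.snd = _
  rw [inner_zero_left, add_zero]

theorem inr_adj (v : (M.dsum M').H) : adjoint (inr M M').j v = v.snd := by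
  refine ext_inner_left ℂ fun w => ?_
  rw [ContinuousLinearMap.adjoint_inner_right]
  refine (WithLp.prod_inner_apply _ _).trans ?_
  change inner ℂ (0 : M.H) v.fst + inner ℂ w v.snd = _
  rw [inner_zero_left, zero_add]

/-- This links the two kinds of stabilisation: adding the trivial system with Hamiltonian `γ` is the
same as pushing along the inclusion of a summand. -/
theorem inl_push (S : M.H →L[ℂ] M.H) : (inl M M').push S = opSum S M'.γ := by
  ext v
  rw [push_apply, inl_adj]
  refine wext ?_ ?_
  · change S v.fst + M.γ (v.fst - v.fst) = S v.fst
    rw [sub_self, map_zero, add_zero]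
  · change 0 + M'.γ (v.snd - 0) = M'.γ v.snd
    rw [sub_zero, zero_add]

theorem inr_push (S : M'.H →L[ℂ] M'.H) : (inr M M').push S = opSum M.γ S := by
  ext v
  rw [push_apply, inr_adj]
  refine wext ?_ ?_
  · change 0 + M.γ (v.fst - 0) = M.γ v.fst
    rw [sub_zero, zero_add]
  · change S v.snd + M'.γ (v.snd - v.snd) = S v.snd
    rw [sub_self, map_zero, add_zero]

/-- The combination `cos t • a + sin t • b` of two isometries with orthogonal ranges. -/
def rot (a b : Emb M M') (h : ∀ v, adjoint a.j (b.j v) = 0) (t : ℝ) : Emb M M' where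
  j := (Real.cos t : ℂ) • a.j + (Real.sin t : ℂ) • b.j
  isom v := by
    have h' : ∀ v, adjoint b.j (a.j v) = 0 := fun v => by
      refine ext_inner_left ℂ fun w => ?_
      rw [ContinuousLinearMap.adjoint_inner_right, ← ContinuousLinearMap.adjoint_inner_left, h,
        inner_zero_left, inner_zero_right]
    have e : adjoint ((Real.cos t : ℂ) • a.j + (Real.sin t : ℂ) • b.j)
        = (Real.cos t : ℂ) • adjoint a.j + (Real.sin t : ℂ) • adjoint b.j := by
      rw [map_add, map_smulₛₗ, map_smulₛₗ, Complex.conj_ofReal, Complex.conj_ofReal]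
    rw [e]
    simp only [add_apply, smul_apply, map_add,
      map_smul, a.isom, b.isom, h, h', smul_zero, add_zero, zero_add, smul_smul, ← add_smul]
    have : (Real.cos t : ℂ) * Real.cos t + (Real.sin t : ℂ) * Real.sin t = 1 := by
      norm_cast
      have := Real.cos_sq_add_sin_sq t; nlinarith
    rw [this, one_smul]
  even v := by simp only [add_apply, smul_apply,
      map_add, map_smul, a.even, b.even]
  -- Real coefficients are essential here: `U g` may be antilinear, and only real scalars pass
  -- through it unchanged.
  equiv g v := by
    simp only [add_apply, smul_apply, map_add,
      M'.U_smul, UFModule.sg_ofReal, a.equiv, b.equiv]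
  ctl := by
    obtain ⟨R, ha⟩ := a.ctl
    obtain ⟨R', hb⟩ := b.ctl
    exact ⟨_, (ha.smul _).add (hb.smul _)⟩

theorem rot_continuous (a b : Emb M M') (h : ∀ v, adjoint a.j (b.j v) = 0) (S : M.H →L[ℂ] M.H) :
    Continuous fun t => (rot a b h t).push S := by
  have hj : Continuous fun t => (rot a b h t).j := by
    change Continuous fun t : ℝ => (Real.cos t : ℂ) • a.j + (Real.sin t : ℂ) • b.j
    fun_prop
  have hj' : Continuous fun t => adjoint (rot a b h t).j :=
    (LinearIsometryEquiv.continuous _).comp hj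
  exact (hj.clm_comp (continuous_const.clm_comp hj')).add
    (continuous_const.clm_comp (continuous_const.sub (hj.clm_comp hj')))

/-- The rotation consists of isometries of the same kind, so any property shared by all
push-forwards of `S` persists along it. Taking the property as the set `Y` lets one lemma serve both
symmetries and Hamiltonians. -/
theorem push_joinedIn (a b : Emb M M') (h : ∀ v, adjoint a.j (b.j v) = 0) {S : M.H →L[ℂ] M.H}
    {Y : Set (M'.H →L[ℂ] M'.H)} (hY : ∀ e : Emb M M', e.push S ∈ Y) :
    JoinedIn Y (a.push S) (b.push S) := by
  have h0 : (rot a b h 0).push S = a.push S := by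
    have : (rot a b h 0).j = a.j := by simp [rot]
    unfold push; rw [this]
  have h1 : (rot a b h (Real.pi / 2)).push S = b.push S := by
    have : (rot a b h (Real.pi / 2)).j = b.j := by simp [rot]
    unfold push; rw [this]
  refine ⟨⟨⟨fun r => (rot a b h (Real.pi / 2 * r)).push S, ?_⟩, ?_, ?_⟩, fun r => hY _⟩
  · exact (rot_continuous a b h S).comp (by fun_prop)
  · simpa using h0
  · simpa using h1

end Emb

end emb

/-! ### The sign of an invertible self-adjoint element -/

section sign

variable {A : Type w} [CStarAlgebra A]

/-- The sign function on the nonzero real numbers. -/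
def sgnFun (x : ℝ) : ℝ := x / |x|

theorem sgnFun_continuousOn : ContinuousOn sgnFun {x | x ≠ 0} :=
  continuousOn_id.div continuous_abs.continuousOn fun _ hx => abs_ne_zero.2 hx

theorem sgnFun_neg (x : ℝ) : sgnFun (-x) = -sgnFun x := by simp [sgnFun, neg_div]

theorem sgnFun_sq {x : ℝ} (h : x ≠ 0) : sgnFun x * sgnFun x = 1 := by
  have := abs_ne_zero.2 h
  rw [sgnFun, div_mul_div_comm, abs_mul_abs_self, div_self (mul_self_ne_zero.2 h)]

/-- The sign `a |a|⁻¹` of an invertible self-adjoint element. -/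
def sgnElt (a : A) : A := cfc sgnFun a

theorem spectrum_subset_ne_zero {a : A} (h : IsUnit a) : spectrum ℝ a ⊆ {x | x ≠ 0} := by
  rintro x hx rfl
  exact (spectrum.zero_notMem_iff ℝ).2 h hx

theorem sgnFun_continuousOn_spectrum {a : A} (h : IsUnit a) :
    ContinuousOn sgnFun (spectrum ℝ a) := sgnFun_continuousOn.mono (spectrum_subset_ne_zero h)

theorem sgnElt_selfAdjoint (a : A) : IsSelfAdjoint (sgnElt a) := cfc_predicate _ _

theorem sgnElt_sq {a : A} (ha : IsSelfAdjoint a) (h : IsUnit a) : sgnElt a * sgnElt a = 1 := by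
  have hc := sgnFun_continuousOn_spectrum h
  rw [sgnElt, ← cfc_mul _ _ a hc hc, ← cfc_const_one ℝ a]
  exact cfc_congr fun x hx => sgnFun_sq (spectrum_subset_ne_zero h hx)

theorem sgnElt_neg {a : A} (ha : IsSelfAdjoint a) (h : IsUnit a) : sgnElt (-a) = -sgnElt a := by
  have hc : ContinuousOn sgnFun ((fun x => -x) '' spectrum ℝ a) := by
    refine sgnFun_continuousOn.mono ?_
    rintro _ ⟨x, hx, rfl⟩
    exact neg_ne_zero.2 (spectrum_subset_ne_zero h hx)
  rw [sgnElt, sgnElt, ← cfc_comp_neg sgnFun a hc ha, ← cfc_neg]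
  exact cfc_congr fun x _ => sgnFun_neg x

theorem sgnElt_smul {a : A} (ha : IsSelfAdjoint a) (h : IsUnit a) {c : ℝ} (hc : 0 < c) :
    sgnElt ((c : ℂ) • a) = sgnElt a := by
  have hcont : ContinuousOn sgnFun ((fun x => c * x) '' spectrum ℝ a) := by
    refine sgnFun_continuousOn.mono ?_
    rintro _ ⟨x, hx, rfl⟩
    exact mul_ne_zero hc.ne' (spectrum_subset_ne_zero h hx)
  have e : (c : ℂ) • a = c • a := Complex.coe_smul c a
  rw [e, sgnElt, sgnElt, ← cfc_comp_const_mul c sgnFun a hcont ha]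
  refine cfc_congr fun x hx => ?_
  simp only [sgnFun, abs_mul, abs_of_pos hc]
  exact mul_div_mul_left _ _ hc.ne'

/-- Squaring maps the spectrum of `a` into that of `1`, so the spectrum lies in `{1, -1}`, where the
sign function is the identity. -/
theorem sgnElt_of_sq_eq_one {a : A} (ha : IsSelfAdjoint a) (h : a * a = 1) : sgnElt a = a := by
  have e : sgnElt a = cfc (fun x : ℝ => x) a := by
    refine cfc_congr fun x hx => ?_
    have h1 : x ^ 2 ∈ spectrum ℝ (a ^ 2) := by
      have := spectrum.pow_image_subset (𝕜 := ℝ) a 2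
      exact this ⟨x, hx, rfl⟩
    rw [pow_two a, h] at h1
    have hn : Nontrivial A := by
      by_contra hn
      rw [not_nontrivial_iff_subsingleton] at hn
      rw [spectrum.of_subsingleton] at hx
      exact hx
    rw [spectrum.one_eq, Set.mem_singleton_iff, pow_two] at h1
    rcases mul_self_eq_one_iff.1 h1 with rfl | rfl <;> simp [sgnFun]
  rw [e, cfc_id' ℝ a ha]

theorem sgnElt_mem {S : StarSubalgebra ℂ A} [IsClosed (S : Set A)] {a : A} (h : a ∈ S) :
    sgnElt a ∈ S := cfc_mem (𝕜' := ℂ) _ h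

/-- For a spectral value `x` one has `|c x - sgn x| = |c|x| - 1|`, which is less than one as soon as
`0 < c|x| < 2`; the bound on `c` gives `c|x| < 1`. The estimate holds for all small `c`, so that
finitely many operators can be treated with a common factor. -/
theorem exists_norm_smul_sub_sgnElt_lt {a : A} (ha : IsSelfAdjoint a) (h : IsUnit a) :
    ∃ c₀ : ℝ, 0 < c₀ ∧ ∀ c : ℝ, 0 < c → c ≤ c₀ → ‖(c : ℂ) • a - sgnElt a‖ < 1 := by
  have hC : 0 < ‖a‖ + 1 := by positivity
  refine ⟨(‖a‖ + 1)⁻¹, inv_pos.2 hC, fun c hc hc' => ?_⟩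
  have e : (c : ℂ) • a - sgnElt a = cfc (fun x : ℝ => c * x - sgnFun x) a := by
    rw [cfc_sub (fun x : ℝ => c * x) sgnFun a (by fun_prop)
      (sgnFun_continuousOn_spectrum h), cfc_const_mul_id _ a, sgnElt]
    exact congrArg (· - _) (Complex.coe_smul _ a)
  rw [e]
  refine norm_cfc_lt one_pos fun x hx => ?_
  have hx0 : x ≠ 0 := spectrum_subset_ne_zero h hx
  have hn : ‖x‖ ≤ ‖a‖ := by
    have := spectrum.norm_le_norm_mul_of_mem hx
    have h1 : ‖(1 : A)‖ ≤ 1 := by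
      rcases subsingleton_or_nontrivial A with hA | hA
      · simp [Subsingleton.elim (1 : A) 0]
      · exact CStarRing.norm_one.le
    nlinarith [norm_nonneg a]
  have e2 : c * x - sgnFun x = sgnFun x * (c * |x| - 1) := by
    have : |x| ≠ 0 := abs_ne_zero.2 hx0
    rw [sgnFun]; field_simp
  have e3 : ‖sgnFun x‖ = 1 := by
    rw [sgnFun, norm_div, Real.norm_eq_abs, Real.norm_eq_abs, abs_abs, div_self (abs_ne_zero.2 hx0)]
  rw [e2, norm_mul, e3, one_mul, Real.norm_eq_abs, abs_lt]
  have h1 : 0 < c * |x| := mul_pos hc (abs_pos.2 hx0)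
  have h2 : c * |x| < 1 := by
    refine (mul_le_mul_of_nonneg_right hc' (abs_nonneg x)).trans_lt ?_
    rw [inv_mul_lt_one₀ hC]
    rw [Real.norm_eq_abs] at hn; linarith
  constructor <;> linarith

theorem sgnElt_continuous {Y : Type*} [TopologicalSpace Y] {a : Y → A} (hc : Continuous a)
    (ha : ∀ y, IsSelfAdjoint (a y)) (h : ∀ y, IsUnit (a y)) : Continuous fun y => sgnElt (a y) := by
  refine Continuous.cfc_of_mem_nhdsSet (s := {x : ℝ | x ≠ 0}) sgnFun ?_ hc ha sgnFun_continuousOn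
  refine isOpen_ne.mem_nhdsSet.2 (Set.iUnion_subset fun y => spectrum_subset_ne_zero (h y))

/-- The map is only required to be real linear because conjugation by `U g` may be antilinear. The
functional calculus over `ℝ` does not see the difference. -/
theorem map_sgnElt (f : A → A) (hadd : ∀ a b, f (a + b) = f a + f b)
    (hmul : ∀ a b, f (a * b) = f a * f b) (hone : f 1 = 1) (hstar : ∀ a, f (star a) = star (f a))
    (hsmul : ∀ (r : ℝ) a, f ((r : ℂ) • a) = (r : ℂ) • f a) (hf : Continuous f) {a : A}
    (ha : IsSelfAdjoint a) (h : IsUnit a) : f (sgnElt a) = sgnElt (f a) := by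
  have hzero : f 0 = 0 := by simpa using hsmul 0 0
  let F : A →⋆ₐ[ℝ] A :=
    { toFun := f
      map_one' := hone
      map_mul' := hmul
      map_zero' := hzero
      map_add' := hadd
      commutes' := fun r => by
        have := hsmul r 1
        rw [hone] at this
        rw [Algebra.algebraMap_eq_smul_one, ← Complex.coe_smul]; exact this
      map_star' := hstar }
  have hF : IsSelfAdjoint (F a) := by
    rw [IsSelfAdjoint, ← map_star, ha.star_eq]
  exact F.map_cfc sgnFun a (sgnFun_continuousOn_spectrum h) hf ha hF

/-- The elements at distance less than one from a symmetry are invertible. -/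
theorem isUnit_of_norm_sub_lt {a s : A} (hs : s * s = 1) (h' : ‖s‖ ≤ 1) (h : ‖a - s‖ < 1) :
    IsUnit a := by
  have h1 : ‖1 - s * a‖ < 1 := by
    have e : 1 - s * a = -(s * (a - s)) := by rw [mul_sub, hs]; abel
    rw [e, norm_neg]
    calc _ ≤ ‖s‖ * ‖a - s‖ := norm_mul_le _ _
      _ ≤ 1 * ‖a - s‖ := by gcongr
      _ < 1 := by rwa [one_mul]
  have h2 : IsUnit (s * a) := by
    have := isUnit_one_sub_of_norm_lt_one h1
    rwa [sub_sub_cancel] at this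
  have h3 : a = s * (s * a) := by rw [← mul_assoc, hs, one_mul]
  have h4 : IsUnit s := isUnit_iff_exists.2 ⟨s, hs, hs⟩
  rw [h3]; exact h4.mul h2

theorem norm_le_one_of_symm {s : A} (h : IsSelfAdjoint s) (hs : s * s = 1) : ‖s‖ ≤ 1 := by
  have h1 := CStarRing.norm_star_mul_self (x := s)
  rw [h.star_eq, hs] at h1
  have h2 : ‖(1 : A)‖ ≤ 1 := by
    rcases subsingleton_or_nontrivial A with hA | hA
    · simp [Subsingleton.elim (1 : A) 0]
    · exact CStarRing.norm_one.le
  nlinarith [norm_nonneg s]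

end sign

/-! ### Symmetries in the Roe algebra -/

section symm

variable {G : Type u} [Group G] {Q : Type v} [Group Q] {T : Twist Q} {X : Type u} [MulAction G X]
  {p : G →* Q}

namespace UFModule

theorem ad_eq_of_map_eq {M : UFModule (T.comap p) X} {S : M.H →L[ℂ] M.H} (hS : S ∈ M.invAlg)
    {g h : G} (hgh : p g = p h) : M.ad g S = M.ad h S := by
  have e : g = h * (h⁻¹ * g) := by group
  rw [e, ad_mul, hS (h⁻¹ * g) (by simp [hgh])]

theorem TwInvariant.mem_invAlg {M : UFModule (T.comap p) X} {S : M.H →L[ℂ] M.H}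
    (h : M.TwInvariant S) : S ∈ M.invAlg := by
  intro g hg
  have : (T.comap p).c g = 1 := by simp [Twist.comap, hg]
  rw [twInvariant_iff.1 h g, this, sgn_one, one_smul]

variable [MetricSpace X]

theorem mem_roe {M : UFModule (T.comap p) X} {S : M.H →L[ℂ] M.H} (h : S ∈ M.invAlg)
    (h' : M.Controlled S) : S ∈ M.roe :=
  StarSubalgebra.le_topologicalClosure _ (show S ∈ M.algRoe from ⟨h, h', M.locallyCompact S⟩)

/-- Operators on uniformly finite modules are automatically locally compact, so a continuous map
that preserves invariance and control passes to the closures. All transport of Roe algebra elements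
between modules rests on this. -/
theorem mapsTo_roe {T' : Twist Q} {M : UFModule (T.comap p) X} {M' : UFModule (T'.comap p) X}
    {f : (M.H →L[ℂ] M.H) → (M'.H →L[ℂ] M'.H)} (hf : Continuous f)
    (h : ∀ S ∈ M.invAlg, f S ∈ M'.invAlg) (h' : ∀ S, M.Controlled S → M'.Controlled (f S))
    {S : M.H →L[ℂ] M.H} (hS : S ∈ M.roe) : f S ∈ M'.roe := by
  have hm : Set.MapsTo f (M.algRoe : Set (M.H →L[ℂ] M.H)) (M'.algRoe : Set _) :=
    fun S hS => ⟨h S hS.1, h' S hS.2.1, M'.locallyCompact _⟩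
  exact hm.closure hf hS

/-- Gapped `c`-twisted invariant self-adjoint elements of the Roe algebra. -/
def GSym (M : UFModule (T.comap p) X) : Set (M.H →L[ℂ] M.H) :=
  {S | S ∈ M.roe ∧ M.TwInvariant S ∧ IsSelfAdjoint S ∧ IsUnit S}

/-- `c`-twisted invariant symmetries in the Roe algebra. -/
def Sym (M : UFModule (T.comap p) X) : Set (M.H →L[ℂ] M.H) :=
  {S | S ∈ M.roe ∧ M.TwInvariant S ∧ IsSelfAdjoint S ∧ S * S = 1}

variable {M : UFModule (T.comap p) X} {S S' : M.H →L[ℂ] M.H}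

theorem sym_subset_gSym (M : UFModule (T.comap p) X) : M.Sym ⊆ M.GSym := fun S h =>
  ⟨h.1, h.2.1, h.2.2.1, isUnit_iff_exists.2 ⟨S, h.2.2.2, h.2.2.2⟩⟩

theorem γ_mem_sym (M : UFModule (T.comap p) X) : M.γ ∈ M.Sym :=
  ⟨mem_roe (TwInvariant.mem_invAlg M.U_γ) controlled_γ, M.U_γ, M.γ_star, M.γ_sq⟩

/-- The resolvent set is open, so if it contains zero it contains a whole interval around zero. -/
theorem gapped_iff : M.Gapped S ↔ IsUnit S := by
  rw [← spectrum.zero_notMem_iff ℂ]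
  constructor
  · rintro ⟨ε, hε, h⟩
    simpa using h 0 ⟨by linarith, hε.le⟩
  · intro h
    have hopen : IsOpen ((fun t : ℝ => (t : ℂ)) ⁻¹' (spectrum ℂ S)ᶜ) :=
      (spectrum.isClosed S).isOpen_compl.preimage Complex.continuous_ofReal
    obtain ⟨ε, hε, hb⟩ := Metric.isOpen_iff.1 hopen 0 (by simpa using h)
    refine ⟨ε / 2, half_pos hε, fun t ht => hb ?_⟩
    rw [mem_ball_zero_iff, Real.norm_eq_abs, abs_lt]
    constructor <;> linarith [ht.1, ht.2]

theorem mem_hamiltonians_iff : S ∈ M.Hamiltonians ↔ M.Controlled S ∧ S ∈ M.GSym := by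
  constructor
  · rintro ⟨h1, h2, h3, h4⟩
    exact ⟨h2, mem_roe h1.mem_invAlg h2, h1, h3, gapped_iff.1 h4⟩
  · rintro ⟨h1, _, h2, h3, h4⟩
    exact ⟨h2, h1, h3, gapped_iff.2 h4⟩

/-- Flattening respects the twist by `c` because the sign function is odd: an element `g` with `c(g)
≠ 0` takes `S` to `-S`, and the sign of `-S` is minus the sign of `S`. -/
theorem sgnElt_mem_sym (h : S ∈ M.GSym) : sgnElt S ∈ M.Sym := by
  obtain ⟨h1, h2, h3, h4⟩ := h
  refine ⟨sgnElt_mem h1, twInvariant_iff.2 fun g => ?_, sgnElt_selfAdjoint _, sgnElt_sq h3 h4⟩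
  rw [map_sgnElt (M.ad g) (M.ad_add g) (M.ad_times g) (M.ad_id g) (M.ad_star g)
    (M.ad_ofReal_smul g) (M.ad_continuous g) h3 h4, twInvariant_iff.1 h2]
  rcases Int.units_eq_one_or ((T.comap p).c g) with h | h
  · rw [h, sgn_one, one_smul, one_smul]
  · have e : sgn (-1) = -1 := by simp [sgn]
    rw [h, e, neg_one_smul, neg_one_smul, sgnElt_neg h3 h4]

theorem TwInvariant.ofReal_smul (r : ℝ) (h : M.TwInvariant S) : M.TwInvariant ((r : ℂ) • S) := by
  refine twInvariant_iff.2 fun g => ?_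
  rw [ad_ofReal_smul, twInvariant_iff.1 h, smul_comm]

theorem TwInvariant.add (h : M.TwInvariant S) (h' : M.TwInvariant S') : M.TwInvariant (S + S') := by
  refine twInvariant_iff.2 fun g => ?_
  rw [ad_add, twInvariant_iff.1 h, twInvariant_iff.1 h', smul_add]

theorem _root_.IsSelfAdjoint.ofReal_smul {A : Type*} [CStarAlgebra A] {a : A} (r : ℝ)
    (h : IsSelfAdjoint a) : IsSelfAdjoint ((r : ℂ) • a) := by
  rw [IsSelfAdjoint, star_smul, h.star_eq, Complex.star_def, Complex.conj_ofReal]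

theorem isUnit_ofReal_smul {A : Type*} [CStarAlgebra A] {a : A} {c : ℝ} (hc : c ≠ 0)
    (h : IsUnit a) : IsUnit ((c : ℂ) • a) := by
  rw [Algebra.smul_def]
  exact ((IsUnit.mk0 (c : ℂ) (by exact_mod_cast hc)).map (algebraMap ℂ A)).mul h

/-- The segment from `s` to `h`. -/
def seg (s h : M.H →L[ℂ] M.H) (r : ℝ) : M.H →L[ℂ] M.H := ((1 - r : ℝ) : ℂ) • s + (r : ℂ) • h

theorem seg_continuous (s h : M.H →L[ℂ] M.H) : Continuous (seg (M := M) s h) := by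
  unfold seg; fun_prop

theorem norm_seg_sub_lt {s h h' : M.H →L[ℂ] M.H} {d : ℝ} (hh : ‖h - s‖ < d) (hh' : ‖h' - s‖ < d)
    {r : ℝ} (h0 : 0 ≤ r) (h1 : r ≤ 1) : ‖seg (M := M) h h' r - s‖ < d := by
  have := (convex_ball s d) (mem_ball_iff_norm.2 hh) (mem_ball_iff_norm.2 hh')
    (sub_nonneg.2 h1) h0 (sub_add_cancel 1 r)
  rw [← Complex.coe_smul, ← Complex.coe_smul] at this
  exact mem_ball_iff_norm.1 this

theorem norm_le_one_of_mem_sym {s : M.H →L[ℂ] M.H} (hs : s ∈ M.Sym) : ‖s‖ ≤ 1 :=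
  norm_le_one_of_symm hs.2.2.1 hs.2.2.2

/-- The open unit ball around a symmetry is convex and consists of invertible elements, so segments
inside it never close the gap. -/
theorem seg_mem_gSym {s h h' : M.H →L[ℂ] M.H} (hs : s ∈ M.Sym) (hh : h ∈ M.GSym)
    (hh' : h' ∈ M.GSym) (d : ‖h - s‖ < 1) (d' : ‖h' - s‖ < 1) {r : ℝ} (h0 : 0 ≤ r) (h1 : r ≤ 1) :
    seg (M := M) h h' r ∈ M.GSym :=
  ⟨add_mem (SMulMemClass.smul_mem _ hh.1) (SMulMemClass.smul_mem _ hh'.1),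
    (hh.2.1.ofReal_smul _).add (hh'.2.1.ofReal_smul _),
    (hh.2.2.1.ofReal_smul _).add (hh'.2.2.1.ofReal_smul _),
    isUnit_of_norm_sub_lt hs.2.2.2 (norm_le_one_of_mem_sym hs) (norm_seg_sub_lt d d' h0 h1)⟩

theorem smul_mem_gSym {h : M.H →L[ℂ] M.H} (hh : h ∈ M.GSym) {c : ℝ} (hc : 0 < c) :
    (c : ℂ) • h ∈ M.GSym :=
  ⟨SMulMemClass.smul_mem _ hh.1, hh.2.1.ofReal_smul _, hh.2.2.1.ofReal_smul _,
    isUnit_ofReal_smul hc.ne' hh.2.2.2⟩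

theorem smul_mem_hamiltonians {h : M.H →L[ℂ] M.H} (hh : h ∈ M.Hamiltonians) {c : ℝ} (hc : 0 < c) :
    (c : ℂ) • h ∈ M.Hamiltonians := by
  rw [mem_hamiltonians_iff] at hh ⊢
  exact ⟨hh.1.smul _, smul_mem_gSym hh.2 hc⟩

/-- A symmetry is homotopic to the sign of each gapped element at distance less than one from it,
up to positive factors. -/
theorem joinedIn_sgnElt {s h : M.H →L[ℂ] M.H} (hs : s ∈ M.Sym) (hh : h ∈ M.GSym) {c : ℝ}
    (hc : 0 < c) (d : ‖(c : ℂ) • h - s‖ < 1) : JoinedIn M.Sym s (sgnElt h) := by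
  have hm : ∀ r : unitInterval, seg (M := M) s ((c : ℂ) • h) r ∈ M.GSym := fun r =>
    seg_mem_gSym hs (M.sym_subset_gSym hs) (smul_mem_gSym hh hc) (by simp) d r.2.1 r.2.2
  -- The path is the sign of the segment from `s` to `c h`. It starts at `s`, since the sign fixes
  -- symmetries, and ends at the sign of `h`, since the sign ignores positive factors.
  refine ⟨⟨⟨fun r => sgnElt (seg (M := M) s ((c : ℂ) • h) r), ?_⟩, ?_, ?_⟩,
    fun r => sgnElt_mem_sym (hm r)⟩
  · exact sgnElt_continuous ((seg_continuous _ _).comp continuous_subtype_val)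
      (fun r => (hm r).2.2.1) fun r => (hm r).2.2.2
  · simpa [seg] using sgnElt_of_sq_eq_one hs.2.2.1 hs.2.2.2
  · simpa [seg] using sgnElt_smul hh.2.2.1 hh.2.2.2 hc

theorem joinedIn_hamiltonians {s h h' : M.H →L[ℂ] M.H} (hs : s ∈ M.Sym) (hh : h ∈ M.Hamiltonians)
    (hh' : h' ∈ M.Hamiltonians) (d : ‖h - s‖ < 1) (d' : ‖h' - s‖ < 1) :
    JoinedIn M.Hamiltonians h h' := by
  rw [mem_hamiltonians_iff] at hh hh'
  refine ⟨⟨⟨fun r => seg (M := M) h h' r, ?_⟩, ?_, ?_⟩, fun r => mem_hamiltonians_iff.2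
    ⟨(hh.1.smul _).add (hh'.1.smul _), seg_mem_gSym hs hh.2 hh'.2 d d' r.2.1 r.2.2⟩⟩
  · exact (seg_continuous _ _).comp continuous_subtype_val
  · simp [seg]
  · simp [seg]

theorem joinedIn_smul {h : M.H →L[ℂ] M.H} (hh : h ∈ M.Hamiltonians) {c : ℝ} (hc : 0 < c) :
    JoinedIn M.Hamiltonians h ((c : ℂ) • h) := by
  have hpos : ∀ r : unitInterval, 0 < 1 - (r : ℝ) + r * c := fun r => by
    have h0 := r.2.1
    have h1 := r.2.2
    rcases h0.eq_or_lt with e | h0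
    · rw [← e]; norm_num
    · have := mul_pos h0 hc; linarith
  refine ⟨⟨⟨fun r => ((1 - r + r * c : ℝ) : ℂ) • h, by fun_prop⟩, by simp, by simp⟩,
    fun r => smul_mem_hamiltonians hh (hpos r)⟩

end UFModule

/-! ### Transport of symmetries and Hamiltonians along isometries. -/

namespace Emb

variable [MetricSpace X] {M M' : UFModule (T.comap p) X} (e : Emb M M')

theorem push_mem_invAlg {S : M.H →L[ℂ] M.H} (h : S ∈ M.invAlg) : e.push S ∈ M'.invAlg := by
  intro g hg
  -- The sign `c` is trivial on `Π`, so the grading on the complement is itself `Π`-invariant.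
  have hc : (T.comap p).c g = 1 := by simp [Twist.comap, hg]
  ext v
  obtain ⟨w, rfl⟩ := (M'.U g).surjective v
  have h1 : M.U g (S (adjoint e.j w)) = S (M.U g (adjoint e.j w)) := by
    have := congrArg (fun A : M.H →L[ℂ] M.H => A (M.U g (adjoint e.j w))) (h g hg)
    simpa [UFModule.ad_apply] using this
  rw [UFModule.ad_apply, AddEquiv.symm_apply_apply, push_apply, push_apply, map_add, ← e.equiv, h1,
    e.adj_equiv, M'.U_γ, hc, sgn_one, one_smul, map_sub, ← e.equiv]

theorem push_mem_roe {S : M.H →L[ℂ] M.H} (h : S ∈ M.roe) : e.push S ∈ M'.roe :=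
  UFModule.mapsTo_roe e.push_continuous (fun _ => e.push_mem_invAlg)
    (fun _ => e.push_controlled) h

theorem push_mem_sym {S : M.H →L[ℂ] M.H} (h : S ∈ M.Sym) : e.push S ∈ M'.Sym :=
  ⟨e.push_mem_roe h.1, e.push_twInvariant h.2.1, e.push_selfAdjoint h.2.2.1,
    e.push_mul_eq_one h.2.2.2⟩

theorem push_mem_gSym {S : M.H →L[ℂ] M.H} (h : S ∈ M.GSym) : e.push S ∈ M'.GSym :=
  ⟨e.push_mem_roe h.1, e.push_twInvariant h.2.1, e.push_selfAdjoint h.2.2.1, e.push_isUnit h.2.2.2⟩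

theorem push_mem_hamiltonians {S : M.H →L[ℂ] M.H} (h : S ∈ M.Hamiltonians) :
    e.push S ∈ M'.Hamiltonians := by
  rw [UFModule.mem_hamiltonians_iff] at h ⊢
  exact ⟨e.push_controlled h.1, e.push_mem_gSym h.2⟩

theorem push_joinedIn_sym {S S' : M.H →L[ℂ] M.H} (h : JoinedIn M.Sym S S') :
    JoinedIn M'.Sym (e.push S) (e.push S') := by
  obtain ⟨c, hc⟩ := h
  exact ⟨c.map e.push_continuous, fun r => e.push_mem_sym (hc r)⟩

end Emb

end symm

/-! ### Approximation of symmetries by Hamiltonians -/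

section approx

variable {G : Type u} [Group G] {Q : Type v} [Group Q] [Finite Q] {T : Twist Q} {X : Type u}
  [MulAction G X] {p : G →* Q} [MetricSpace X] [IsIsometricSMul G X]

namespace UFModule

/-- A controlled `Π`-invariant operator near `s` is made twisted invariant by the average `b` over
`Q` with signs `(-1)^{c(q)}`, and then self-adjoint by taking the real part. Both operations fix `s`
and are contractive, so the distance to `s` does not grow. Control survives because `G` acts
isometrically and `Q` is finite. -/
theorem exists_hamiltonian_near (hp : Function.Surjective p) (M : UFModule (T.comap p) X)
    {s : M.H →L[ℂ] M.H} (hs : s ∈ M.Sym) {ε : ℝ} (hε : 0 < ε) (hε' : ε ≤ 1) :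
    ∃ h ∈ M.Hamiltonians, ‖h - s‖ < ε := by
  have := Fintype.ofFinite Q
  obtain ⟨a, ha, hda⟩ := Metric.mem_closure_iff.1 (show s ∈ closure (M.algRoe : Set _) from hs.1) ε hε
  rw [dist_comm, dist_eq_norm] at hda
  have hinv : a ∈ M.invAlg := ha.1
  let sec := Function.surjInv hp
  have hsec : ∀ q, p (sec q) = q := Function.surjInv_eq hp
  let n : ℝ := Fintype.card Q
  have hn : 0 < n := Nat.cast_pos.2 Fintype.card_pos
  let b : (M.H →L[ℂ] M.H) → (M.H →L[ℂ] M.H) := fun x =>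
    ((n⁻¹ : ℝ) : ℂ) • ∑ q, sgn (T.c q) • M.ad (sec q) x
  have ad_sum : ∀ g (f : Q → M.H →L[ℂ] M.H), M.ad g (∑ q, f q) = ∑ q, M.ad g (f q) := fun g f =>
    map_sum (AddMonoidHom.mk' (M.ad g) (M.ad_add g)) f _
  have ctl_sum : ∀ (t : Finset Q) (f : Q → M.H →L[ℂ] M.H), (∀ q, M.Controlled (f q)) →
      M.Controlled (∑ q ∈ t, f q) := fun t f hf => by
    classical
    induction t using Finset.induction_on with
    | empty => simpa using (controlled_one (M := M)).smul 0
    | insert q t hq ih => rw [Finset.sum_insert hq]; exact (hf q).add ih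
  have hbs : b s = s := by
    have : ∀ q, sgn (T.c q) • M.ad (sec q) s = s := fun q => by
      have h1 : (T.comap p).c (sec q) = T.c q := congrArg T.c (hsec q)
      rw [twInvariant_iff.1 hs.2.1, h1, smul_smul, sgn_mul_self, one_smul]
    simp only [b, this, Finset.sum_const, Finset.card_univ]
    rw [← Nat.cast_smul_eq_nsmul ℂ, smul_smul]
    have : ((n⁻¹ : ℝ) : ℂ) * (Fintype.card Q : ℂ) = 1 := by
      simp [n]
    rw [this, one_smul]
  have ad_sub : ∀ g x y, M.ad g (x - y) = M.ad g x - M.ad g y := fun g x y =>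
    map_sub (AddMonoidHom.mk' (M.ad g) (M.ad_add g)) x y
  have hsg : ∀ e, ‖sgn e‖ = 1 := fun e => by
    rcases Int.units_eq_one_or e with rfl | rfl <;> simp [sgn]
  have hbd : ‖b a - s‖ ≤ ‖a - s‖ := by
    have e : b a - b s = ((n⁻¹ : ℝ) : ℂ) • ∑ q, sgn (T.c q) • M.ad (sec q) (a - s) := by
      simp only [b, ad_sub, smul_sub, Finset.sum_sub_distrib]
    rw [← hbs, e, norm_smul, hbs]
    have h1 : ‖∑ q, sgn (T.c q) • M.ad (sec q) (a - s)‖ ≤ n * ‖a - s‖ := by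
      refine (norm_sum_le_of_le _ (f := fun q => sgn (T.c q) • M.ad (sec q) (a - s))
        (n := fun _ => ‖a - s‖) fun q _ => ?_).trans_eq ?_
      · rw [norm_smul, hsg, one_mul]
        exact M.ad_norm_le _ _
      · rw [Finset.sum_const, Finset.card_univ, nsmul_eq_mul]
    have h2 : ‖((n⁻¹ : ℝ) : ℂ)‖ = n⁻¹ := by
      rw [Complex.norm_real, Real.norm_of_nonneg (inv_pos.2 hn).le]
    rw [h2]
    calc _ ≤ n⁻¹ * (n * ‖a - s‖) := mul_le_mul_of_nonneg_left h1 (inv_pos.2 hn).le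
      _ = _ := by rw [← mul_assoc, inv_mul_cancel₀ hn.ne', one_mul]
  have hbt : M.TwInvariant (b a) := by
    refine twInvariant_iff.2 fun g => ?_
    simp only [b]
    rw [ad_ofReal_smul, ad_sum, smul_comm]
    congr 1
    rw [Finset.smul_sum]
    rw [← Equiv.sum_comp (Equiv.mulLeft (p g)) (fun q => sgn ((T.comap p).c g) •
      sgn (T.c q) • M.ad (sec q) a)]
    refine Finset.sum_congr rfl fun q _ => ?_
    have h1 : (T.comap p).c g = T.c (p g) := rfl
    have h2 : M.ad (sec (p g * q)) a = M.ad (g * sec q) a :=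
      ad_eq_of_map_eq hinv (by simp [hsec])
    rw [ad_smul, sg_sgn, Equiv.coe_mulLeft, h2, ad_mul, h1, map_mul, sgn_mul, smul_smul, ← mul_assoc,
      sgn_mul_self, one_mul]
  -- The section `sec` is not a homomorphism; in the preceding computation this did not matter
  -- because two lifts of an element of `Q` differ by an element of `Π`, under which `a` is
  -- invariant.
  have hbc : M.Controlled (b a) := (ctl_sum _ _ fun q => (ha.2.1.ad (sec q)).smul _).smul _
  let h : M.H →L[ℂ] M.H := ((2⁻¹ : ℝ) : ℂ) • (b a + star (b a))
  have hst : M.TwInvariant (star (b a)) := by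
    refine twInvariant_iff.2 fun g => ?_
    rw [ad_star, twInvariant_iff.1 hbt, star_smul, star_sgn]
  have hd : ‖h - s‖ < ε := by
    have h1 : h - s = ((2⁻¹ : ℝ) : ℂ) • ((b a - s) + star (b a - s)) := by
      rw [star_sub, hs.2.2.1.star_eq]
      simp only [h]
      have h3 : s = ((2⁻¹ : ℝ) : ℂ) • (s + s) := by
        rw [← two_smul ℂ s, smul_smul]; simp
      nth_rewrite 1 [h3]
      rw [← smul_sub]; congr 1; abel
    have h2 : ‖((2⁻¹ : ℝ) : ℂ)‖ = 2⁻¹ := by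
      rw [Complex.norm_real, Real.norm_of_nonneg (by norm_num)]
    rw [h1, norm_smul, h2]
    have h3 := norm_add_le (b a - s) (star (b a - s))
    rw [norm_star] at h3
    linarith
  refine ⟨h, mem_hamiltonians_iff.2 ?_, hd⟩
  have hc : M.Controlled h := (hbc.add hbc.star).smul _
  have ht : M.TwInvariant h := (hbt.add hst).ofReal_smul _
  exact ⟨hc, mem_roe ht.mem_invAlg hc, ht, (IsSelfAdjoint.add_star_self _).ofReal_smul _,
    isUnit_of_norm_sub_lt hs.2.2.2 (norm_le_one_of_mem_sym hs) (hd.trans_le hε')⟩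

end UFModule

end approx

/-! ### Matrices of operators -/

section mop

variable {E : Type u} [NormedAddCommGroup E] [InnerProductSpace ℂ E]
  {l m n : Type} [Fintype l] [DecidableEq l] [Fintype m] [DecidableEq m] [Fintype n] [DecidableEq n]

/-- The inclusion of the `i`-th summand of `E ⊗ ℂ^m`. -/
def inclE (E : Type u) [NormedAddCommGroup E] [InnerProductSpace ℂ E] {m : Type} [Fintype m]
    [DecidableEq m] (i : m) : E →L[ℂ] PiLp 2 (fun _ : m => E) :=
  (PiLp.continuousLinearEquiv 2 ℂ (fun _ : m => E)).symm.toContinuousLinearMap ∘L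
    ContinuousLinearMap.single ℂ (fun _ : m => E) i

/-- The projection onto the `i`-th summand of `E ⊗ ℂ^m`. -/
def projE (E : Type u) [NormedAddCommGroup E] [InnerProductSpace ℂ E] {m : Type} [Fintype m]
    (i : m) : PiLp 2 (fun _ : m => E) →L[ℂ] E := PiLp.proj 2 (fun _ : m => E) i

theorem inclE_apply (i k : m) (v : E) : inclE E i v k = if k = i then v else 0 := by
  change (Pi.single i v : m → E) k = _
  by_cases h : k = i
  · subst h; simp
  · simp [h]

theorem projE_apply (i : m) (v : PiLp 2 (fun _ : m => E)) : projE E i v = v i := rfl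

/-- The operator with a given matrix of operators. -/
def mop (A : Matrix m n (E →L[ℂ] E)) : PiLp 2 (fun _ : n => E) →L[ℂ] PiLp 2 (fun _ : m => E) :=
  ∑ i, ∑ k, inclE E i ∘L A i k ∘L projE E k

theorem mop_apply (A : Matrix m n (E →L[ℂ] E)) (v : PiLp 2 (fun _ : n => E)) (i : m) :
    mop A v i = ∑ k, A i k (v k) := by
  have h : mop A v i = projE E i (mop A v) := rfl
  rw [h, mop, _root_.sum_apply, map_sum]
  rw [Finset.sum_eq_single i]
  · rw [_root_.sum_apply, map_sum]
    refine Finset.sum_congr rfl fun k _ => ?_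
    change inclE E i (A i k (v k)) i = _
    rw [inclE_apply, if_pos rfl]
  · intro j _ hj
    rw [_root_.sum_apply, map_sum]
    refine Finset.sum_eq_zero fun k _ => ?_
    change inclE E j (A j k (v k)) i = _
    rw [inclE_apply, if_neg hj.symm]
  · intro h; exact absurd (Finset.mem_univ i) h

/-- The matrix of an operator. -/
def mat (S : PiLp 2 (fun _ : n => E) →L[ℂ] PiLp 2 (fun _ : m => E)) : Matrix m n (E →L[ℂ] E) :=
  fun i k => projE E i ∘L S ∘L inclE E k

theorem mat_apply (S : PiLp 2 (fun _ : n => E) →L[ℂ] PiLp 2 (fun _ : m => E)) (i : m) (k : n)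
    (v : E) : mat S i k v = S (inclE E k v) i := rfl

theorem mat_mop (A : Matrix m n (E →L[ℂ] E)) : mat (mop A) = A := by
  ext i k v
  rw [mat_apply, mop_apply, Finset.sum_eq_single k]
  · rw [inclE_apply, if_pos rfl]
  · intro j _ hj; rw [inclE_apply, if_neg hj, map_zero]
  · intro h; exact absurd (Finset.mem_univ k) h

theorem sum_inclE (v : PiLp 2 (fun _ : n => E)) : ∑ k, inclE E k (v k) = v := by
  ext i
  have h : (∑ k, inclE E k (v k)) i = projE E i (∑ k, inclE E k (v k)) := rfl
  rw [h, map_sum]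
  simp [projE_apply, inclE_apply]

theorem mop_mat (S : PiLp 2 (fun _ : n => E) →L[ℂ] PiLp 2 (fun _ : m => E)) : mop (mat S) = S := by
  ext v i
  rw [mop_apply]
  nth_rewrite 2 [← sum_inclE v]
  rw [map_sum]
  have h : (∑ k, S (inclE E k (v k))) i = projE E i (∑ k, S (inclE E k (v k))) := rfl
  rw [h, map_sum]
  rfl

theorem mop_mul (A : Matrix l m (E →L[ℂ] E)) (B : Matrix m n (E →L[ℂ] E)) :
    mop (A * B) = mop A ∘L mop B := by
  ext v i
  rw [mop_apply, ContinuousLinearMap.comp_apply, mop_apply]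
  simp only [Matrix.mul_apply, mop_apply, _root_.sum_apply, map_sum]
  rw [Finset.sum_comm]
  rfl

theorem mop_one : mop (1 : Matrix n n (E →L[ℂ] E)) = 1 := by
  ext v i
  rw [mop_apply, Finset.sum_eq_single i]
  · rw [Matrix.one_apply_eq]; rfl
  · intro k _ hk; rw [Matrix.one_apply_ne hk.symm]; rfl
  · intro h; exact absurd (Finset.mem_univ i) h

theorem mop_add (A B : Matrix m n (E →L[ℂ] E)) : mop (A + B) = mop A + mop B := by
  ext v i
  rw [mop_apply]
  change _ = mop A v i + mop B v i
  simp only [mop_apply, Matrix.add_apply, add_apply, Finset.sum_add_distrib]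

theorem mop_smul (z : ℂ) (A : Matrix m n (E →L[ℂ] E)) : mop (z • A) = z • mop A := by
  ext v i
  rw [mop_apply]
  change _ = z • mop A v i
  simp only [mop_apply, Matrix.smul_apply, smul_apply, Finset.smul_sum]

theorem mop_zero : mop (0 : Matrix m n (E →L[ℂ] E)) = 0 := by
  ext v i
  rw [mop_apply]
  exact Finset.sum_eq_zero fun _ _ => rfl

theorem mop_continuous : Continuous (mop (E := E) (m := m) (n := n)) := by
  refine continuous_finsetSum _ fun i _ => continuous_finsetSum _ fun k _ => ?_
  exact continuous_const.clm_comp ((continuous_id.matrix_elem i k).clm_comp continuous_const)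

theorem mat_continuous : Continuous (mat (E := E) (m := m) (n := n)) :=
  continuous_matrix fun _ _ => continuous_const.clm_comp (continuous_id.clm_comp continuous_const)

theorem mop_star [CompleteSpace E] (A : Matrix m n (E →L[ℂ] E)) : mop Aᴴ = adjoint (mop A) := by
  refine (ContinuousLinearMap.eq_adjoint_iff _ _).2 fun v w => ?_
  rw [PiLp.inner_apply, PiLp.inner_apply]
  simp only [mop_apply, sum_inner, inner_sum, Matrix.conjTranspose_apply]
  rw [Finset.sum_comm]
  refine Finset.sum_congr rfl fun i _ => Finset.sum_congr rfl fun k _ => ?_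
  rw [ContinuousLinearMap.star_eq_adjoint, ContinuousLinearMap.adjoint_inner_left]

theorem mop_lift_apply [CompleteSpace E] (M : Matrix m n ℂ) (v : PiLp 2 (fun _ : n => E)) (i : m) :
    mop (lift (E →L[ℂ] E) M) v i = ∑ k, M i k • v k := by
  rw [mop_apply]
  refine Finset.sum_congr rfl fun k _ => ?_
  change (algebraMap ℂ (E →L[ℂ] E) (M i k)) (v k) = _
  rw [Algebra.algebraMap_eq_smul_one]; rfl

theorem mop_lift_mul_apply [CompleteSpace E] (M : Matrix l m ℂ) (N : Matrix m n ℂ)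
    (v : PiLp 2 (fun _ : n => E)) :
    mop (lift (E →L[ℂ] E) M) (mop (lift (E →L[ℂ] E) N) v) = mop (lift (E →L[ℂ] E) (M * N)) v := by
  rw [lift_mul, mop_mul]; rfl

theorem mop_lift_one_apply [CompleteSpace E] (v : PiLp 2 (fun _ : n => E)) :
    mop (lift (E →L[ℂ] E) (1 : Matrix n n ℂ)) v = v := by
  rw [lift_one, mop_one]; rfl

theorem norm_mop_lift_apply [CompleteSpace E] {M : Matrix m n ℂ} (h : Mᴴ * M = 1)
    (v : PiLp 2 (fun _ : n => E)) : ‖mop (lift (E →L[ℂ] E) M) v‖ = ‖v‖ := by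
  have h1 : inner ℂ (mop (lift (E →L[ℂ] E) M) v) (mop (lift (E →L[ℂ] E) M) v) = inner ℂ v v := by
    rw [← ContinuousLinearMap.adjoint_inner_right, ← mop_star, ← lift_star, mop_lift_mul_apply, h,
      mop_lift_one_apply]
  rw [inner_self_eq_norm_sq_to_K, inner_self_eq_norm_sq_to_K] at h1
  exact (pow_left_inj₀ (norm_nonneg _) (norm_nonneg _) two_ne_zero).1 (by exact_mod_cast h1)

/-- The operator `S ⊗ 1`. -/
def diagOp (n : Type) [Fintype n] [DecidableEq n] (S : E →L[ℂ] E) :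
    PiLp 2 (fun _ : n => E) →L[ℂ] PiLp 2 (fun _ : n => E) :=
  mop (Matrix.diagonal fun _ => S)

theorem diagOp_apply (S : E →L[ℂ] E) (v : PiLp 2 (fun _ : n => E)) (i : n) :
    diagOp n S v i = S (v i) := by
  rw [diagOp, mop_apply, Finset.sum_eq_single i]
  · rw [Matrix.diagonal_apply_eq]
  · intro k _ hk; rw [Matrix.diagonal_apply_ne _ hk.symm]; rfl
  · intro h; exact absurd (Finset.mem_univ i) h

end mop

/-! ### The tensor product of a module with a finite dimensional representation -/

theorem MatRep.u_unitary' {Q : Type v} [Group Q] {T : Twist Q} (V : MatRep T) (q : Q) :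
    (V.u q)ᴴ * V.u q = 1 := mul_eq_one_comm.1 (V.u_unitary q)

/-- The cocycle is not normalised, so `u 1` is only a scalar of modulus one. Conjugation by it is
trivial, which is all that is needed for the elements of `Π`. -/
theorem MatRep.u_one {Q : Type v} [Group Q] {T : Twist Q} (V : MatRep T) :
    V.u 1 = (T.τ 1 1 : ℂ) • 1 := by
  have h := V.u_mul 1 1
  have e : (V.u 1).map (sg (T.φ 1)) = V.u 1 := by ext i k; simp
  rw [e, mul_one] at h
  have h2 := congrArg (· * (V.u 1)ᴴ) h
  simp only [Matrix.mul_assoc, V.u_unitary, Matrix.smul_mul, mul_one] at h2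
  exact h2

section tens

variable {G : Type u} [Group G] {Q : Type v} [Group Q] {T : Twist Q} {X : Type u} [MulAction G X]
  {p : G →* Q} (N : UFModule (T.phiOnly.comap p) X)

namespace UFModule

theorem U_smul' (g : G) (z : ℂ) (v : N.H) : N.U g (z • v) = sg (T.φ (p g)) z • N.U g v :=
  N.U_smul g z v

theorem U_mul' (g h : G) (v : N.H) : N.U g (N.U h v) = N.U (g * h) v := by
  rw [N.U_mul]
  change ((1 : Circle) : ℂ) • _ = _
  rw [Circle.coe_one, one_smul]

/-- The action `U_g ⊗ 1`, conjugate linear in the second factor according to `φ`. -/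
def pointU (n : Type) (g : G) : PiLp 2 (fun _ : n => N.H) ≃+ PiLp 2 (fun _ : n => N.H) where
  toFun v := WithLp.toLp 2 fun i => N.U g (v i)
  invFun v := WithLp.toLp 2 fun i => (N.U g).symm (v i)
  left_inv v := by ext i; simp
  right_inv v := by ext i; simp
  map_add' v w := by ext i; simp

theorem pointU_apply {n : Type} (g : G) (v : PiLp 2 (fun _ : n => N.H)) (i : n) :
    N.pointU n g v i = N.U g (v i) := rfl

theorem pointU_mop_lift {m n : Type} [Fintype m] [DecidableEq m] [Fintype n] [DecidableEq n] (g : G)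
    (M : Matrix m n ℂ) (v : PiLp 2 (fun _ : n => N.H)) :
    N.pointU m g (mop (lift _ M) v)
      = mop (lift _ (M.map (sg (T.φ (p g))))) (N.pointU n g v) := by
  ext i
  rw [pointU_apply, mop_lift_apply, mop_lift_apply, map_sum]
  refine Finset.sum_congr rfl fun k _ => ?_
  rw [N.U_smul']; rfl

theorem pointU_mop {m n : Type} [Fintype m] [DecidableEq m] [Fintype n] [DecidableEq n] (g : G)
    (A : Matrix m n (N.H →L[ℂ] N.H)) (v : PiLp 2 (fun _ : n => N.H)) :
    N.pointU m g (mop A v) = mop (A.map (N.ad g)) (N.pointU n g v) := by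
  ext i
  rw [pointU_apply, mop_apply, mop_apply, map_sum]
  refine Finset.sum_congr rfl fun k _ => ?_
  rw [Matrix.map_apply, pointU_apply, ad_apply, AddEquiv.symm_apply_apply]

theorem norm_pointU {n : Type} [Fintype n] (g : G) (v : PiLp 2 (fun _ : n => N.H)) :
    ‖N.pointU n g v‖ = ‖v‖ := by
  rw [PiLp.norm_eq_of_L2, PiLp.norm_eq_of_L2]
  simp only [pointU_apply, N.U_norm]

/-- The tensor product `N ⊗ V` of a `φ`-twisted module with a `(φ, c, τ)`-twisted representation. -/
def tens (V : MatRep T) : UFModule (T.comap p) X where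
  H := PiLp 2 (fun _ : V.ι => N.H)
  γ := mop (lift _ V.Γ)
  γ_star := by
    rw [IsSelfAdjoint, ContinuousLinearMap.star_eq_adjoint, ← mop_star, ← lift_star, V.Γ_star]
  γ_sq := by
    refine (mop_mul _ _).symm.trans ?_
    rw [← lift_mul, V.Γ_sq, lift_one, mop_one]
  U g :=
    { toFun := fun v => mop (lift _ (V.u (p g))) (N.pointU V.ι g v)
      invFun := fun v => (N.pointU V.ι g).symm (mop (lift _ (V.u (p g))ᴴ) v)
      left_inv := fun v => by
        change (N.pointU V.ι g).symm (mop _ (mop _ (N.pointU V.ι g v))) = v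
        rw [mop_lift_mul_apply, V.u_unitary', mop_lift_one_apply, AddEquiv.symm_apply_apply]
      right_inv := fun v => by
        change mop _ (N.pointU V.ι g ((N.pointU V.ι g).symm (mop _ v))) = v
        rw [AddEquiv.apply_symm_apply, mop_lift_mul_apply, V.u_unitary, mop_lift_one_apply]
      map_add' := fun v w => by rw [map_add, map_add] }
  U_norm g v := (norm_mop_lift_apply (V.u_unitary' _) _).trans (N.norm_pointU g v)
  U_smul g z v := by
    have h : N.pointU V.ι g (z • v) = sg (T.φ (p g)) z • N.pointU V.ι g v := by
      ext i
      exact N.U_smul' g z (v i)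
    change mop _ _ = sg (T.φ (p g)) z • mop _ _
    rw [h, map_smul]
  U_mul g h v := by
    change mop (lift _ (V.u (p g))) (N.pointU V.ι g (mop (lift _ (V.u (p h))) (N.pointU V.ι h v)))
      = (T.τ (p g) (p h) : ℂ) • mop (lift _ (V.u (p (g * h)))) (N.pointU V.ι (g * h) v)
    have e : N.pointU V.ι g (N.pointU V.ι h v) = N.pointU V.ι (g * h) v := by
      ext i; exact N.U_mul' g h (v i)
    rw [pointU_mop_lift, mop_lift_mul_apply, V.u_mul, e, lift_smul, mop_smul, map_mul]
    rfl
  U_γ g v := by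
    change mop (lift _ (V.u (p g))) (N.pointU V.ι g (mop (lift _ V.Γ) v))
      = sgn (T.c (p g)) • mop (lift _ V.Γ) (mop (lift _ (V.u (p g))) (N.pointU V.ι g v))
    rw [pointU_mop_lift, mop_lift_mul_apply, mop_lift_mul_apply, V.u_Γ, lift_smul, mop_smul]
    rfl
  proj x := diagOp V.ι (N.proj x)
  proj_star x := ⟨by
    ext v i
    change diagOp V.ι (N.proj x) (diagOp V.ι (N.proj x) v) i = _
    rw [diagOp_apply, diagOp_apply, proj_proj], by
    rw [IsSelfAdjoint, ContinuousLinearMap.star_eq_adjoint, diagOp, ← mop_star,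
      Matrix.diagonal_conjTranspose]
    congr 2
    funext i
    exact (N.proj_star x).isSelfAdjoint.star_eq⟩
  proj_orth x y h := by
    ext v i
    change diagOp V.ι (N.proj x) (diagOp V.ι (N.proj y) v) i = 0
    rw [diagOp_apply, diagOp_apply, proj_proj_of_ne _ h]
  proj_total v hv := by
    ext i
    refine N.proj_total _ fun x => ?_
    have := congrArg (fun w : PiLp 2 (fun _ : V.ι => N.H) => w i) (hv x)
    exact (diagOp_apply _ _ _).symm.trans this
  proj_γ x := by
    ext v i
    change mop _ (diagOp V.ι (N.proj x) v) i = diagOp V.ι (N.proj x) (mop _ v) i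
    simp only [mop_lift_apply, diagOp_apply, map_sum, map_smul]
  U_proj g x v := by
    change mop _ (N.pointU V.ι g (diagOp V.ι (N.proj x) v))
      = diagOp V.ι (N.proj (g • x)) (mop _ (N.pointU V.ι g v))
    ext i
    simp only [mop_lift_apply, diagOp_apply, map_sum, map_smul, pointU_apply, N.U_proj]
  uniformlyFinite := by
    obtain ⟨K, hK⟩ := N.uniformlyFinite
    refine ⟨Fintype.card V.ι * K, fun x => ?_⟩
    have := (hK x).1
    let e : LinearMap.range (diagOp V.ι (N.proj x) :
          PiLp 2 (fun _ : V.ι => N.H) →ₗ[ℂ] PiLp 2 (fun _ : V.ι => N.H)) →ₗ[ℂ]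
        (V.ι → LinearMap.range (N.proj x : N.H →ₗ[ℂ] N.H)) :=
      { toFun := fun v i => ⟨v.1 i, by
          obtain ⟨_, w, rfl⟩ := v
          exact ⟨w i, (diagOp_apply _ _ _).symm⟩⟩
        map_add' := fun _ _ => rfl
        map_smul' := fun _ _ => rfl }
    have he : Function.Injective e := fun v w h =>
      Subtype.ext (PiLp.ext fun i => congrArg Subtype.val (congrFun h i))
    refine ⟨FiniteDimensional.of_injective e he,
      (LinearMap.finrank_le_finrank_of_injective he).trans ?_⟩
    rw [Module.finrank_pi_fintype]
    exact (Finset.sum_le_card_nsmul _ _ _ fun _ _ => (hK x).2).trans_eq (by simp)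

/-- The operator on `N ⊗ V` with a given matrix. -/
def tmop (V : MatRep T) (A : Matrix V.ι V.ι (N.H →L[ℂ] N.H)) : (N.tens V).H →L[ℂ] (N.tens V).H :=
  mop A

/-- The matrix of an operator on `N ⊗ V`. -/
def tmat (V : MatRep T) (S : (N.tens V).H →L[ℂ] (N.tens V).H) : Matrix V.ι V.ι (N.H →L[ℂ] N.H) :=
  mat (E := N.H) (m := V.ι) (n := V.ι) S

variable {V : MatRep T} {A B : Matrix V.ι V.ι (N.H →L[ℂ] N.H)}

theorem tmat_tmop (A : Matrix V.ι V.ι (N.H →L[ℂ] N.H)) : N.tmat V (N.tmop V A) = A := mat_mop A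

theorem tmop_tmat (S : (N.tens V).H →L[ℂ] (N.tens V).H) : N.tmop V (N.tmat V S) = S :=
  mop_mat (E := N.H) (m := V.ι) (n := V.ι) S

theorem tmop_injective : Function.Injective (N.tmop V) :=
  Function.LeftInverse.injective N.tmat_tmop

theorem tmop_mul (A B : Matrix V.ι V.ι (N.H →L[ℂ] N.H)) :
    N.tmop V (A * B) = N.tmop V A * N.tmop V B := mop_mul A B

theorem tmop_one : N.tmop V 1 = 1 := mop_one

theorem tmop_star (A : Matrix V.ι V.ι (N.H →L[ℂ] N.H)) : N.tmop V Aᴴ = star (N.tmop V A) :=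
  mop_star A

theorem tmop_smul (z : ℂ) (A : Matrix V.ι V.ι (N.H →L[ℂ] N.H)) :
    N.tmop V (z • A) = z • N.tmop V A := mop_smul z A

theorem tmop_sum {ι : Type} (s : Finset ι) (f : ι → Matrix V.ι V.ι (N.H →L[ℂ] N.H)) :
    N.tmop V (∑ i ∈ s, f i) = ∑ i ∈ s, N.tmop V (f i) :=
  map_sum (AddMonoidHom.mk' (N.tmop V) mop_add) f s

theorem tmop_continuous : Continuous (N.tmop V) := mop_continuous

theorem tmat_continuous : Continuous (N.tmat V) := mat_continuous

/-- Conjugation on `N ⊗ V` becomes the action `α_q ⊗ Ad U_q` on matrices that enters the definition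
of `symmSet`. This is why K-theory cycles can be read as operators on `N ⊗ V`. -/
theorem tens_ad_tmop (g : G) (A : Matrix V.ι V.ι (N.H →L[ℂ] N.H)) :
    (N.tens V).ad g (N.tmop V A)
      = N.tmop V (lift _ (V.u (p g)) * A.map (N.ad g) * (lift _ (V.u (p g)))ᴴ) := by
  ext v : 1
  change mop (lift _ (V.u (p g))) (N.pointU V.ι g (mop A
    ((N.pointU V.ι g).symm (mop (lift _ (V.u (p g))ᴴ) v)))) = mop _ v
  rw [pointU_mop, AddEquiv.apply_symm_apply, mop_mul, mop_mul, ← lift_star]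
  rfl

/-- Elements of `Π` act on the factor `V` by a phase, which cancels in a conjugation; hence
`Π`-invariance can be tested on matrix entries. -/
theorem tens_ad_tmop_of_map_eq_one {g : G} (hg : p g = 1)
    (A : Matrix V.ι V.ι (N.H →L[ℂ] N.H)) :
    (N.tens V).ad g (N.tmop V A) = N.tmop V (A.map (N.ad g)) := by
  rw [tens_ad_tmop, hg, V.u_one, lift_smul, lift_one, Matrix.conjTranspose_smul, Matrix.smul_mul,
    Matrix.smul_mul, Matrix.mul_smul, smul_smul, one_mul, Matrix.conjTranspose_one, mul_one]
  have : (T.τ 1 1 : ℂ) * star (T.τ 1 1 : ℂ) = 1 := by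
    rw [Complex.star_def, Complex.mul_conj, Circle.normSq_coe, Complex.ofReal_one]
  rw [this, one_smul]

theorem tmop_mem_invAlg : N.tmop V A ∈ (N.tens V).invAlg ↔ ∀ i k, A i k ∈ N.invAlg := by
  constructor
  · intro h i k g hg
    have h1 := h g hg
    rw [tens_ad_tmop_of_map_eq_one _ hg] at h1
    exact congrFun (congrFun (N.tmop_injective h1) i) k
  · intro h g hg
    rw [tens_ad_tmop_of_map_eq_one _ hg]
    congr 1
    ext1 i k
    exact h i k g hg

theorem tmop_commute_proj (x : X) :
    Commute ((N.tens V).proj x) (N.tmop V A) ↔ ∀ i k, Commute (N.proj x) (A i k) := by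
  have h0 : (N.tens V).proj x = N.tmop V (Matrix.diagonal fun _ => N.proj x) := rfl
  rw [h0, commute_iff_eq, ← tmop_mul, ← tmop_mul, (N.tmop_injective).eq_iff]
  constructor
  · intro h i k
    have := congrFun (congrFun h i) k
    rwa [Matrix.diagonal_mul, Matrix.mul_diagonal] at this
  · intro h
    ext1 i k
    rw [Matrix.diagonal_mul, Matrix.mul_diagonal]
    exact h i k

variable [MetricSpace X]

theorem tmop_controlled :
    (N.tens V).Controlled (N.tmop V A) ↔ ∀ i k, N.Controlled (A i k) := by
  have hproj : ∀ x, (N.tens V).proj x = N.tmop V (Matrix.diagonal fun _ => N.proj x) := fun x => rfl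
  have key : ∀ x y, (N.tens V).proj y * N.tmop V A * (N.tens V).proj x = 0 ↔
      ∀ i k, N.proj y * A i k * N.proj x = 0 := fun x y => by
    have h0 : (0 : (N.tens V).H →L[ℂ] (N.tens V).H) = N.tmop V 0 := mop_zero.symm
    rw [hproj, hproj, ← tmop_mul, ← tmop_mul, h0, (N.tmop_injective).eq_iff]
    constructor
    · intro h i k
      have := congrFun (congrFun h i) k
      rwa [Matrix.mul_diagonal, Matrix.diagonal_mul] at this
    · intro h
      ext1 i k
      rw [Matrix.mul_diagonal, Matrix.diagonal_mul]
      exact h i k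
  constructor
  · rintro ⟨R, hR, h⟩ i k
    exact ⟨R, hR, fun x y hxy => (key x y).1 (h x y hxy) i k⟩
  · intro h
    choose R hR h using h
    -- The sum of absolute values dominates every single radius, and the summand `1` keeps the bound
    -- positive even if the index set is empty.
    refine ⟨1 + ∑ i, ∑ k, |R i k|, by positivity, fun x y hxy => (key x y).2 fun i k =>
      h i k x y (lt_of_le_of_lt ?_ hxy)⟩
    calc R i k ≤ |R i k| := le_abs_self _
      _ ≤ ∑ k, |R i k| := Finset.single_le_sum (f := fun k => |R i k|)
          (fun _ _ => abs_nonneg _) (Finset.mem_univ k)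
      _ ≤ ∑ i, ∑ k, |R i k| := Finset.single_le_sum (f := fun i => ∑ k, |R i k|)
          (fun _ _ => Finset.sum_nonneg fun _ _ => abs_nonneg _) (Finset.mem_univ i)
      _ ≤ _ := by linarith

/-- Taking a matrix entry and inserting an operator at a single entry are continuous and preserve
invariance and control, so both pass to the norm closures. A matrix is the finite sum of its single
entries. -/
theorem tmop_mem_roe : N.tmop V A ∈ (N.tens V).roe ↔ ∀ i k, A i k ∈ N.roe := by
  constructor
  · intro h i k
    have h2 : N.tmat V (N.tmop V A) i k ∈ N.roe := by
      refine mapsTo_roe (M := N.tens V) (M' := N) (f := fun S => N.tmat V S i k)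
        (N.tmat_continuous.matrix_elem i k) (fun S hS => ?_) (fun S hS => ?_) h
      · rw [← N.tmop_tmat S, tmop_mem_invAlg] at hS
        exact hS i k
      · rw [← N.tmop_tmat S, tmop_controlled] at hS
        exact hS i k
    rwa [tmat_tmop] at h2
  · intro h
    have h1 : ∀ i k, N.tmop V (Matrix.single i k (A i k)) ∈ (N.tens V).roe := fun i k => by
      refine mapsTo_roe (M := N) (M' := N.tens V) (f := fun S => N.tmop V (Matrix.single i k S))
        ?_ (fun S hS => ?_) (fun S hS => ?_) (h i k)
      · refine N.tmop_continuous.comp (continuous_matrix fun a b => ?_)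
        simp only [Matrix.single_apply]
        split_ifs <;> fun_prop
      · refine N.tmop_mem_invAlg.2 fun a b => ?_
        rw [Matrix.single_apply]
        split_ifs
        · exact hS
        · exact zero_mem _
      · refine N.tmop_controlled.2 fun a b => ?_
        rw [Matrix.single_apply]
        split_ifs
        · exact hS
        · simpa using hS.smul 0
    rw [Matrix.matrix_eq_sum_single A, tmop_sum]
    refine sum_mem fun i _ => ?_
    rw [tmop_sum]
    exact sum_mem fun k _ => h1 i k

end UFModule

end tens

/-! ### Embeddings of direct sums -/

/-- The operator `S ⊕ S'` on a direct sum of modules. -/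
def UFModule.osum {G : Type u} [Group G] {T : Twist G} {X : Type u} [MulAction G X]
    {M M' : UFModule T X} (S : M.H →L[ℂ] M.H) (S' : M'.H →L[ℂ] M'.H) :
    (M.dsum M').H →L[ℂ] (M.dsum M').H := opSum S S'

open UFModule (osum)

namespace Emb

section coprod

variable {G : Type u} [Group G] {T : Twist G} {X : Type u} [MulAction G X] [MetricSpace X]
  {M M' M₁ M₂ M₁' M₂' : UFModule T X}

theorem adj_comp (f : Emb M' M₁) (e : Emb M M') (v : M₁.H) :
    adjoint (f.comp e).j v = adjoint e.j (adjoint f.j v) := by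
  change adjoint (f.j ∘L e.j) v = _
  rw [ContinuousLinearMap.adjoint_comp]; rfl

theorem adj_symm {a : Emb M₁ M} {b : Emb M₂ M} (h : ∀ v, adjoint a.j (b.j v) = 0) (v : M₁.H) :
    adjoint b.j (a.j v) = 0 := by
  refine ext_inner_left ℂ fun w => ?_
  rw [ContinuousLinearMap.adjoint_inner_right, ← ContinuousLinearMap.adjoint_inner_left, h,
    inner_zero_left, inner_zero_right]

/-- The map `(v, w) ↦ a v + b w` for two isometries with orthogonal ranges. -/
def coprodMap (a : Emb M₁ M) (b : Emb M₂ M) : (M₁.dsum M₂).H →L[ℂ] M.H :=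
  a.j ∘L adjoint (inl M₁ M₂).j + b.j ∘L adjoint (inr M₁ M₂).j

theorem coprodMap_apply (a : Emb M₁ M) (b : Emb M₂ M) (v : (M₁.dsum M₂).H) :
    coprodMap a b v = a.j v.fst + b.j v.snd := by
  change a.j (adjoint (inl M₁ M₂).j v) + b.j (adjoint (inr M₁ M₂).j v) = _
  rw [inl_adj, inr_adj]

theorem coprodMap_adj (a : Emb M₁ M) (b : Emb M₂ M) (v : M.H) :
    adjoint (coprodMap a b) v = WithLp.toLp 2 (adjoint a.j v, adjoint b.j v) := by
  refine ext_inner_left ℂ fun w => ?_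
  rw [ContinuousLinearMap.adjoint_inner_right, coprodMap_apply, inner_add_left]
  refine Eq.trans ?_ (WithLp.prod_inner_apply _ _).symm
  rw [← ContinuousLinearMap.adjoint_inner_right, ← ContinuousLinearMap.adjoint_inner_right]
  rfl

/-- The isometry `(v, w) ↦ a v + b w` for two isometries with orthogonal ranges. -/
def coprod (a : Emb M₁ M) (b : Emb M₂ M) (h : ∀ v, adjoint a.j (b.j v) = 0) :
    Emb (M₁.dsum M₂) M where
  j := coprodMap a b
  isom v := by
    rw [coprodMap_adj, coprodMap_apply]
    refine wext ?_ ?_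
    · change adjoint a.j (a.j v.fst + b.j v.snd) = v.fst
      rw [map_add, a.isom, h, add_zero]
    · change adjoint b.j (a.j v.fst + b.j v.snd) = v.snd
      rw [map_add, b.isom, adj_symm h, zero_add]
  even v := by
    rw [coprodMap_apply, coprodMap_apply, map_add, ← a.even, ← b.even]; rfl
  equiv g v := by
    rw [coprodMap_apply, coprodMap_apply, map_add, ← a.equiv, ← b.equiv]; rfl
  ctl := by
    obtain ⟨R, ha⟩ := a.ctl
    obtain ⟨R', hb⟩ := b.ctl
    obtain ⟨R₁, h₁⟩ := (inl M₁ M₂).ctl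
    obtain ⟨R₂, h₂⟩ := (inr M₁ M₂).ctl
    exact ⟨_, (ha.comp h₁.adjoint).add (hb.comp h₂.adjoint)⟩

theorem coprod_push (a : Emb M₁ M) (b : Emb M₂ M) (h : ∀ v, adjoint a.j (b.j v) = 0)
    (S : M₁.H →L[ℂ] M₁.H) (S' : M₂.H →L[ℂ] M₂.H) (v : M.H) :
    (coprod a b h).push (osum S S') v
      = a.j (S (adjoint a.j v)) + b.j (S' (adjoint b.j v))
        + M.γ (v - (a.j (adjoint a.j v) + b.j (adjoint b.j v))) := by
  have e : ∀ v, (coprod a b h).j v = a.j v.fst + b.j v.snd := coprodMap_apply a b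
  have e' : ∀ v, adjoint (coprod a b h).j v = WithLp.toLp 2 (adjoint a.j v, adjoint b.j v) :=
    coprodMap_adj a b
  rw [push_apply, e, e, e']
  rfl

theorem inl_inr (v : M₂.H) : adjoint (inl M₁ M₂).j ((inr M₁ M₂).j v) = 0 := by
  rw [inl_adj]; rfl

/-- The direct sum of two isometries. -/
def dsum (a : Emb M₁ M₁') (b : Emb M₂ M₂') : Emb (M₁.dsum M₂) (M₁'.dsum M₂') :=
  coprod ((inl M₁' M₂').comp a) ((inr M₁' M₂').comp b) fun v => by
    rw [adj_comp]
    change adjoint a.j (adjoint (inl M₁' M₂').j ((inr M₁' M₂').j (b.j v))) = 0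
    rw [inl_inr, map_zero]

theorem dsum_push (a : Emb M₁ M₁') (b : Emb M₂ M₂') (S : M₁.H →L[ℂ] M₁.H)
    (S' : M₂.H →L[ℂ] M₂.H) : (dsum a b).push (osum S S') = osum (a.push S) (b.push S') := by
  ext v
  refine (coprod_push _ _ _ S S' v).trans ?_
  rw [adj_comp, adj_comp, inl_adj, inr_adj]
  refine wext ?_ ?_
  · change a.j (S (adjoint a.j v.fst)) + 0 + M₁'.γ (v.fst - (a.j (adjoint a.j v.fst) + 0)) = _
    rw [add_zero, add_zero]; rfl
  · change 0 + b.j (S' (adjoint b.j v.snd)) + M₂'.γ (v.snd - (0 + b.j (adjoint b.j v.snd))) = _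
    rw [zero_add, zero_add]; rfl

end coprod

end Emb

/-! ### Inclusions of representations -/

section rows

variable {l m : Type} [Fintype l] [DecidableEq l] [Fintype m] [DecidableEq m]
  {R : Type*} [Ring R] [StarRing R]

theorem fromRows_left_isom : (Matrix.fromRows (1 : Matrix l l R) (0 : Matrix m l R))ᴴ *
    Matrix.fromRows (1 : Matrix l l R) (0 : Matrix m l R) = 1 := by
  rw [Matrix.conjTranspose_fromRows_eq_fromCols_conjTranspose, Matrix.fromCols_mul_fromRows]
  simp

theorem fromRows_right_isom : (Matrix.fromRows (0 : Matrix l m R) (1 : Matrix m m R))ᴴ *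
    Matrix.fromRows (0 : Matrix l m R) (1 : Matrix m m R) = 1 := by
  rw [Matrix.conjTranspose_fromRows_eq_fromCols_conjTranspose, Matrix.fromCols_mul_fromRows]
  simp

theorem fromRows_left_right : (Matrix.fromRows (1 : Matrix l l R) (0 : Matrix m l R))ᴴ *
    Matrix.fromRows (0 : Matrix l m R) (1 : Matrix m m R) = 0 := by
  rw [Matrix.conjTranspose_fromRows_eq_fromCols_conjTranspose, Matrix.fromCols_mul_fromRows]
  simp

theorem fromRows_left_mul (A : Matrix l l R) (B : Matrix m m R) :
    Matrix.fromRows (1 : Matrix l l R) (0 : Matrix m l R) * A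
      = Matrix.fromBlocks A 0 0 B * Matrix.fromRows (1 : Matrix l l R) (0 : Matrix m l R) := by
  rw [Matrix.fromBlocks_mul_fromRows, Matrix.fromRows_mul]
  simp

theorem fromRows_right_mul (A : Matrix l l R) (B : Matrix m m R) :
    Matrix.fromRows (0 : Matrix l m R) (1 : Matrix m m R) * B
      = Matrix.fromBlocks A 0 0 B * Matrix.fromRows (0 : Matrix l m R) (1 : Matrix m m R) := by
  rw [Matrix.fromBlocks_mul_fromRows, Matrix.fromRows_mul]
  simp

theorem fromRows_conj_add (A : Matrix l l R) (B : Matrix m m R) :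
    Matrix.fromRows (1 : Matrix l l R) (0 : Matrix m l R) * A *
        (Matrix.fromRows (1 : Matrix l l R) (0 : Matrix m l R))ᴴ +
      Matrix.fromRows (0 : Matrix l m R) (1 : Matrix m m R) * B *
        (Matrix.fromRows (0 : Matrix l m R) (1 : Matrix m m R))ᴴ = Matrix.fromBlocks A 0 0 B := by
  rw [fromRows_left_mul A B, fromRows_right_mul A B, Matrix.mul_assoc, Matrix.mul_assoc,
    ← Matrix.mul_add]
  have : Matrix.fromRows (1 : Matrix l l R) (0 : Matrix m l R) *
        (Matrix.fromRows (1 : Matrix l l R) (0 : Matrix m l R))ᴴ +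
      Matrix.fromRows (0 : Matrix l m R) (1 : Matrix m m R) *
        (Matrix.fromRows (0 : Matrix l m R) (1 : Matrix m m R))ᴴ = 1 := by
    rw [Matrix.conjTranspose_fromRows_eq_fromCols_conjTranspose,
      Matrix.conjTranspose_fromRows_eq_fromCols_conjTranspose, Matrix.fromRows_mul_fromCols,
      Matrix.fromRows_mul_fromCols, Matrix.fromBlocks_add, ← Matrix.fromBlocks_one]
    simp
  rw [this, Matrix.mul_one]

theorem fromRows_left_map {S : Type*} [Ring S] (f : R →+* S) :
    (Matrix.fromRows (1 : Matrix l l R) (0 : Matrix m l R)).map f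
      = Matrix.fromRows (1 : Matrix l l S) (0 : Matrix m l S) := by
  ext i k
  rcases i with i | i
  · by_cases h : i = k <;> simp [h]
  · simp

theorem fromRows_right_map {S : Type*} [Ring S] (f : R →+* S) :
    (Matrix.fromRows (0 : Matrix l m R) (1 : Matrix m m R)).map f
      = Matrix.fromRows (0 : Matrix l m S) (1 : Matrix m m S) := by
  ext i k
  rcases i with i | i
  · simp
  · by_cases h : i = k <;> simp [h]

end rows

/-- Even equivariant isometric inclusions of twisted representations. -/
structure RepIncl {Q : Type v} [Group Q] {T : Twist Q} (V W : MatRep T) where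
  J : Matrix W.ι V.ι ℂ
  isom : Jᴴ * J = 1
  even : J * V.Γ = W.Γ * J
  equiv : ∀ q, J * V.u q = W.u q * J.map (sg (T.φ q))

namespace RepIncl

variable {Q : Type v} [Group Q] {T : Twist Q}

/-- The inclusion of the first summand. -/
def inl (V W : MatRep T) : RepIncl V (V.dsum W) where
  J := Matrix.fromRows (1 : Matrix V.ι V.ι ℂ) (0 : Matrix W.ι V.ι ℂ)
  isom := fromRows_left_isom
  even := fromRows_left_mul V.Γ W.Γ
  equiv q := (fromRows_left_mul (V.u q) (W.u q)).trans
    (congrArg (Matrix.fromBlocks (V.u q) 0 0 (W.u q) * ·) (fromRows_left_map _).symm)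

/-- The inclusion of the second summand. -/
def inr (V W : MatRep T) : RepIncl W (V.dsum W) where
  J := Matrix.fromRows (0 : Matrix V.ι W.ι ℂ) (1 : Matrix W.ι W.ι ℂ)
  isom := fromRows_right_isom
  even := fromRows_right_mul V.Γ W.Γ
  equiv q := (fromRows_right_mul (V.u q) (W.u q)).trans
    (congrArg (Matrix.fromBlocks (V.u q) 0 0 (W.u q) * ·) (fromRows_right_map _).symm)

theorem inl_inr (V W : MatRep T) : (inl V W).Jᴴ * (inr V W).J = 0 := fromRows_left_right

end RepIncl

/-! ### Inclusions of representations as isometries of modules. -/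

section tensIncl

variable {G : Type u} [Group G] {Q : Type v} [Group Q] {T : Twist Q} {X : Type u} [MulAction G X]
  {p : G →* Q} [MetricSpace X] (N : UFModule (T.phiOnly.comap p) X) {U V W : MatRep T}

namespace UFModule

/-- A scalar matrix as a matrix of operators. -/
abbrev lft {m n : Type} (M : Matrix m n ℂ) : Matrix m n (N.H →L[ℂ] N.H) := lift (N.H →L[ℂ] N.H) M

/-- The operator `N ⊗ V → N ⊗ W` with a given matrix. -/
def rmop (A : Matrix W.ι V.ι (N.H →L[ℂ] N.H)) : (N.tens V).H →L[ℂ] (N.tens W).H := mop A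

theorem rmop_self (A : Matrix V.ι V.ι (N.H →L[ℂ] N.H)) : N.rmop A = N.tmop V A := rfl

theorem rmop_comp (A : Matrix W.ι V.ι (N.H →L[ℂ] N.H)) (B : Matrix V.ι U.ι (N.H →L[ℂ] N.H)) :
    N.rmop A ∘L N.rmop B = N.rmop (A * B) := (mop_mul A B).symm

theorem rmop_adj (A : Matrix W.ι V.ι (N.H →L[ℂ] N.H)) :
    adjoint (N.rmop A) = N.rmop Aᴴ := (mop_star A).symm

theorem rmop_add (A B : Matrix W.ι V.ι (N.H →L[ℂ] N.H)) :
    N.rmop (A + B) = N.rmop A + N.rmop B := mop_add A B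

theorem rmop_sub (A B : Matrix W.ι V.ι (N.H →L[ℂ] N.H)) :
    N.rmop (A - B) = N.rmop A - N.rmop B := map_sub (AddMonoidHom.mk' N.rmop N.rmop_add) A B

theorem rmop_zero : N.rmop (0 : Matrix W.ι V.ι (N.H →L[ℂ] N.H)) = 0 := mop_zero

theorem rmop_one : N.rmop (1 : Matrix V.ι V.ι (N.H →L[ℂ] N.H)) = 1 := mop_one

theorem tens_γ : (N.tens V).γ = N.rmop (N.lft V.Γ) := rfl

theorem lft_mul {l m n : Type} [Fintype m] (A : Matrix l m ℂ) (B : Matrix m n ℂ) :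
    N.lft (A * B) = N.lft A * N.lft B := lift_mul A B

theorem lft_star {m n : Type} (A : Matrix m n ℂ) : N.lft Aᴴ = (N.lft A)ᴴ := lift_star A

theorem lft_sub {m n : Type} (A B : Matrix m n ℂ) : N.lft (A - B) = N.lft A - N.lft B :=
  Matrix.map_sub _ (map_sub _) _ _

theorem lft_one {n : Type} [DecidableEq n] : N.lft (1 : Matrix n n ℂ) = 1 := lift_one

end UFModule

/-- The isometry `1 ⊗ J : N ⊗ V → N ⊗ W`. -/
def Emb.tens (J : RepIncl V W) : Emb (N.tens V) (N.tens W) where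
  j := N.rmop (N.lft J.J)
  isom v := by
    have h : adjoint (N.rmop (N.lft J.J)) ∘L N.rmop (N.lft J.J) = 1 := by
      rw [N.rmop_adj, N.rmop_comp, ← N.lft_star, ← N.lft_mul, J.isom, N.lft_one, N.rmop_one]
    exact congrArg (fun A : (N.tens V).H →L[ℂ] (N.tens V).H => A v) h
  even v := by
    have h : N.rmop (N.lft J.J) ∘L (N.tens V).γ = (N.tens W).γ ∘L N.rmop (N.lft J.J) := by
      rw [N.tens_γ, N.tens_γ, N.rmop_comp, N.rmop_comp, ← N.lft_mul, ← N.lft_mul, J.even]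
    exact congrArg (fun A : (N.tens V).H →L[ℂ] (N.tens W).H => A v) h
  equiv g v := by
    have h : ∀ v : PiLp 2 (fun _ : V.ι => N.H),
        mop (N.lft J.J) (mop (N.lft (V.u (p g))) (N.pointU V.ι g v))
          = mop (N.lft (W.u (p g))) (N.pointU W.ι g (mop (N.lft J.J) v)) := fun v => by
      rw [N.pointU_mop_lift, mop_lift_mul_apply, mop_lift_mul_apply, J.equiv]
    exact h v
  ctl := ⟨0, fun x y v hxy => by
    have hne : y ≠ x := by rintro rfl; rw [dist_self] at hxy; exact lt_irrefl _ hxy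
    have h : (N.tens W).proj y ∘L N.rmop (N.lft J.J) ∘L (N.tens V).proj x = 0 := by
      have h0 : ∀ (V : MatRep T) x, (N.tens V).proj x
        = N.rmop (Matrix.diagonal fun _ => N.proj x) := fun _ _ => rfl
      rw [h0, h0, N.rmop_comp, N.rmop_comp, ← N.rmop_zero]
      congr 1
      ext1 i k
      rw [Matrix.diagonal_mul, Matrix.mul_diagonal, Matrix.zero_apply]
      change N.proj y * ((algebraMap ℂ (N.H →L[ℂ] N.H) (J.J i k)) * N.proj x) = 0
      rw [Algebra.commutes, ← mul_assoc, N.proj_orth y x hne, zero_mul]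
    exact congrArg (fun A : (N.tens V).H →L[ℂ] (N.tens W).H => A v) h⟩

/-- The right-hand side is the formula in `IsIncl.eq`: the relation of K-theory for an inclusion of
representations is the push-forward along `1 ⊗ J`. -/
theorem Emb.tens_push (J : RepIncl V W) (A : Matrix V.ι V.ι (N.H →L[ℂ] N.H)) :
    (Emb.tens N J).push (N.tmop V A) = N.tmop W
      (N.lft J.J * A * (N.lft J.J)ᴴ + N.lft (W.Γ * (1 - J.J * J.Jᴴ))) := by
  have h : (Emb.tens N J).push (N.tmop V A) = N.rmop (N.lft J.J) ∘L N.rmop A ∘L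
      adjoint (N.rmop (N.lft J.J)) + (N.tens W).γ ∘L (1 - N.rmop (N.lft J.J) ∘L
        adjoint (N.rmop (N.lft J.J))) := rfl
  rw [h, N.tens_γ, N.rmop_adj, ← N.rmop_one, N.rmop_comp, N.rmop_comp, N.rmop_comp, ← N.rmop_sub,
    N.rmop_comp, ← N.rmop_add, N.rmop_self, N.lft_mul, N.lft_sub, N.lft_one, N.lft_mul, N.lft_star,
    Matrix.mul_assoc]

theorem Emb.tens_inl_inr (v : (N.tens W).H) :
    adjoint (Emb.tens N (RepIncl.inl V W)).j ((Emb.tens N (RepIncl.inr V W)).j v) = 0 := by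
  have h : adjoint (N.rmop (N.lft (RepIncl.inl V W).J)) ∘L N.rmop (N.lft (RepIncl.inr V W).J) = 0 := by
    rw [N.rmop_adj, N.rmop_comp, ← N.lft_star, ← N.lft_mul, RepIncl.inl_inr]
    exact (congrArg N.rmop lift_zero).trans N.rmop_zero
  exact congrArg (fun A : (N.tens W).H →L[ℂ] (N.tens V).H => A v) h

/-- The isometry `(N ⊗ V) ⊕ (N ⊗ W) → N ⊗ (V ⊕ W)`. -/
def Emb.tensSum (V W : MatRep T) : Emb ((N.tens V).dsum (N.tens W)) (N.tens (V.dsum W)) :=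
  Emb.coprod (Emb.tens N (RepIncl.inl V W)) (Emb.tens N (RepIncl.inr V W)) (Emb.tens_inl_inr N)

theorem Emb.tensSum_push (A : Matrix V.ι V.ι (N.H →L[ℂ] N.H)) (B : Matrix W.ι W.ι (N.H →L[ℂ] N.H)) :
    (Emb.tensSum N V W).push (osum (N.tmop V A) (N.tmop W B))
      = N.tmop (V.dsum W) (Matrix.fromBlocks A 0 0 B) := by
  let a := N.rmop (N.lft (RepIncl.inl V W).J)
  let b := N.rmop (N.lft (RepIncl.inr V W).J)
  have conj : ∀ A B, a ∘L N.rmop A ∘L adjoint a + b ∘L N.rmop B ∘L adjoint b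
      = N.tmop (V.dsum W) (Matrix.fromBlocks A 0 0 B) := fun A B => by
    have h : N.lft (RepIncl.inl V W).J * A * (N.lft (RepIncl.inl V W).J)ᴴ
        + N.lft (RepIncl.inr V W).J * B * (N.lft (RepIncl.inr V W).J)ᴴ
        = Matrix.fromBlocks A 0 0 B := by
      have h1 : N.lft (RepIncl.inl V W).J = Matrix.fromRows 1 0 := fromRows_left_map _
      have h2 : N.lft (RepIncl.inr V W).J = Matrix.fromRows 0 1 := fromRows_right_map _
      rw [h1, h2]
      exact fromRows_conj_add A B
    rw [N.rmop_adj, N.rmop_adj, N.rmop_comp, N.rmop_comp, N.rmop_comp, N.rmop_comp, ← N.rmop_add,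
      ← Matrix.mul_assoc, ← Matrix.mul_assoc, h]
    rfl
  -- The ranges of the two inclusions span `N ⊗ (V ⊕ W)`, so this isometry is onto and no grading
  -- term is added.
  have hone : a ∘L adjoint a + b ∘L adjoint b = 1 := by
    have h := conj 1 1
    rw [N.rmop_one, N.rmop_one] at h
    refine h.trans ?_
    exact (congrArg (N.tmop (V.dsum W)) Matrix.fromBlocks_one).trans N.tmop_one
  ext v : 1
  have e1 : v - (a (adjoint a v) + b (adjoint b v)) = 0 :=
    sub_eq_zero.2 (congrArg (fun A : (N.tens (V.dsum W)).H →L[ℂ] (N.tens (V.dsum W)).H => A v)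
      hone).symm
  refine (Emb.coprod_push _ _ _ _ _ v).trans ?_
  change _ + (N.tens (V.dsum W)).γ (v - (a (adjoint a v) + b (adjoint b v))) = _
  rw [e1, map_zero, add_zero, ← conj]
  rfl

end tensIncl

/-! ### Classes in K-theory -/

section coeMat

variable {B : Type w} [CStarAlgebra B] {A : StarSubalgebra ℂ B}

/-- A matrix over a subalgebra as a matrix over the ambient algebra. -/
def coeMat {m n : Type} (s : Matrix m n A) : Matrix m n B := s.map Subtype.val

theorem coeMat_injective {m n : Type} : Function.Injective (coeMat (A := A) (m := m) (n := n)) :=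
  fun _ _ h => Matrix.ext fun i k => Subtype.ext (congrFun (congrFun h i) k)

theorem coeMat_mul {l m n : Type} [Fintype m] (s : Matrix l m A) (t : Matrix m n A) :
    coeMat (s * t) = coeMat s * coeMat t := Matrix.map_mul (f := A.subtype)

theorem coeMat_add {m n : Type} (s t : Matrix m n A) : coeMat (s + t) = coeMat s + coeMat t := rfl

theorem coeMat_star {m n : Type} (s : Matrix m n A) : coeMat sᴴ = (coeMat s)ᴴ := rfl

theorem coeMat_smul {m n : Type} (z : ℂ) (s : Matrix m n A) : coeMat (z • s) = z • coeMat s := rfl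

theorem coeMat_one {n : Type} [DecidableEq n] : coeMat (1 : Matrix n n A) = 1 :=
  Matrix.map_one _ rfl rfl

theorem coeMat_lift [IsClosed (A : Set B)] {m n : Type} (M : Matrix m n ℂ) :
    coeMat (lift A M) = lift B M := rfl

theorem coeMat_fromBlocks {l m n o : Type} (a : Matrix n l A) (b : Matrix n m A)
    (c : Matrix o l A) (d : Matrix o m A) : coeMat (Matrix.fromBlocks a b c d)
      = Matrix.fromBlocks (coeMat a) (coeMat b) (coeMat c) (coeMat d) :=
  Matrix.fromBlocks_map _ _ _ _ _

end coeMat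

/-! ### K-theory classes as symmetries of modules. -/

section kcls

variable {G : Type u} [Group G] {Q : Type v} [Group Q] {T : Twist Q} {X : Type u} [MulAction G X]
  {p : G →* Q} (hp : Function.Surjective p) (N : UFModule (T.phiOnly.comap p) X)

/-- Twisted invariant symmetries over an algebra of `Π`-invariant operators on `N`, as operators on
`N ⊗ V`. -/
theorem UFModule.mem_symmSet_iff (A : StarSubalgebra ℂ (N.H →L[ℂ] N.H))
    [IsClosed (A : Set (N.H →L[ℂ] N.H))] (hA : A ≤ N.invAlg)
    (had : ∀ g {S}, S ∈ A → N.ad g S ∈ A) (V : MatRep T) (s : Matrix V.ι V.ι A) :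
    s ∈ symmSet (T := T) (N.qAction hp A hA had) V.u ↔
      (N.tens V).TwInvariant (N.tmop V (coeMat s)) ∧ IsSelfAdjoint (N.tmop V (coeMat s)) ∧
        N.tmop V (coeMat s) * N.tmop V (coeMat s) = 1 := by
  have hinv : N.tmop V (coeMat s) ∈ (N.tens V).invAlg :=
    N.tmop_mem_invAlg.2 fun i k => hA (s i k).2
  have h1 : sᴴ = s ↔ IsSelfAdjoint (N.tmop V (coeMat s)) := by
    rw [IsSelfAdjoint, ← N.tmop_star, N.tmop_injective.eq_iff, ← coeMat_star,
      coeMat_injective.eq_iff]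
  have h2 : s * s = 1 ↔ N.tmop V (coeMat s) * N.tmop V (coeMat s) = 1 := by
    have e : N.tmop V (coeMat (1 : Matrix V.ι V.ι A)) = 1 := by rw [coeMat_one, N.tmop_one]
    rw [← N.tmop_mul, ← e, N.tmop_injective.eq_iff, ← coeMat_mul, coeMat_injective.eq_iff]
  have h3 : (∀ q, lift A (V.u q) * s.map ((N.qAction hp A hA had).act q) * (lift A (V.u q))ᴴ
      = sgn (T.c q) • s) ↔ (N.tens V).TwInvariant (N.tmop V (coeMat s)) := by
    have key : ∀ q, (lift A (V.u q) * s.map ((N.qAction hp A hA had).act q) * (lift A (V.u q))ᴴ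
        = sgn (T.c q) • s) ↔ (N.tens V).ad (Function.surjInv hp q) (N.tmop V (coeMat s))
          = sgn (T.c q) • N.tmop V (coeMat s) := fun q => by
      rw [N.tens_ad_tmop, Function.surjInv_eq hp q, ← N.tmop_smul, N.tmop_injective.eq_iff,
        ← coeMat_injective.eq_iff, coeMat_mul, coeMat_mul, coeMat_star, coeMat_lift, coeMat_smul]
      rfl
    rw [UFModule.twInvariant_iff]
    constructor
    · intro h g
      rw [UFModule.ad_eq_of_map_eq hinv (h := Function.surjInv hp (p g))
        (Function.surjInv_eq hp _).symm]
      exact (key _).1 (h _)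
    · intro h q
      rw [key, h]
      have : (T.comap p).c (Function.surjInv hp q) = T.c q := congrArg T.c (Function.surjInv_eq hp q)
      rw [this]
  exact ⟨fun h => ⟨h3.1 h.2.2, h1.1 h.1, h2.1 h.2.1⟩, fun h => ⟨h1.2 h.2.1, h2.2 h.2.2, h3.2 h.1⟩⟩

variable [MetricSpace X] [IsIsometricSMul G X]

/-- The action of `Q` on the Roe algebra of a module over the twist `(φ, 0, 0)`. -/
abbrev UFModule.roeAct : TwAction T.φ N.roe := N.roeAction hp

/-- The K-group of the Roe algebra of a module. -/
abbrev KRoe := K0 (T := T) (N.roeAct hp)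

theorem UFModule.mem_symm_iff (V : MatRep T) (s : Matrix V.ι V.ι N.roe) :
    s ∈ Symm (T := T) (N.roeAct hp) V ↔ N.tmop V (coeMat s) ∈ (N.tens V).Sym :=
  (N.mem_symmSet_iff hp N.roe N.roe_le_invAlg (fun g _ => N.ad_mem_roe g) V s).trans
    ⟨fun h => ⟨N.tmop_mem_roe.2 fun i k => (s i k).2, h⟩, fun h => h.2⟩

/-- The matrix over the Roe algebra of an element of the Roe algebra of `N ⊗ V`. -/
def UFModule.roeMat {V : MatRep T} (S : (N.tens V).H →L[ℂ] (N.tens V).H) (hS : S ∈ (N.tens V).roe) :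
    Matrix V.ι V.ι N.roe := fun i k =>
  ⟨N.tmat V S i k, by
    rw [← N.tmop_tmat S] at hS
    exact N.tmop_mem_roe.1 hS i k⟩

theorem UFModule.tmop_roeMat {V : MatRep T} (S : (N.tens V).H →L[ℂ] (N.tens V).H)
    (hS : S ∈ (N.tens V).roe) : N.tmop V (coeMat (N.roeMat S hS)) = S := N.tmop_tmat S

/-- The class in K-theory of a symmetry of `N ⊗ V`. -/
def kcls (V : MatRep T) (S : (N.tens V).Sym) : KRoe hp N :=
  K0.mk _ V ⟨N.roeMat S.1 S.2.1, (N.mem_symm_iff hp V _).2 (by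
    rw [N.tmop_roeMat]; exact S.2)⟩

variable {N}

theorem kcls_tmop (V : MatRep T) (s : Symm (T := T) (N.roeAct hp) V) :
    kcls hp N V ⟨N.tmop V (coeMat s.1), (N.mem_symm_iff hp V _).1 s.2⟩ = K0.mk _ V s := by
  have h : N.roeMat (N.tmop V (coeMat s.1)) ((N.mem_symm_iff hp V _).1 s.2).1 = s.1 :=
    coeMat_injective (N.tmop_injective (N.tmop_roeMat _ _))
  exact congrArg (K0.mk _ V) (Subtype.ext h)

theorem kcls_congr {V : MatRep T} {S S' : (N.tens V).Sym} (h : S.1 = S'.1) :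
    kcls hp N V S = kcls hp N V S' := by rw [Subtype.ext h]

theorem kcls_joined {V : MatRep T} {S S' : (N.tens V).Sym} (h : JoinedIn (N.tens V).Sym S.1 S'.1) :
    kcls hp N V S = kcls hp N V S' := by
  refine Quot.sound (K0Rel.homotopy V _ _ ?_)
  obtain ⟨c, hc⟩ := h
  refine ⟨⟨⟨fun r => N.roeMat (c r) (hc r).1, ?_⟩, ?_, ?_⟩, fun r =>
    (N.mem_symm_iff hp V _).2 (by
      change N.tmop V (coeMat (N.roeMat (c r) (hc r).1)) ∈ _
      rw [N.tmop_roeMat]; exact hc r)⟩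
  · exact continuous_matrix fun i k => Continuous.subtype_mk
      ((N.tmat_continuous.matrix_elem i k).comp c.continuous) _
  · exact coeMat_injective (N.tmop_injective (by
      change N.tmop V (coeMat (N.roeMat (c 0) (hc 0).1)) = _
      rw [N.tmop_roeMat, N.tmop_roeMat, c.source]))
  · exact coeMat_injective (N.tmop_injective (by
      change N.tmop V (coeMat (N.roeMat (c 1) (hc 1).1)) = _
      rw [N.tmop_roeMat, N.tmop_roeMat, c.target]))

theorem kcls_incl {V W : MatRep T} (J : RepIncl V W) (S : (N.tens V).Sym) :
    kcls hp N W ⟨(Emb.tens N J).push S.1, (Emb.tens N J).push_mem_sym S.2⟩ = kcls hp N V S := by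
  refine (Quot.sound (K0Rel.incl V W _ _ J.J ⟨J.isom, J.even, J.equiv, ?_⟩)).symm
  refine coeMat_injective (N.tmop_injective ?_)
  rw [N.tmop_roeMat, coeMat_add, coeMat_mul, coeMat_mul, coeMat_star, coeMat_lift, coeMat_lift,
    ← Emb.tens_push, N.tmop_roeMat]

theorem UFModule.tmop_coeMat_fromBlocks {V W : MatRep T} (N : UFModule (T.phiOnly.comap p) X)
    (a : Matrix V.ι V.ι N.roe) (b : Matrix W.ι W.ι N.roe) :
    N.tmop (V.dsum W) (coeMat (Matrix.fromBlocks a 0 0 b))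
      = (Emb.tensSum N V W).push (osum (N.tmop V (coeMat a)) (N.tmop W (coeMat b))) := by
  exact (congrArg (N.tmop (V.dsum W)) (coeMat_fromBlocks a 0 0 b)).trans
    (Emb.tensSum_push N _ _).symm

theorem kcls_add (V W : MatRep T) (S : (N.tens V).Sym) (S' : (N.tens W).Sym)
    (h : (Emb.tensSum N V W).push (osum S.1 S'.1) ∈ (N.tens (V.dsum W)).Sym) :
    kcls hp N V S + kcls hp N W S' = kcls hp N (V.dsum W) ⟨_, h⟩ := by
  refine congrArg (Quot.mk _) (Sigma.ext rfl (heq_of_eq (Subtype.ext ?_)))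
  refine coeMat_injective (N.tmop_injective ?_)
  refine (N.tmop_coeMat_fromBlocks _ _).trans (Eq.trans ?_ (N.tmop_roeMat _ h.1).symm)
  exact congrArg₂ (fun a b => (Emb.tensSum N V W).push (osum a b)) (N.tmop_roeMat _ S.2.1)
    (N.tmop_roeMat _ S'.2.1)

/-- Functions on the K-group, in terms of symmetries of the modules `N ⊗ V`. -/
def kLift {β : Type*} (F : ∀ V : MatRep T, (N.tens V).Sym → β)
    (hincl : ∀ (V W : MatRep T) (J : RepIncl V W) (S : (N.tens V).Sym),
      F W ⟨(Emb.tens N J).push S.1, (Emb.tens N J).push_mem_sym S.2⟩ = F V S)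
    (hjoin : ∀ (V : MatRep T) (S S' : (N.tens V).Sym), JoinedIn (N.tens V).Sym S.1 S'.1 →
      F V S = F V S') : KRoe hp N → β :=
  Quot.lift (fun x => F x.1 ⟨N.tmop x.1 (coeMat x.2.1), (N.mem_symm_iff hp x.1 _).1 x.2.2⟩) (by
    rintro _ _ (⟨V, W, s, s', j, h⟩ | ⟨V, s, s', h⟩)
    · refine (hincl V W ⟨j, h.isom, h.even, h.equiv⟩ _).symm.trans (congrArg (F W) (Subtype.ext ?_))
      have e : coeMat s'.1 = N.lft j * coeMat s.1 * (N.lft j)ᴴ + N.lft (W.Γ * (1 - j * jᴴ)) := by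
        rw [h.eq, coeMat_add, coeMat_mul, coeMat_mul, coeMat_star, coeMat_lift, coeMat_lift]
      exact (Emb.tens_push N ⟨j, h.isom, h.even, h.equiv⟩ _).trans (congrArg (N.tmop W) e.symm)
    · refine hjoin V _ _ ?_
      obtain ⟨c, hc⟩ := h
      have hcont : Continuous fun s : Matrix V.ι V.ι N.roe => N.tmop V (coeMat s) :=
        N.tmop_continuous.comp (continuous_id.matrix_map continuous_subtype_val)
      exact ⟨c.map hcont, fun r => (N.mem_symm_iff hp V _).1 (hc r)⟩)

theorem kLift_kcls {β : Type*} (F : ∀ V : MatRep T, (N.tens V).Sym → β) (hincl) (hjoin)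
    (V : MatRep T) (S : (N.tens V).Sym) : kLift hp F hincl hjoin (kcls hp N V S) = F V S :=
  congrArg (F V) (Subtype.ext (N.tmop_roeMat (V := V) S.1 S.2.1))

theorem exists_kcls (x : KRoe hp N) : ∃ V S, kcls hp N V S = x := by
  obtain ⟨V, s⟩ := x
  exact ⟨V, _, kcls_tmop hp V s⟩

/-! ### Classes of symmetries of arbitrary modules -/

/-- The class of the symmetry of `N ⊗ V` obtained from a symmetry of `M` through an embedding. -/
def pcls {M : UFModule (T.comap p) X} {V : MatRep T} (e : Emb M (N.tens V)) (S : M.Sym) :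
    KRoe hp N := kcls hp N V ⟨e.push S.1, e.push_mem_sym S.2⟩

/-- Composing with the inclusions of `V` and `W` into `V ⊕ W` does not change the classes and makes
the two embeddings orthogonal, so that they can be rotated into each other. No relation between `a`
and `b` is required. -/
theorem pcls_eq {M : UFModule (T.comap p) X} {V W : MatRep T} (a : Emb M (N.tens V))
    (b : Emb M (N.tens W)) (S : M.Sym) : pcls hp a S = pcls hp b S := by
  have h1 : pcls hp ((Emb.tens N (RepIncl.inl V W)).comp a) S = pcls hp a S :=
    (kcls_congr hp (Emb.comp_push _ _ _)).trans
      (kcls_incl hp (RepIncl.inl V W) ⟨a.push S.1, a.push_mem_sym S.2⟩)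
  have h2 : pcls hp ((Emb.tens N (RepIncl.inr V W)).comp b) S = pcls hp b S :=
    (kcls_congr hp (Emb.comp_push _ _ _)).trans
      (kcls_incl hp (RepIncl.inr V W) ⟨b.push S.1, b.push_mem_sym S.2⟩)
  rw [← h1, ← h2]
  refine kcls_joined hp (Emb.push_joinedIn _ _ (fun v => ?_) fun e => e.push_mem_sym S.2)
  rw [Emb.adj_comp]
  change adjoint a.j (adjoint (Emb.tens N (RepIncl.inl V W)).j
    ((Emb.tens N (RepIncl.inr V W)).j (b.j v))) = 0
  rw [Emb.tens_inl_inr, map_zero]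

variable (N) in
/-- Every module has an embedding into some `N ⊗ V`. -/
def Absorbing : Prop :=
  ∀ M : UFModule (T.comap p) X, ∃ V : MatRep T, Nonempty (Emb M (N.tens V))

/-- The class in the K-theory of the Roe algebra of `N` of a symmetry of a module. -/
def fcls (hN : Absorbing N) (M : UFModule (T.comap p) X) (S : M.Sym) :
    KRoe hp N := pcls hp (hN M).choose_spec.some S

variable (hN : Absorbing N) {M M' : UFModule (T.comap p) X}

theorem fcls_eq {V : MatRep T} (e : Emb M (N.tens V)) (S : M.Sym) :
    fcls hp hN M S = pcls hp e S := pcls_eq hp _ _ S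

theorem fcls_tens (V : MatRep T) (S : (N.tens V).Sym) :
    fcls hp hN (N.tens V) S = kcls hp N V S :=
  (fcls_eq hp hN (Emb.refl _) S).trans (kcls_congr hp (Emb.refl_push _))

/-- An embedding of `M'` composed with `e` is an embedding of `M`, and the class does not depend on
the embedding used. -/
theorem fcls_push (e : Emb M M') (S : M.Sym) :
    fcls hp hN M' ⟨e.push S.1, e.push_mem_sym S.2⟩ = fcls hp hN M S := by
  obtain ⟨V, ⟨f⟩⟩ := hN M'
  rw [fcls_eq hp hN f, fcls_eq hp hN (f.comp e)]
  exact kcls_congr hp (Emb.comp_push _ _ _).symm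

theorem fcls_joined {S S' : M.Sym} (h : JoinedIn M.Sym S.1 S'.1) :
    fcls hp hN M S = fcls hp hN M S' :=
  kcls_joined hp (Emb.push_joinedIn_sym _ h)

/-- The identity `S ⊕ S' = (S ⊕ γ') + (γ ⊕ S') - (γ ⊕ γ')` reduces the claim to push-forwards along
the two summands, avoiding an approximation in both variables. -/
theorem UFModule.osum_mem_roe {S : M.H →L[ℂ] M.H} {S' : M'.H →L[ℂ] M'.H} (h : S ∈ M.roe)
    (h' : S' ∈ M'.roe) : osum S S' ∈ (M.dsum M').roe := by
  have h1 : (Emb.inl M M').push S ∈ (M.dsum M').roe := (Emb.inl M M').push_mem_roe h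
  have h2 : (Emb.inr M M').push S' ∈ (M.dsum M').roe := (Emb.inr M M').push_mem_roe h'
  have h3 : (M.dsum M').γ ∈ (M.dsum M').roe := (M.dsum M').γ_mem_sym.1
  have h4 : osum S S' = (Emb.inl M M').push S + (Emb.inr M M').push S' - (M.dsum M').γ := by
    rw [Emb.inl_push, Emb.inr_push]
    ext v
    refine wext ?_ ?_
    · change S v.fst = S v.fst + M.γ v.fst - M.γ v.fst
      rw [add_sub_cancel_right]
    · change S' v.snd = M'.γ v.snd + S' v.snd - M'.γ v.snd
      rw [add_sub_cancel_left]
  rw [h4]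
  exact sub_mem (add_mem h1 h2) h3

theorem UFModule.osum_mem_sym {S : M.H →L[ℂ] M.H} {S' : M'.H →L[ℂ] M'.H} (h : S ∈ M.Sym)
    (h' : S' ∈ M'.Sym) : osum S S' ∈ (M.dsum M').Sym :=
  ⟨UFModule.osum_mem_roe h.1 h'.1, fun g v => wext (h.2.1 g v.fst) (h'.2.1 g v.snd),
    opSum_selfAdjoint h.2.2.1 h'.2.2.1, (opSum_mul _ _ _ _).trans (by
      rw [h.2.2.2, h'.2.2.2]; exact opSum_one)⟩

theorem fcls_add (S : M.Sym) (S' : M'.Sym) :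
    fcls hp hN (M.dsum M') ⟨osum S.1 S'.1, UFModule.osum_mem_sym S.2 S'.2⟩
      = fcls hp hN M S + fcls hp hN M' S' := by
  obtain ⟨V, ⟨e⟩⟩ := hN M
  obtain ⟨W, ⟨f⟩⟩ := hN M'
  rw [fcls_eq hp hN e, fcls_eq hp hN f, fcls_eq hp hN ((Emb.tensSum N V W).comp (e.dsum f))]
  have h : ((Emb.tensSum N V W).comp (e.dsum f)).push (osum S.1 S'.1)
      = (Emb.tensSum N V W).push (osum (e.push S.1) (f.push S'.1)) := by
    rw [Emb.comp_push, Emb.dsum_push]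
  refine Eq.trans (kcls_congr hp h) (kcls_add hp V W ⟨e.push S.1, e.push_mem_sym S.2⟩
    ⟨f.push S'.1, f.push_mem_sym S'.2⟩ ((Emb.tensSum N V W).push_mem_sym
      (UFModule.osum_mem_sym (e.push_mem_sym S.2) (f.push_mem_sym S'.2)))).symm

/-- The comparison of the K-groups of the Roe algebras of two absorbing modules. -/
def kMap (hN : Absorbing N) (N' : UFModule (T.phiOnly.comap p) X) :
    KRoe hp N' → KRoe hp N :=
  kLift hp (fun V S => fcls hp hN (N'.tens V) S)
    (fun _ _ J S => fcls_push hp hN (Emb.tens N' J) S) fun _ _ _ h => fcls_joined hp hN h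

/-- The comparison map fixes the class of every symmetry of every module. Since all K-theory classes
arise in this way, this one formula makes the two comparison maps inverse to each other and
additive. -/
theorem kMap_fcls {N' : UFModule (T.phiOnly.comap p) X} (hN' : Absorbing N') (S : M.Sym) :
    kMap hp hN N' (fcls hp hN' M S) = fcls hp hN M S := by
  obtain ⟨V, ⟨e⟩⟩ := hN' M
  rw [fcls_eq hp hN' e]
  refine (kLift_kcls hp _ _ _ _ _).trans ?_
  exact fcls_push hp hN e S

theorem exists_fcls (x : KRoe hp N) :
    ∃ (M : UFModule (T.comap p) X) (S : M.Sym), fcls hp hN M S = x := by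
  obtain ⟨V, S, rfl⟩ := exists_kcls hp x
  exact ⟨_, S, fcls_tens hp hN V S⟩

/-- The K-groups of the Roe algebras of two absorbing modules are isomorphic. -/
def kEquiv {N' : UFModule (T.phiOnly.comap p) X} (hN' : Absorbing N') :
    KRoe hp N' ≃+ KRoe hp N where
  toFun := kMap hp hN N'
  invFun := kMap hp hN' N
  left_inv x := by
    obtain ⟨M, S, rfl⟩ := exists_fcls hp hN' x
    rw [kMap_fcls, kMap_fcls]
  right_inv x := by
    obtain ⟨M, S, rfl⟩ := exists_fcls hp hN x
    rw [kMap_fcls, kMap_fcls]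
  map_add' x y := by
    obtain ⟨M, S, rfl⟩ := exists_fcls hp hN' x
    obtain ⟨M', S', rfl⟩ := exists_fcls hp hN' y
    rw [← fcls_add, kMap_fcls, kMap_fcls, kMap_fcls, fcls_add]

end kcls

/-! ### Topological phases and K-theory -/

section phases

variable {G : Type u} [Group G] {Q : Type v} [Group Q] {T : Twist Q} {X : Type u}
  [MulAction G X] {p : G →* Q} {M M' : UFModule (T.comap p) X}

theorem UFModule.norm_osum_lt {A : M.H →L[ℂ] M.H} {B : M'.H →L[ℂ] M'.H} {r : ℝ}
    (hA : ‖A‖ < r) (hB : ‖B‖ < r) : ‖osum A B‖ < r := by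
  refine (ContinuousLinearMap.opNorm_le_bound _ (le_max_of_le_left (norm_nonneg A))
    fun v => ?_).trans_lt (max_lt hA hB)
  refine (pow_le_pow_iff_left₀ (norm_nonneg _) (by positivity) two_ne_zero).1 ?_
  have e1 : ‖osum A B v‖ ^ 2 = ‖A v.fst‖ ^ 2 + ‖B v.snd‖ ^ 2 := WithLp.prod_norm_sq_eq_of_L2 _
  have e2 : ‖v‖ ^ 2 = ‖v.fst‖ ^ 2 + ‖v.snd‖ ^ 2 := WithLp.prod_norm_sq_eq_of_L2 _
  rw [e1, mul_pow, e2, mul_add, ← mul_pow, ← mul_pow]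
  gcongr
  · exact (A.le_opNorm _).trans (by gcongr; exact le_max_left _ _)
  · exact (B.le_opNorm _).trans (by gcongr; exact le_max_right _ _)

theorem UFModule.osum_sub (A C : M.H →L[ℂ] M.H) (B D : M'.H →L[ℂ] M'.H) :
    osum A B - osum C D = osum (A - C) (B - D) := by
  ext v
  exact wext rfl rfl

theorem UFModule.smul_osum (z : ℂ) (A : M.H →L[ℂ] M.H) (B : M'.H →L[ℂ] M'.H) :
    z • osum A B = osum (z • A) (z • B) := by
  ext v
  exact wext rfl rfl

variable [MetricSpace X]

/-- The phase of a Hamiltonian. -/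
def tcls (M : UFModule (T.comap p) X) (h : M.Hamiltonians) : TP (T.comap p) X :=
  Quot.mk _ ⟨M, h.1, h.2⟩

theorem UFModule.osum_mem_hamiltonians {h : M.H →L[ℂ] M.H} {h' : M'.H →L[ℂ] M'.H}
    (hh : h ∈ M.Hamiltonians) (hh' : h' ∈ M'.Hamiltonians) :
    osum h h' ∈ (M.dsum M').Hamiltonians := opSum_mem hh hh'

theorem tcls_joined {h h' : M.Hamiltonians} (c : JoinedIn M.Hamiltonians h.1 h'.1) :
    tcls M h = tcls M h' := Quot.sound (BulkRel.homotopy M _ _ _ _ c)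

theorem tcls_add (h : M.Hamiltonians) (h' : M'.Hamiltonians) : tcls M h + tcls M' h'
    = tcls (M.dsum M') ⟨osum h.1 h'.1, UFModule.osum_mem_hamiltonians h.2 h'.2⟩ := rfl

theorem tcls_stab (h : M.Hamiltonians) (h' : M'.Hamiltonians)
    (hc : ∀ x, Commute (M'.proj x) h'.1) : tcls M h + tcls M' h' = tcls M h :=
  (Quot.sound (BulkRel.stab ⟨M, h.1, h.2⟩ ⟨M', h'.1, h'.2⟩ hc)).symm

theorem tcls_add_comm (h : M.Hamiltonians) (h' : M'.Hamiltonians) :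
    tcls M h + tcls M' h' = tcls M' h' + tcls M h :=
  Quot.sound (BulkRel.swap ⟨M, h.1, h.2⟩ ⟨M', h'.1, h'.2⟩)

theorem UFModule.γ_mem_hamiltonians (M : UFModule (T.comap p) X) : M.γ ∈ M.Hamiltonians :=
  UFModule.mem_hamiltonians_iff.2 ⟨UFModule.controlled_γ, M.sym_subset_gSym M.γ_mem_sym⟩

/-- Up to trivial summands, `h` is `h ⊕ γ'` and its push-forward is `γ ⊕ e.push h`. On `M ⊕ M'`
these are the push-forwards of `h` along two isometries with orthogonal ranges, and the rotation
between them stays within the Hamiltonians. -/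
theorem tcls_push (e : Emb M M') (h : M.Hamiltonians) :
    tcls M' ⟨e.push h.1, e.push_mem_hamiltonians h.2⟩ = tcls M h := by
  have h1 : tcls M h + tcls M' ⟨M'.γ, M'.γ_mem_hamiltonians⟩ = tcls M h :=
    tcls_stab _ _ fun x => (M'.proj_γ x).symm
  have h2 : tcls M' ⟨e.push h.1, e.push_mem_hamiltonians h.2⟩ + tcls M ⟨M.γ, M.γ_mem_hamiltonians⟩
      = tcls M' ⟨e.push h.1, e.push_mem_hamiltonians h.2⟩ :=
    tcls_stab _ _ fun x => (M.proj_γ x).symm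
  rw [← h1, ← h2, tcls_add_comm, tcls_add, tcls_add]
  have e1 : osum h.1 M'.γ = (Emb.inl M M').push h.1 := (Emb.inl_push _).symm
  have e2 : osum M.γ (e.push h.1) = ((Emb.inr M M').comp e).push h.1 :=
    (Emb.inr_push _).symm.trans (Emb.comp_push _ _ _).symm
  refine (tcls_joined (?_ : JoinedIn _ (osum h.1 M'.γ) (osum M.γ (e.push h.1)))).symm
  rw [e1, e2]
  refine Emb.push_joinedIn (Emb.inl M M') ((Emb.inr M M').comp e) (fun v => ?_)
    fun f => f.push_mem_hamiltonians h.2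
  exact Emb.inl_inr (e.j v)

variable [IsIsometricSMul G X] [Finite Q] (hp : Function.Surjective p)

/-- The phase of the Hamiltonians near a symmetry in the Roe algebra. -/
def aprx (M : UFModule (T.comap p) X) (S : M.Sym) : TP (T.comap p) X :=
  tcls M ⟨_, (UFModule.exists_hamiltonian_near hp M S.2 one_pos le_rfl).choose_spec.1⟩

/-- Any two Hamiltonians in the unit ball around `S` are joined by a segment of Hamiltonians, so the
approximant chosen in `aprx` is irrelevant. -/
theorem aprx_eq (S : M.Sym) (h : M.Hamiltonians) (d : ‖h.1 - S.1‖ < 1) :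
    aprx hp M S = tcls M h :=
  tcls_joined (UFModule.joinedIn_hamiltonians S.2
    (UFModule.exists_hamiltonian_near hp M S.2 one_pos le_rfl).choose_spec.1 h.2
    (UFModule.exists_hamiltonian_near hp M S.2 one_pos le_rfl).choose_spec.2 d)

theorem exists_near (hp : Function.Surjective p) (S : M.Sym) {ε : ℝ} (hε : 0 < ε) (hε' : ε ≤ 1) :
    ∃ h : M.Hamiltonians, ‖h.1 - S.1‖ < ε := by
  obtain ⟨h, hh, d⟩ := UFModule.exists_hamiltonian_near hp M S.2 hε hε'
  exact ⟨⟨h, hh⟩, d⟩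

theorem aprx_push (e : Emb M M') (S : M.Sym) :
    aprx hp M' ⟨e.push S.1, e.push_mem_sym S.2⟩ = aprx hp M S := by
  obtain ⟨h, d⟩ := exists_near hp S one_pos le_rfl
  rw [aprx_eq hp S h d, ← tcls_push e h]
  exact aprx_eq hp _ _ ((e.norm_push_sub_le _ _).trans_lt d)

/-- The symmetries along the path need not be controlled, so the path itself gives no path of
Hamiltonians. Instead the phase is locally constant: a Hamiltonian within one half of `c t` is
within distance one of all nearby `c r`. -/
theorem aprx_joined {S S' : M.Sym} (c : JoinedIn M.Sym S.1 S'.1) :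
    aprx hp M S = aprx hp M S' := by
  obtain ⟨c, hc⟩ := c
  have hloc : IsLocallyConstant fun t => aprx hp M ⟨c t, hc t⟩ := by
    refine (IsLocallyConstant.iff_eventually_eq _).2 fun t => ?_
    obtain ⟨h, d⟩ := exists_near hp ⟨c t, hc t⟩ (one_half_pos (α := ℝ)) (by norm_num)
    have hev := Metric.tendsto_nhds.1 (c.continuous.tendsto t) _ (one_half_pos (α := ℝ))
    filter_upwards [hev] with r hr
    rw [aprx_eq hp ⟨c r, hc r⟩ h, aprx_eq hp ⟨c t, hc t⟩ h (d.trans one_half_lt_one)]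
    have e : h.1 - c r = (h.1 - c t) + (c t - c r) := by abel
    rw [e]
    rw [dist_comm, dist_eq_norm] at hr
    exact (norm_add_le _ _).trans_lt (by have := add_lt_add d hr; linarith)
  have h01 := hloc.apply_eq_of_isPreconnected isPreconnected_univ (Set.mem_univ 0) (Set.mem_univ 1)
  have e0 : (⟨c 0, hc 0⟩ : M.Sym) = S := Subtype.ext c.source
  have e1 : (⟨c 1, hc 1⟩ : M.Sym) = S' := Subtype.ext c.target
  rwa [e0, e1] at h01

theorem aprx_add (S : M.Sym) (S' : M'.Sym) :
    aprx hp (M.dsum M') ⟨osum S.1 S'.1, UFModule.osum_mem_sym S.2 S'.2⟩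
      = aprx hp M S + aprx hp M' S' := by
  obtain ⟨h, d⟩ := exists_near hp S one_pos le_rfl
  obtain ⟨h', d'⟩ := exists_near hp S' one_pos le_rfl
  rw [aprx_eq hp S h d, aprx_eq hp S' h' d', tcls_add]
  refine aprx_eq hp _ ⟨osum h.1 h'.1, UFModule.osum_mem_hamiltonians h.2 h'.2⟩ ?_
  have e := UFModule.norm_osum_lt d d'
  rwa [← UFModule.osum_sub] at e

/-- The flattening of a Hamiltonian. -/
def flat (M : UFModule (T.comap p) X) (h : M.Hamiltonians) : M.Sym :=
  ⟨sgnElt h.1, UFModule.sgnElt_mem_sym (UFModule.mem_hamiltonians_iff.1 h.2).2⟩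

theorem exists_near_flat (h : M.Hamiltonians) : ∃ c₀ : ℝ, 0 < c₀ ∧ ∀ c : ℝ, 0 < c → c ≤ c₀ →
    ‖(c : ℂ) • h.1 - (flat M h).1‖ < 1 :=
  exists_norm_smul_sub_sgnElt_lt h.2.2.2.1 (UFModule.mem_hamiltonians_iff.1 h.2).2.2.2.2

/-- A sufficiently small positive multiple of `h` is close to the sign of `h`, and scaling by a
positive factor does not change the phase. -/
theorem aprx_flat (h : M.Hamiltonians) : aprx hp M (flat M h) = tcls M h := by
  obtain ⟨c, hc, d⟩ := exists_near_flat h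
  rw [aprx_eq hp (flat M h) ⟨_, UFModule.smul_mem_hamiltonians h.2 hc⟩ (d c hc le_rfl)]
  exact (tcls_joined (UFModule.joinedIn_smul h.2 hc)).symm

theorem joinedIn_flat (S : M.Sym) (h : M.Hamiltonians) {c : ℝ} (hc : 0 < c)
    (d : ‖(c : ℂ) • h.1 - S.1‖ < 1) : JoinedIn M.Sym S.1 (flat M h).1 :=
  UFModule.joinedIn_sgnElt S.2 (UFModule.mem_hamiltonians_iff.1 h.2).2 hc d

variable (N : UFModule (T.phiOnly.comap p) X)

/-- The phase of a K-theory class. -/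
def phase : KRoe hp N → TP (T.comap p) X :=
  kLift hp (fun V S => aprx hp (N.tens V) S) (fun _ _ J S => aprx_push hp (Emb.tens N J) S)
    fun _ _ _ h => aprx_joined hp h

variable {N} (hN : Absorbing N)

theorem phase_fcls (S : M.Sym) : phase hp N (fcls hp hN M S) = aprx hp M S := by
  obtain ⟨V, ⟨e⟩⟩ := hN M
  rw [fcls_eq hp hN e]
  exact (kLift_kcls hp _ _ _ _ _).trans (aprx_push hp e S)

theorem phase_add (hN : Absorbing N) (x y : KRoe hp N) : phase hp N (x + y) = phase hp N x + phase hp N y := by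
  obtain ⟨M, S, rfl⟩ := exists_fcls hp hN x
  obtain ⟨M', S', rfl⟩ := exists_fcls hp hN y
  rw [← fcls_add, phase_fcls, phase_fcls, phase_fcls, aprx_add]

variable {D : AddSubgroup (KRoe hp N)}

/-- Compatibility of the functional calculus with direct sums is bypassed: a small multiple of `h ⊕
h'` is within distance one of the direct sum of the signs, and this already gives a homotopy from
that sum to the sign of `h ⊕ h'`. -/
theorem fcls_flat_osum (h : M.Hamiltonians) (h' : M'.Hamiltonians) :
    fcls hp hN (M.dsum M') (flat _ ⟨osum h.1 h'.1, UFModule.osum_mem_hamiltonians h.2 h'.2⟩)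
      = fcls hp hN M (flat M h) + fcls hp hN M' (flat M' h') := by
  obtain ⟨c, hc, d⟩ := exists_near_flat h
  obtain ⟨c', hc', d'⟩ := exists_near_flat h'
  -- One factor must be small enough for both summands at once.
  have hm : 0 < min c c' := lt_min hc hc'
  refine Eq.trans ?_ (fcls_add hp hN (flat M h) (flat M' h'))
  refine (fcls_joined hp hN (joinedIn_flat (M := M.dsum M')
    ⟨osum (flat M h).1 (flat M' h').1, UFModule.osum_mem_sym (flat M h).2 (flat M' h').2⟩
    ⟨osum h.1 h'.1, UFModule.osum_mem_hamiltonians h.2 h'.2⟩ hm ?_)).symm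
  have e := UFModule.norm_osum_lt (d _ hm (min_le_left _ _)) (d' _ hm (min_le_right _ _))
  rwa [← UFModule.osum_sub, ← UFModule.smul_osum] at e

theorem fcls_flat_of_map (V : M.H ≃ₗᵢ[ℂ] M'.H) (hV : M.IsIso M' V) (h : M.Hamiltonians)
    (h' : M'.Hamiltonians) (e : ∀ v, V (h.1 v) = h'.1 (V v)) :
    fcls hp hN M (flat M h) = fcls hp hN M' (flat M' h') := by
  obtain ⟨c, hc, d⟩ := exists_near_flat h
  rw [← fcls_push hp hN (Emb.ofIso V hV)]
  refine fcls_joined hp hN (joinedIn_flat _ _ hc ?_)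
  have e' : (c : ℂ) • h'.1 = (Emb.ofIso V hV).push ((c : ℂ) • h.1) := by
    ext v
    obtain ⟨w, rfl⟩ := V.surjective v
    rw [Emb.ofIso_push]
    change (c : ℂ) • h'.1 (V w) = V ((c : ℂ) • h.1 w)
    rw [map_smul, e]
  rw [e']
  exact (Emb.norm_push_sub_le _ _ _).trans_lt (d c hc le_rfl)

theorem fcls_flat_joined {h h' : M.Hamiltonians} (c : JoinedIn M.Hamiltonians h.1 h'.1) :
    fcls hp hN M (flat M h) = fcls hp hN M (flat M h') := by
  obtain ⟨c, hc⟩ := c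
  refine fcls_joined hp hN ⟨⟨⟨fun t => sgnElt (c t), ?_⟩, ?_, ?_⟩, fun t => (flat M ⟨c t, hc t⟩).2⟩
  · exact sgnElt_continuous c.continuous (fun t => (hc t).2.2.1)
      fun t => (UFModule.mem_hamiltonians_iff.1 (hc t)).2.2.2.2
  · simp [flat]
  · simp [flat]

/-- Block diagonal invariant operators form a closed `*`-algebra, which therefore contains the sign
of each of its invertible self-adjoint elements. -/
theorem commute_flat {h : M.Hamiltonians} (hc : ∀ x, Commute (M.proj x) h.1) (x : X) :
    Commute (M.proj x) (flat M h).1 := by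
  have h1 : h.1 ∈ M.diag :=
    ⟨UFModule.TwInvariant.mem_invAlg h.2.1, hc⟩
  exact (show sgnElt h.1 ∈ M.diag from sgnElt_mem h1).2 x

/-- The phases as a quotient of a K-group, by a subgroup `D` consisting of the classes of block
diagonal symmetries. -/
def tpEquiv (hD : ∀ y, y ∈ D ↔ ∃ (M : UFModule (T.comap p) X) (S : M.Sym),
    (∀ x, Commute (M.proj x) S.1) ∧ fcls hp hN M S = y) : TP (T.comap p) X ≃+ KRoe hp N ⧸ D :=
  let f : TP (T.comap p) X →ₙ+ KRoe hp N ⧸ D :=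
    { toFun := Quot.lift (fun B => (fcls hp hN B.M (flat B.M ⟨B.ham, B.mem⟩) : KRoe hp N ⧸ D)) (by
        intro B C r
        cases r with
        | iso _ _ V hV h =>
          exact congrArg _ (fcls_flat_of_map hp hN V hV ⟨B.ham, B.mem⟩ ⟨C.ham, C.mem⟩ h)
        | homotopy M h₀ h₁ m₀ m₁ c =>
          exact congrArg _ (fcls_flat_joined (h := ⟨h₀, m₀⟩) (h' := ⟨h₁, m₁⟩) hp hN c)
        | stab _ B' h =>
          have e := fcls_flat_osum hp hN ⟨B.ham, B.mem⟩ ⟨B'.ham, B'.mem⟩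
          refine Eq.trans ?_ (congrArg _ e).symm
          refine (QuotientAddGroup.mk_add_of_mem _ ((hD _).2 ⟨B'.M, _, ?_, rfl⟩)).symm
          exact commute_flat (h := ⟨B'.ham, B'.mem⟩) h)
      map_add' := by
        rintro ⟨B⟩ ⟨B'⟩
        exact congrArg _ (fcls_flat_osum hp hN ⟨B.ham, B.mem⟩ ⟨B'.ham, B'.mem⟩) }
  have hf : ∀ (M : UFModule (T.comap p) X) h, f (tcls M h) = (fcls hp hN M (flat M h) : _ ⧸ D) :=
    fun _ _ => rfl
  have hex : ∀ y : TP (T.comap p) X, ∃ (M : UFModule (T.comap p) X) (h : M.Hamiltonians),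
      y = tcls M h := by
    rintro ⟨B⟩
    exact ⟨B.M, ⟨B.ham, B.mem⟩, rfl⟩
  AddEquiv.ofBijective f (by
    constructor
    · intro y y' hy
      obtain ⟨M, h, rfl⟩ := hex y
      obtain ⟨M', h', rfl⟩ := hex y'
      rw [hf, hf, QuotientAddGroup.eq] at hy
      obtain ⟨M₀, S, hS, e⟩ := (hD _).1 hy
      have e1 : phase hp N (fcls hp hN M' (flat M' h'))
          = phase hp N (fcls hp hN M (flat M h)) + phase hp N (fcls hp hN M₀ S) := by
        rw [← phase_add hp hN, e, add_neg_cancel_left]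
      -- A block diagonal symmetry is already controlled, hence is its own Hamiltonian, and adding
      -- it is one of the stabilisations.
      rw [phase_fcls, phase_fcls, phase_fcls, aprx_flat, aprx_flat,
        aprx_eq hp S ⟨S.1, UFModule.mem_hamiltonians_iff.2
          ⟨UFModule.controlled_of_commute hS, M₀.sym_subset_gSym S.2⟩⟩ (by simp), tcls_stab] at e1
      · exact e1.symm
      · exact hS
    · intro x
      obtain ⟨x, rfl⟩ := QuotientAddGroup.mk_surjective x
      obtain ⟨M, S, rfl⟩ := exists_fcls hp hN x
      -- A Hamiltonian near `S` has a sign homotopic to `S`, so it represents the given class.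
      obtain ⟨h, d⟩ := exists_near hp S one_pos le_rfl
      refine ⟨tcls M h, (hf M h).trans (congrArg _ ?_)⟩
      exact (fcls_joined hp hN (joinedIn_flat S h one_pos (by simpa using d))).symm)

end phases

/-! ### The decomposition of a module -/

theorem finrank_range_sum_smul_le {K V : Type*} [Field K] [AddCommGroup V] [Module K V] {X : Type*}
    (P : X → V →ₗ[K] V) (c : X → K) {N : ℕ} (h : ∀ x, FiniteDimensional K (LinearMap.range (P x)) ∧
      Module.finrank K (LinearMap.range (P x)) ≤ N) (s : Finset X) :
    FiniteDimensional K (LinearMap.range (∑ x ∈ s, c x • P x)) ∧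
      Module.finrank K (LinearMap.range (∑ x ∈ s, c x • P x)) ≤ s.card * N := by
  classical
  induction s using Finset.induction_on with
  | empty =>
    rw [Finset.sum_empty, LinearMap.range_zero]
    exact ⟨inferInstance, by simp⟩
  | insert x s hx ih =>
    have := (h x).1
    have := ih.1
    have hle : LinearMap.range (∑ y ∈ insert x s, c y • P y)
        ≤ LinearMap.range (P x) ⊔ LinearMap.range (∑ y ∈ s, c y • P y) := by
      rintro _ ⟨v, rfl⟩
      rw [Finset.sum_insert hx, LinearMap.add_apply]
      exact Submodule.add_mem_sup ⟨c x • v, map_smul _ _ _⟩ ⟨v, rfl⟩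
    refine ⟨Submodule.finiteDimensional_of_le hle, (Submodule.finrank_mono hle).trans ?_⟩
    refine (Submodule.finrank_add_le_finrank_add_finrank _ _).trans ?_
    rw [Finset.card_insert_of_notMem hx, add_mul, one_mul, add_comm]
    exact add_le_add ih.2 (h x).2

namespace UFModule

section decomposition

variable {G : Type u} [Group G] {T : Twist G} {X : Type u} [MulAction G X] (M : UFModule T X)

theorem inner_proj_self (x : X) (v : M.H) :
    inner ℂ (M.proj x v) v = ((‖M.proj x v‖ ^ 2 : ℝ) : ℂ) := by
  rw [← M.proj_proj, M.inner_proj, inner_self_eq_norm_sq_to_K, M.proj_proj]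
  norm_cast

theorem norm_sq_sum_proj (s : Finset X) (c : X → ℝ) (v : M.H) :
    ‖∑ x ∈ s, (c x : ℂ) • M.proj x v‖ ^ 2 = ∑ x ∈ s, c x ^ 2 * ‖M.proj x v‖ ^ 2 := by
  classical
  induction s using Finset.induction_on with
  | empty => simp
  | insert x s hx ih =>
    have h : inner ℂ ((c x : ℂ) • M.proj x v) (∑ y ∈ s, (c y : ℂ) • M.proj y v) = 0 := by
      rw [inner_sum]
      refine Finset.sum_eq_zero fun y hy => ?_
      have hne : x ≠ y := by rintro rfl; exact hx hy
      rw [inner_smul_left, inner_smul_right, M.inner_proj, M.proj_proj_of_ne hne, inner_zero_right,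
        mul_zero, mul_zero]
    rw [Finset.sum_insert hx, Finset.sum_insert hx, ← ih, sq,
      norm_add_sq_eq_norm_sq_add_norm_sq_of_inner_eq_zero _ _ h, norm_smul, ← sq, ← sq, mul_pow,
      Complex.norm_real, Real.norm_eq_abs, sq_abs]

theorem sum_norm_sq_proj_le (s : Finset X) (v : M.H) : ∑ x ∈ s, ‖M.proj x v‖ ^ 2 ≤ ‖v‖ ^ 2 := by
  have h1 := M.norm_sq_sum_proj s (fun _ => 1) v
  simp only [Complex.ofReal_one, one_smul, one_pow, one_mul] at h1
  have h2 : inner ℂ (∑ x ∈ s, M.proj x v) v = ((∑ x ∈ s, ‖M.proj x v‖ ^ 2 : ℝ) : ℂ) := by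
    rw [sum_inner, Complex.ofReal_sum]
    exact Finset.sum_congr rfl fun x _ => M.inner_proj_self x v
  have h3 := norm_inner_le_norm (𝕜 := ℂ) (∑ x ∈ s, M.proj x v) v
  rw [h2, Complex.norm_real, ← h1, Real.norm_of_nonneg (sq_nonneg _)] at h3
  rw [← h1]
  have h4 := norm_nonneg (∑ x ∈ s, M.proj x v)
  rcases h4.eq_or_lt with h | h
  · rw [← h, zero_pow two_ne_zero]; exact sq_nonneg _
  · have : ‖∑ x ∈ s, M.proj x v‖ ≤ ‖v‖ := by nlinarith
    gcongr

/-- Bessel's inequality makes the orthogonal components summable. Their sum has the same components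
as `v`, so totality of the projections identifies it with `v`. -/
theorem hasSum_proj (v : M.H) : HasSum (fun x => M.proj x v) v := by
  have hV : OrthogonalFamily ℂ (fun x => LinearMap.range (M.proj x : M.H →ₗ[ℂ] M.H))
      fun x => (LinearMap.range (M.proj x : M.H →ₗ[ℂ] M.H)).subtypeₗᵢ := by
    rintro x y hxy ⟨_, a, rfl⟩ ⟨_, b, rfl⟩
    change inner ℂ (M.proj x a) (M.proj y b) = 0
    rw [M.inner_proj, M.proj_proj_of_ne hxy, inner_zero_right]
  have hs : Summable fun x => M.proj x v := by
    refine (hV.summable_iff_norm_sq_summable fun x => ⟨M.proj x v, v, rfl⟩).2 ?_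
    exact summable_of_sum_le (fun _ => sq_nonneg _) fun s => M.sum_norm_sq_proj_le s v
  obtain ⟨w, hw⟩ := hs
  have e : w = v := by
    refine sub_eq_zero.1 (M.proj_total _ fun x => ?_)
    have h1 := (M.proj x).hasSum hw
    have h2 : HasSum (fun y => M.proj x (M.proj y v)) (M.proj x (M.proj x v)) :=
      hasSum_single x fun y hy => M.proj_proj_of_ne hy.symm v
    rw [map_sub, h1.unique h2, M.proj_proj, sub_self]
  rwa [e] at hw

theorem hasSum_norm_sq_proj (v : M.H) : HasSum (fun x => ‖M.proj x v‖ ^ 2) (‖v‖ ^ 2) := by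
  have h := (innerSL ℂ v).hasSum (M.hasSum_proj v)
  have h1 : ∀ x, innerSL ℂ v (M.proj x v) = ((‖M.proj x v‖ ^ 2 : ℝ) : ℂ) := fun x => by
    rw [innerSL_apply_apply, ← M.inner_proj, M.inner_proj_self]
  have h2 : innerSL ℂ v v = ((‖v‖ ^ 2 : ℝ) : ℂ) := by
    rw [innerSL_apply_apply, inner_self_eq_norm_sq_to_K]; norm_cast
  rw [h2, show (fun x => innerSL ℂ v (M.proj x v)) = _ from funext h1] at h
  exact_mod_cast h

/-- Finitely many functionals, homogeneous with respect to the grading, that compute the norms of the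
weighted sums of the components in a finite set. -/
theorem exists_functionals (n : ℕ) : ∃ d : ℕ, ∀ (s : Finset X) (a : X → ℝ), (∀ x, 0 ≤ a x) →
    s.card ≤ n → ∃ f : Fin d × ℤˣ → M.H →ₗ[ℂ] ℂ,
      (∀ l v, f l (M.γ v) = sgn l.2 * f l v) ∧
      (∀ v, ∑ l, ‖f l v‖ ^ 2 = ∑ x ∈ s, a x * ‖M.proj x v‖ ^ 2) ∧
      ∀ l x v, x ∉ s → f l (M.proj x v) = 0 := by
  classical
  obtain ⟨N, hN⟩ := M.uniformlyFinite
  refine ⟨n * N, fun s a ha hs => ?_⟩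
  -- The square roots are chosen so that `‖A v‖²` is the weighted sum of the `‖P_x v‖²`. The rank of
  -- `A` is at most `n * N`, whatever the set `s`.
  let A : M.H →ₗ[ℂ] M.H := ∑ x ∈ s, (√(a x) : ℂ) • (M.proj x : M.H →ₗ[ℂ] M.H)
  have hA : ∀ v, A v = ∑ x ∈ s, (√(a x) : ℂ) • M.proj x v := fun v => by
    simp [A, LinearMap.sum_apply]
  have hAγ : ∀ v, A (M.γ v) = M.γ (A v) := fun v => by
    rw [hA, hA, map_sum]
    exact Finset.sum_congr rfl fun x _ => by rw [map_smul, M.γ_proj]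
  obtain ⟨hfd, hd'⟩ : FiniteDimensional ℂ (LinearMap.range A) ∧
      Module.finrank ℂ (LinearMap.range A) ≤ s.card * N :=
    finrank_range_sum_smul_le (fun x => (M.proj x : M.H →ₗ[ℂ] M.H)) (fun x => (√(a x) : ℂ)) hN s
  have hd : Module.finrank ℂ (LinearMap.range A) ≤ n * N := hd'.trans (Nat.mul_le_mul_right N hs)
  let b := stdOrthonormalBasis ℂ (LinearMap.range A)
  -- Coordinates in an orthonormal basis of the range of `A`, padded by zero functionals. The index
  -- set thereby becomes the same for all `s`, as one finite dimensional representation must serve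
  -- all points.
  let β : Fin (n * N) → M.H →ₗ[ℂ] ℂ := fun m =>
    if h : m.1 < Module.finrank ℂ (LinearMap.range A) then
      (innerSL ℂ (b ⟨m.1, h⟩ : M.H) : M.H →ₗ[ℂ] ℂ) else 0
  have hβ : ∀ v, ∑ m, ‖β m (A v)‖ ^ 2 = ‖A v‖ ^ 2 := fun v => by
    have h1 := b.sum_sq_norm_inner_right (⟨A v, v, rfl⟩ : LinearMap.range A)
    have h2 : ‖(⟨A v, v, rfl⟩ : LinearMap.range A)‖ = ‖A v‖ := rfl
    rw [h2] at h1
    rw [← h1]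
    refine (Finset.sum_of_injOn (Fin.castLE hd) (Fin.castLE_injective hd).injOn (by simp)
      (fun m _ hm => ?_) fun m _ => ?_).symm
    · have : ¬ m.1 < Module.finrank ℂ (LinearMap.range A) := fun h =>
        hm ⟨⟨m.1, h⟩, by simp, rfl⟩
      simp [β, this]
    · simp only [β, Fin.val_castLE, m.2, dif_pos]
      rfl
  -- Each coordinate is split along the even and the odd part `(v ± γ v)/2`; the parallelogram law
  -- shows that the sum of squares is preserved.
  let f : Fin (n * N) × ℤˣ → M.H →ₗ[ℂ] ℂ := fun l =>
    (β l.1 ∘ₗ A) ∘ₗ ((2⁻¹ : ℂ) • (LinearMap.id + sgn l.2 • (M.γ : M.H →ₗ[ℂ] M.H)))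
  have hf : ∀ l v, f l v = β l.1 (A ((2⁻¹ : ℂ) • (v + sgn l.2 • M.γ v))) := fun l v => rfl
  refine ⟨f, fun l v => ?_, fun v => ?_, fun l x v hx => ?_⟩
  · have e : (2⁻¹ : ℂ) • (M.γ v + sgn l.2 • M.γ (M.γ v))
        = sgn l.2 • (2⁻¹ : ℂ) • (v + sgn l.2 • M.γ v) := by
      rw [M.γ_γ, smul_comm (sgn l.2) (2⁻¹ : ℂ), smul_add (sgn l.2), smul_smul (sgn l.2) (sgn l.2),
        sgn_mul_self, one_smul, add_comm]
    rw [hf, hf, e, map_smul A (sgn l.2), map_smul, smul_eq_mul]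
  · rw [Fintype.sum_prod_type_right]
    simp only [hf, hβ]
    have h1 : ∀ e : ℤˣ, A ((2⁻¹ : ℂ) • (v + sgn e • M.γ v))
        = (2⁻¹ : ℂ) • (A v + sgn e • M.γ (A v)) := fun e => by
      rw [map_smul, map_add, map_smul, hAγ]
    have h2 : ‖M.γ (A v)‖ = ‖A v‖ := by
      have := M.inner_γ (A v) (M.γ (A v))
      rw [M.γ_γ, inner_self_eq_norm_sq_to_K, inner_self_eq_norm_sq_to_K] at this
      have h3 : ‖M.γ (A v)‖ ^ 2 = ‖A v‖ ^ 2 := by exact_mod_cast this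
      exact (pow_left_inj₀ (norm_nonneg _) (norm_nonneg _) two_ne_zero).1 h3
    have h3 := parallelogram_law_with_norm ℂ (A v) (M.γ (A v))
    have h4 : (Finset.univ : Finset ℤˣ) = {1, -1} := rfl
    rw [h4, Finset.sum_pair (by decide), h1, h1]
    have h5 : sgn (-1) = -1 := by simp [sgn]
    rw [sgn_one, h5, one_smul, neg_one_smul, ← sub_eq_add_neg, norm_smul, norm_smul]
    have h6 := M.norm_sq_sum_proj s (fun x => √(a x)) v
    rw [← hA] at h6
    simp only [Real.sq_sqrt (ha _)] at h6
    rw [← h6]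
    rw [h2] at h3
    have h7 : ‖(2⁻¹ : ℂ)‖ = 2⁻¹ := by simp
    rw [h7, mul_pow, mul_pow]
    nlinarith
  · rw [hf]
    have h1 : ∀ w, A (M.proj x w) = 0 := fun w => by
      rw [hA]
      refine Finset.sum_eq_zero fun y hy => ?_
      rw [M.proj_proj_of_ne (by rintro rfl; exact hx hy), smul_zero]
    rw [map_smul A, map_add A, map_smul A, M.γ_proj, h1, h1, smul_zero, add_zero, smul_zero,
      map_zero]

end decomposition

end UFModule

/-! ### Multiples of the regular representation -/

section regular

variable {Q : Type v} [Group Q] [Finite Q] (T : Twist Q)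

variable {L : Type} [Fintype L] [DecidableEq L]

/-- The action of `q` on the index set of a multiple of the regular representation. -/
def regAct (q : Q) (k : Fin (Nat.card Q) × L) : Fin (Nat.card Q) × L :=
  (Finite.equivFin Q (q * (Finite.equivFin Q).symm k.1), k.2)

theorem regAct_injective (q : Q) : Function.Injective (regAct (L := L) q) := fun _ _ h =>
  Prod.ext ((Finite.equivFin Q).symm.injective (mul_left_cancel
    ((Finite.equivFin Q).injective (Prod.ext_iff.1 h).1))) (Prod.ext_iff.1 h).2

theorem regAct_mul (q r : Q) (k : Fin (Nat.card Q) × L) :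
    regAct (q * r) k = regAct q (regAct r k) := by
  simp [regAct, mul_assoc]

theorem regAct_symm (q : Q) (k : Fin (Nat.card Q) × L) :
    (Finite.equivFin Q).symm (regAct q k).1 = q * (Finite.equivFin Q).symm k.1 := by
  simp [regAct]

theorem regAct_surjective (q : Q) : Function.Surjective (regAct (L := L) q) := fun k =>
  ⟨regAct q⁻¹ k, by simp [regAct]⟩

/-- A sum of copies of the twisted regular representation, the grading being modified on the `l`-th
copy by the sign `σ l`. -/
def MatRep.regular (σ : L → ℤˣ) : MatRep T where
  -- The group `Q` is numbered by `Fin (Nat.card Q)` because index sets of representations live in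
  -- `Type`.
  ι := Fin (Nat.card Q) × L
  -- The factor `c` of the group element gives left translation by `q` the parity `c(q)`.
  Γ := Matrix.diagonal fun k => sgn (T.c ((Finite.equivFin Q).symm k.1) * σ k.2)
  u q := Matrix.of fun k k' =>
    if k = regAct q k' then (T.τ q ((Finite.equivFin Q).symm k'.1) : ℂ) else 0
  Γ_star := by
    rw [Matrix.diagonal_conjTranspose]
    congr 1
    funext k
    exact star_sgn _
  Γ_sq := by
    rw [Matrix.diagonal_mul_diagonal]
    simp
  u_unitary q := by
    rw [mul_eq_one_comm]
    ext k k'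
    have h : ∀ e : Q, star (T.τ q e : ℂ) * T.τ q e = 1 := fun e => by
      have := Complex.conj_mul' (T.τ q e : ℂ)
      rw [Circle.norm_coe, Complex.ofReal_one, one_pow] at this
      exact this
    simp only [Matrix.mul_apply, Matrix.conjTranspose_apply, Matrix.of_apply]
    rw [Finset.sum_eq_single (regAct q k') (fun k'' _ hk => by rw [if_neg hk, mul_zero])
      (fun hk => absurd (Finset.mem_univ _) hk), if_pos rfl, Matrix.one_apply]
    by_cases hk : k = k'
    · rw [hk, if_pos rfl, if_pos rfl, h]
    · rw [if_neg hk, if_neg fun e => hk (regAct_injective q e.symm), star_zero, zero_mul]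
  u_mul q r := by
    ext k k'
    simp only [Matrix.mul_apply, Matrix.map_apply, Matrix.of_apply, Matrix.smul_apply, smul_eq_mul]
    rw [Finset.sum_eq_single (regAct r k') (fun k'' _ hk => by rw [if_neg hk, map_zero, mul_zero])
      (fun hk => absurd (Finset.mem_univ _) hk), if_pos rfl, regAct_mul]
    by_cases hk : k = regAct q (regAct r k')
    · rw [if_pos hk, if_pos hk, regAct_symm, mul_comm, T.cocycle]
    · rw [if_neg hk, if_neg hk, zero_mul, mul_zero]
  u_Γ q := by
    ext k k'
    rw [Matrix.diagonal_map (map_zero _), Matrix.mul_diagonal, Matrix.smul_apply,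
      Matrix.diagonal_mul, Matrix.of_apply, smul_eq_mul]
    simp only [sg_sgn]
    by_cases hk : k = regAct q k'
    · rw [if_pos hk, hk, regAct_symm, map_mul]
      have h : (regAct q k').2 = k'.2 := rfl
      rw [h, sgn_mul, sgn_mul, sgn_mul]
      linear_combination (-(T.τ q ((Finite.equivFin Q).symm k'.1) : ℂ) *
        sgn (T.c ((Finite.equivFin Q).symm k'.1)) * sgn (σ k'.2)) * sgn_mul_self (T.c q)
    · rw [if_neg hk, zero_mul, mul_zero, mul_zero]

end regular

/-! ### Embeddings into multiples of `ℋ_{X,G}` -/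

/-- In the extended nonnegative reals sums can be computed and exchanged without summability;
finiteness of the total then returns an honest convergent sum. -/
theorem hasSum_of_tsum_ofReal {Y : Type*} {g : Y → ℝ} {c : ℝ} (hg : ∀ y, 0 ≤ g y) (hc : 0 ≤ c)
    (h : ∑' y, ENNReal.ofReal (g y) = ENNReal.ofReal c) : HasSum g c := by
  have h1 := ENNReal.hasSum_toReal (f := fun y => ENNReal.ofReal (g y))
    (by rw [h]; exact ENNReal.ofReal_ne_top)
  rw [← ENNReal.tsum_toReal_eq fun _ => ENNReal.ofReal_ne_top, h] at h1
  simpa [ENNReal.toReal_ofReal, hg, hc] using h1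

section coeff

variable {G : Type u} [Group G] {Q : Type v} [Group Q] {T : Twist Q} {p : G →* Q}
  {X Z : Type u} [MulAction G X] [MulAction G Z] (M : UFModule (T.comap p) Z)
  {L : Type} [Fintype L] [DecidableEq L] (f : X → L → M.H →ₗ[ℂ] ℂ)

theorem UFModule.U_symm_U (g h : G) (v : M.H) : (M.U (g * h)).symm (M.U g v)
    = sg (T.φ (p (g * h))) (T.τ (p g) (p h)) • (M.U h).symm v := by
  obtain ⟨w, rfl⟩ := (M.U h).surjective v
  rw [AddEquiv.symm_apply_apply, M.U_mul, M.U_symm_smul, AddEquiv.symm_apply_apply]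
  rfl

theorem UFModule.U_symm_γ (g : G) (v : M.H) : (M.U g).symm (M.γ v)
    = sgn (T.c (p g)) • M.γ ((M.U g).symm v) := by
  obtain ⟨w, rfl⟩ := (M.U g).surjective v
  apply (M.U g).injective
  rw [AddEquiv.apply_symm_apply, AddEquiv.symm_apply_apply, M.U_smul, sg_sgn, M.U_γ, smul_smul]
  exact ((congrArg (· • M.γ (M.U g w)) (sgn_mul_self (T.c (p g)))).trans (one_smul ℂ _)).symm

theorem UFModule.U_symm_proj (g : G) (z : Z) (v : M.H) : (M.U g).symm (M.proj z v)
    = M.proj (g⁻¹ • z) ((M.U g).symm v) := by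
  obtain ⟨w, rfl⟩ := (M.U g).surjective v
  apply (M.U g).injective
  rw [AddEquiv.apply_symm_apply, AddEquiv.symm_apply_apply, M.U_proj, smul_inv_smul]

theorem UFModule.norm_proj_U_symm (g : G) (z : Z) (v : M.H) :
    ‖M.proj z ((M.U g).symm v)‖ = ‖M.proj (g • z) v‖ := by
  obtain ⟨w, rfl⟩ := (M.U g).surjective v
  rw [AddEquiv.symm_apply_apply, ← M.U_proj, M.U_norm]

/-- The value at `y` of the functional `f x l`, for `x` a base point, translated to `y`. -/
def coeff (v : M.H) (l : L) (y : XTilde G X) : ℂ :=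
  sg (T.φ (p y.elt)) (f (basePt (G := G) y.pt) l ((M.U y.elt).symm v))

variable [Finite Q]

/-- The values of the functionals, arranged in a multiple of the regular representation. -/
def regCoeff (v : M.H) (k : Fin (Nat.card Q) × L) (y : XTilde G X) : ℂ :=
  if k.1 = Finite.equivFin Q (p y.elt) then coeff M f v k.2 y else 0

theorem coeff_add (v w : M.H) (l : L) (y : XTilde G X) :
    coeff M f (v + w) l y = coeff M f v l y + coeff M f w l y := by
  simp [coeff]

theorem coeff_smul (z : ℂ) (v : M.H) (l : L) (y : XTilde G X) :
    coeff M f (z • v) l y = z * coeff M f v l y := by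
  rw [coeff, M.U_symm_smul, map_smul, smul_eq_mul, map_mul]
  exact congrArg (· * _) (sg_self (T.φ (p y.elt)) z)

/-- Base points are constant along orbits, and `(U_{gh})⁻¹ U_g` differs from `U_h⁻¹` by a value of
the cocycle. The factor `τ` obtained is the matrix entry of the twisted regular representation,
which makes `regJ` equivariant. -/
theorem coeff_U (g : G) (v : M.H) (l : L) (y : XTilde G X) : coeff M f (M.U g v) l (g • y)
    = T.τ (p g) (p y.elt) * sg (T.φ (p g)) (coeff M f v l y) := by
  have h : basePt (G := G) (g • y).pt = basePt (G := G) y.pt := basePt_smul g y.pt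
  rw [coeff, h]
  change sg (T.φ (p (g * y.elt))) (f _ l ((M.U (g * y.elt)).symm (M.U g v))) = _
  rw [M.U_symm_U, map_smul, smul_eq_mul, map_mul, sg_self, coeff, sg_sg, ← map_mul, ← map_mul]

variable {f} {σ : L → ℤˣ}

theorem coeff_γ (hf : ∀ x l v, f x l (M.γ v) = sgn (σ l) * f x l v) (v : M.H) (l : L)
    (y : XTilde G X) : coeff M f (M.γ v) l y = sgn (T.c (p y.elt) * σ l) * coeff M f v l y := by
  rw [coeff, M.U_symm_γ, map_smul, hf, smul_eq_mul, map_mul, map_mul, sg_sgn, sg_sgn, sgn_mul,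
    mul_assoc]
  rfl

/-- A point `y` contributes only to the copy labelled by the image of its group element in `Q`, so
arranging coefficients in the regular representation introduces no multiplicity. -/
theorem sum_norm_regCoeff (v : M.H) (y : XTilde G X) :
    ∑ k, ‖regCoeff M f v k y‖ ^ 2 = ∑ l, ‖f (basePt (G := G) y.pt) l ((M.U y.elt).symm v)‖ ^ 2 := by
  rw [Fintype.sum_prod_type, Finset.sum_eq_single (Finite.equivFin Q (p y.elt))]
  · exact Finset.sum_congr rfl fun l _ => by rw [regCoeff, if_pos rfl, coeff, norm_sg]
  · intro k _ hk
    exact Finset.sum_eq_zero fun l _ => by rw [regCoeff, if_neg hk]; simp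
  · exact fun h => absurd (Finset.mem_univ _) h

variable (hsum : ∀ v, HasSum (fun y : XTilde G X =>
  ∑ l, ‖f (basePt (G := G) y.pt) l ((M.U y.elt).symm v)‖ ^ 2) (‖v‖ ^ 2))

theorem summable_regCoeff (hsum : ∀ v, HasSum (fun y : XTilde G X =>
    ∑ l, ‖f (basePt (G := G) y.pt) l ((M.U y.elt).symm v)‖ ^ 2) (‖v‖ ^ 2)) (v : M.H) (k : Fin (Nat.card Q) × L) :
    Summable fun y : XTilde G X => ‖regCoeff M f v k y‖ ^ 2 := by
  refine Summable.of_nonneg_of_le (fun y => sq_nonneg _) (fun y => ?_) (hsum v).summable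
  rw [← sum_norm_regCoeff]
  exact Finset.single_le_sum (f := fun k => ‖regCoeff M f v k y‖ ^ 2) (fun _ _ => sq_nonneg _)
    (Finset.mem_univ k)

/-- The isometry given by the functionals. -/
def regIsom : M.H →ₗᵢ[ℂ] PiLp 2 (fun _ : Fin (Nat.card Q) × L => L2 (XTilde G X)) where
  toFun v := WithLp.toLp 2 fun k => ⟨regCoeff M f v k, L2.mem (by
    simpa using summable_regCoeff M hsum v k)⟩
  map_add' v w := by
    ext k y
    change regCoeff M f (v + w) k y = regCoeff M f v k y + regCoeff M f w k y
    simp only [regCoeff, coeff_add]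
    split_ifs <;> simp
  map_smul' z v := by
    ext k y
    change regCoeff M f (z • v) k y = z * regCoeff M f v k y
    simp only [regCoeff, coeff_smul, mul_ite, mul_zero]
  norm_map' v := by
    refine (pow_left_inj₀ (norm_nonneg _) (norm_nonneg _) two_ne_zero).1 ?_
    refine (PiLp.norm_sq_eq_of_L2 _ _).trans ?_
    have h1 : ∀ k, HasSum (fun y : XTilde G X => ‖regCoeff M f v k y‖ ^ 2)
        (‖(⟨regCoeff M f v k, L2.mem (by simpa using summable_regCoeff M hsum v k)⟩ :
          L2 (XTilde G X))‖ ^ 2) := fun k => by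
      have h2 := L2.norm_sq (⟨regCoeff M f v k, L2.mem (by
        simpa using summable_regCoeff M hsum v k)⟩ : L2 (XTilde G X))
      simp only [Real.rpow_two] at h2
      rw [h2]
      exact (summable_regCoeff M hsum v k).hasSum
    have h3 := hasSum_sum (s := Finset.univ) fun k _ => h1 k
    simp only [sum_norm_regCoeff] at h3
    exact h3.unique (hsum v)

variable [TopologicalSpace G] [DiscreteTopology G] [BoundedFiniteSubgroups G] [TopologicalSpace X]
  [ProperSMul G X]

/-- The isometry given by the functionals, as a map between modules. -/
def regJ : M.H →L[ℂ] ((HXG T p X).tens (MatRep.regular T σ)).H :=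
  (regIsom M hsum).toContinuousLinearMap

theorem regJ_isom (v : M.H) : adjoint (regJ (σ := σ) M hsum) (regJ (σ := σ) M hsum v) = v := by
  have h := (ContinuousLinearMap.norm_map_iff_adjoint_comp_self (regJ (σ := σ) M hsum)).1
    fun v => (regIsom M hsum).norm_map v
  exact congrArg (fun A : M.H →L[ℂ] M.H => A v) h

theorem regJ_even (hf : ∀ x l v, f x l (M.γ v) = sgn (σ l) * f x l v) (v : M.H) :
    regJ (σ := σ) M hsum (M.γ v)
      = ((HXG T p X).tens (MatRep.regular T σ)).γ (regJ (σ := σ) M hsum v) := by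
  refine PiLp.ext fun (k : Fin (Nat.card Q) × L) => ?_
  refine Eq.trans ?_ (mop_lift_apply _ _ _).symm
  have h : ∑ k' : Fin (Nat.card Q) × L, (MatRep.regular T σ).Γ k k' • regIsom M hsum v k'
      = sgn (T.c ((Finite.equivFin Q).symm k.1) * σ k.2) • regIsom M hsum v k := by
    refine (Finset.sum_eq_single k (fun k' _ hk => ?_)
      (fun hk => absurd (Finset.mem_univ _) hk)).trans ?_
    · exact (congrArg (· • _) (Matrix.diagonal_apply_ne _ hk.symm)).trans (zero_smul ℂ _)
    · exact congrArg (· • _) (Matrix.diagonal_apply_eq _ _)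
  refine Eq.trans ?_ h.symm
  refine lp.ext (funext fun y => ?_)
  change regCoeff M f (M.γ v) k y = _ * regCoeff M f v k y
  rw [regCoeff, regCoeff]
  by_cases hk : k.1 = Finite.equivFin Q (p y.elt)
  · rw [if_pos hk, if_pos hk, coeff_γ M hf, hk, Equiv.symm_apply_apply]
  · rw [if_neg hk, if_neg hk, mul_zero]

theorem regJ_equiv (g : G) (v : M.H) : regJ (σ := σ) M hsum (M.U g v)
    = ((HXG T p X).tens (MatRep.regular T σ)).U g (regJ (σ := σ) M hsum v) := by
  refine PiLp.ext fun (k : Fin (Nat.card Q) × L) => ?_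
  obtain ⟨k, rfl⟩ := regAct_surjective (p g) k
  refine Eq.trans ?_ (mop_lift_apply _ _ _).symm
  have h : ∑ k' : Fin (Nat.card Q) × L, (MatRep.regular T σ).u (p g) (regAct (p g) k) k' •
        (HXG T p X).U g (regIsom M hsum v k')
      = (T.τ (p g) ((Finite.equivFin Q).symm k.1) : ℂ) •
        (HXG T p X).U g (regIsom M hsum v k) := by
    refine (Finset.sum_eq_single k (fun k' _ hk => ?_)
      (fun hk => absurd (Finset.mem_univ _) hk)).trans ?_
    · exact (congrArg (· • _) (if_neg fun e => hk (regAct_injective _ e).symm)).trans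
        (zero_smul ℂ _)
    · exact congrArg (· • _) (if_pos rfl)
  refine Eq.trans ?_ h.symm
  refine lp.ext (funext fun y => ?_)
  obtain ⟨y, rfl⟩ := MulAction.surjective g y
  change regCoeff M f (M.U g v) (regAct (p g) k) (g • y)
    = (T.τ (p g) ((Finite.equivFin Q).symm k.1) : ℂ) *
      sg (T.φ (p g)) (regCoeff M f v k (g⁻¹ • g • y))
  rw [inv_smul_smul, regCoeff, regCoeff]
  have hiff : (regAct (p g) k).1 = Finite.equivFin Q (p (g • y).elt) ↔
      k.1 = Finite.equivFin Q (p y.elt) := by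
    change Finite.equivFin Q (p g * (Finite.equivFin Q).symm k.1)
      = Finite.equivFin Q (p (g * y.elt)) ↔ _
    rw [EmbeddingLike.apply_eq_iff_eq, map_mul, mul_right_inj, Equiv.symm_apply_eq]
  by_cases hk : k.1 = Finite.equivFin Q (p y.elt)
  · rw [if_pos hk, if_pos (hiff.2 hk), hk, Equiv.symm_apply_apply]
    exact coeff_U M f g v k.2 y
  · rw [if_neg hk, if_neg (mt hiff.1 hk), map_zero, mul_zero]

/-- Support is prescribed only for the functionals at base points. Translating by the group element
of `y` carries it to all points, because the relation is invariant. -/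
theorem regJ_proj {r : X → Z → Prop} (hr : ∀ (g : G) x z, r (g • x) (g • z) ↔ r x z)
    (hf : ∀ x l z v, ¬ r x z → f x l (M.proj z v) = 0) {x : X} {z : Z} (hxz : ¬ r x z) (v : M.H) :
    ((HXG T p X).tens (MatRep.regular T σ)).proj x (regJ (σ := σ) M hsum (M.proj z v)) = 0 := by
  refine PiLp.ext fun (k : Fin (Nat.card Q) × L) => ?_
  refine (diagOp_apply _ _ _).trans ?_
  refine lp.ext (funext fun y => ?_)
  refine (L2.cut_apply {y : XTilde G X | y.pt = x} _ y).trans ?_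
  by_cases hy : y.pt = x
  · refine (if_pos hy).trans ?_
    change regCoeff M f (M.proj z v) k y = 0
    have h : coeff M f (M.proj z v) k.2 y = 0 := by
      have hb : ¬ r (basePt (G := G) y.pt) (y.elt⁻¹ • z) := by
        rw [← hr y.elt, y.smul_basePt, smul_inv_smul, hy]
        exact hxz
      rw [coeff, M.U_symm_proj, hf _ _ _ _ hb, map_zero]
    rw [regCoeff, h, ite_self]
  · exact if_neg hy

end coeff

/-! ### Isometries supported in an invariant relation. -/

section absorb

variable {G : Type u} [Group G] {Q : Type v} [Group Q] {T : Twist Q} {p : G →* Q}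
  [TopologicalSpace G] [DiscreteTopology G] [BoundedFiniteSubgroups G]
  {X Z : Type u} [MulAction G X] [TopologicalSpace X] [ProperSMul G X] [MulAction G Z]

theorem finite_lifts {s : Set X} (hs : s.Finite) : {y : XTilde G X | y.pt ∈ s}.Finite := by
  obtain ⟨N, hN⟩ := fibre_bound (G := G) (X := X)
  exact hs.preimage' (f := XTilde.pt) fun x _ => Set.finite_coe_iff.1 (hN x).1

/-- The weight of `z` is the inverse of the number of points of `X̃` lying over the elements of `X`
related to `z`. Each `‖P_z v‖²` is counted exactly that often, so the weighted sum is `∑ ‖P_z v‖² =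
‖v‖²`. Finiteness of the fibres of `X̃` makes the number finite, nonemptiness of the sections makes
it positive. -/
theorem hasSum_weights (M : UFModule (T.comap p) Z) {r : X → Z → Prop}
    (hr : ∀ (g : G) x z, r (g • x) (g • z) ↔ r x z) (h1 : ∀ x, {z | r x z}.Finite)
    (h2 : ∀ z, {x | r x z}.Finite) (h3 : ∀ z, {x | r x z}.Nonempty) :
    ∃ a : Z → ℝ, (∀ z, 0 ≤ a z) ∧ ∀ v, HasSum (fun y : XTilde G X =>
      ∑ z ∈ (h1 (basePt (G := G) y.pt)).toFinset, a z * ‖M.proj z ((M.U y.elt).symm v)‖ ^ 2)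
        (‖v‖ ^ 2) := by
  classical
  have hfin : ∀ z, {y : XTilde G X | r y.pt z}.Finite := fun z => finite_lifts (h2 z)
  have hpos : ∀ z, 0 < (hfin z).toFinset.card := fun z => by
    obtain ⟨x, hx⟩ := h3 z
    obtain ⟨g, hg⟩ := exists_smul_basePt (G := G) x
    exact Finset.card_pos.2 ⟨⟨g, x, hg⟩, (hfin z).mem_toFinset.2 hx⟩
  let a : Z → ℝ := fun z => ((hfin z).toFinset.card : ℝ)⁻¹
  have ha : ∀ (g : G) z, a (g • z) = a z := fun g z => by
    have h : (hfin (g • z)).toFinset.card = (hfin z).toFinset.card := by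
      refine (Finset.card_nbij' (g • ·) (g⁻¹ • ·) ?_ ?_ ?_ ?_).symm
      · intro y hy
        simpa [XTilde.pt_smul, hr] using hy
      · intro y hy
        have hy' : r y.pt (g • z) := by simpa using hy
        rw [← hr g⁻¹, inv_smul_smul] at hy'
        simpa [XTilde.pt_smul] using hy'
      · intro y _; exact inv_smul_smul g y
      · intro y _; exact smul_inv_smul g y
    simp only [a, h]
  have ha0 : ∀ z, 0 ≤ a z := fun z => inv_nonneg.2 (Nat.cast_nonneg _)
  refine ⟨a, ha0, fun v => ?_⟩
  -- By invariance of the weights and of the relation, the sum at the base point for the translated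
  -- vector equals the sum at the point of `y` for `v` itself.
  have e1 : ∀ y : XTilde G X,
      ∑ z ∈ (h1 (basePt (G := G) y.pt)).toFinset, a z * ‖M.proj z ((M.U y.elt).symm v)‖ ^ 2
        = ∑ z ∈ (h1 y.pt).toFinset, a z * ‖M.proj z v‖ ^ 2 := fun y => by
    refine Finset.sum_nbij' (y.elt • ·) (y.elt⁻¹ • ·) ?_ ?_ ?_ ?_ ?_
    · intro z hz
      have hz' : r (basePt (G := G) y.pt) z := by simpa using hz
      rw [← hr y.elt, y.smul_basePt] at hz'
      simpa using hz'
    · intro z hz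
      have hz' : r y.pt z := by simpa using hz
      rw [← y.smul_basePt, ← hr y.elt⁻¹, inv_smul_smul] at hz'
      simpa using hz'
    · intro z _; exact inv_smul_smul _ z
    · intro z _; exact smul_inv_smul _ z
    · intro z _
      rw [ha, M.norm_proj_U_symm]
  simp only [e1]
  have hnn : ∀ z, 0 ≤ a z * ‖M.proj z v‖ ^ 2 := fun z => mul_nonneg (ha0 z) (sq_nonneg _)
  refine hasSum_of_tsum_ofReal (fun y => Finset.sum_nonneg fun z _ => hnn z) (sq_nonneg _) ?_
  have e2 : ∀ y : XTilde G X,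
      ENNReal.ofReal (∑ z ∈ (h1 y.pt).toFinset, a z * ‖M.proj z v‖ ^ 2)
        = ∑' z, if r y.pt z then ENNReal.ofReal (a z * ‖M.proj z v‖ ^ 2) else 0 := fun y => by
    rw [ENNReal.ofReal_sum_of_nonneg fun z _ => hnn z, tsum_eq_sum (s := (h1 y.pt).toFinset)]
    · refine Finset.sum_congr rfl fun z hz => (if_pos ?_).symm
      simpa using hz
    · intro z hz
      refine if_neg fun h => hz ?_
      simpa using h
  have e3 : ∀ z, ∑' y : XTilde G X, (if r y.pt z then ENNReal.ofReal (a z * ‖M.proj z v‖ ^ 2) else 0)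
      = ENNReal.ofReal (‖M.proj z v‖ ^ 2) := fun z => by
    rw [tsum_eq_sum (s := (hfin z).toFinset)]
    · rw [Finset.sum_congr rfl fun y hy => if_pos (by simpa using hy), Finset.sum_const,
        nsmul_eq_mul, ← ENNReal.ofReal_natCast, ← ENNReal.ofReal_mul (Nat.cast_nonneg _), ← mul_assoc,
        mul_inv_cancel₀ (Nat.cast_ne_zero.2 (hpos z).ne'), one_mul]
    · intro y hy
      refine if_neg fun h => hy ?_
      simpa using h
  rw [tsum_congr e2, ENNReal.tsum_comm, tsum_congr e3]
  have h := M.hasSum_norm_sq_proj v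
  rw [← ENNReal.ofReal_tsum_of_nonneg (fun _ => sq_nonneg _) h.summable, h.tsum_eq]

/-- An even equivariant isometry from a module over `Z` into a multiple of `ℋ_{X,G}`, supported in an
invariant relation between `X` and `Z` all of whose sections are finite. -/
theorem exists_isometry [Finite Q] (M : UFModule (T.comap p) Z) {r : X → Z → Prop}
    (hr : ∀ (g : G) x z, r (g • x) (g • z) ↔ r x z) {n : ℕ} (h1 : ∀ x, {z | r x z}.encard ≤ n)
    (h2 : ∀ z, {x | r x z}.Finite) (h3 : ∀ z, {x | r x z}.Nonempty) :
    ∃ (V : MatRep T) (j : M.H →L[ℂ] ((HXG T p X).tens V).H), (∀ v, adjoint j (j v) = v) ∧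
      (∀ v, j (M.γ v) = ((HXG T p X).tens V).γ (j v)) ∧
      (∀ g v, j (M.U g v) = ((HXG T p X).tens V).U g (j v)) ∧
      ∀ x z v, ¬ r x z → ((HXG T p X).tens V).proj x (j (M.proj z v)) = 0 := by
  have h1' : ∀ x, {z | r x z}.Finite := fun x => Set.finite_of_encard_le_coe (h1 x)
  obtain ⟨a, ha, hsum⟩ := hasSum_weights M hr h1' h2 h3
  obtain ⟨d, hd⟩ := M.exists_functionals n
  choose f hf1 hf2 hf3 using fun x => hd (h1' x).toFinset a ha (by
    have := h1 x
    rw [(h1' x).encard_eq_coe_toFinset_card] at this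
    exact_mod_cast this)
  have hs : ∀ v, HasSum (fun y : XTilde G X =>
      ∑ l, ‖f (basePt (G := G) y.pt) l ((M.U y.elt).symm v)‖ ^ 2) (‖v‖ ^ 2) := fun v => by
    simp only [hf2]
    exact hsum v
  -- The second component of the index of a functional is its parity, and it becomes the sign
  -- modifying the grading on that copy of the regular representation.
  refine ⟨MatRep.regular T Prod.snd, regJ M hs, regJ_isom M hs, regJ_even M hs hf1, regJ_equiv M hs,
    fun x z v hxz => regJ_proj M hs hr (fun x l z v h => hf3 x l z v ?_) hxz v⟩
  simpa using h

end absorb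

/-! ### Block diagonal classes -/

section diagonal

variable {G : Type u} [Group G] [TopologicalSpace G] [DiscreteTopology G] [BoundedFiniteSubgroups G]
  {Q : Type v} [Group Q] [Finite Q] {T : Twist Q} {p : G →* Q} (hp : Function.Surjective p)
  {X : Type u} [MetricSpace X] [MulAction G X] [IsIsometricSMul G X] [ProperSMul G X]

/-- For the relation of equality the isometry has no off-diagonal blocks. Summing over the
components of `v`, it therefore intertwines the projections. -/
theorem exists_diagonal_emb (M : UFModule (T.comap p) X) :
    ∃ (V : MatRep T) (e : Emb M ((HXG T p X).tens V)),
      ∀ x v, e.j (M.proj x v) = ((HXG T p X).tens V).proj x (e.j v) := by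
  obtain ⟨V, j, h1, h2, h3, h4⟩ := exists_isometry (X := X) M (r := Eq) (n := 1)
    (fun g x z => smul_left_cancel_iff g) (fun x => by simp) (fun z => by simp)
    (fun z => ⟨z, rfl⟩)
  refine ⟨V, ⟨j, h1, h2, h3, 0, fun x y v hxy => h4 y x v fun e => ?_⟩, fun x v => ?_⟩
  · rw [e, dist_self] at hxy
    exact lt_irrefl _ hxy
  · change j (M.proj x v) = _
    have hs := (M.hasSum_proj v).mapL (((HXG T p X).tens V).proj x ∘L j)
    have hs' : HasSum (fun y => (((HXG T p X).tens V).proj x ∘L j) (M.proj y v))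
        ((((HXG T p X).tens V).proj x ∘L j) (M.proj x v)) :=
      hasSum_single x fun y hy => h4 x y v hy.symm
    refine Eq.trans ?_ (hs'.unique hs)
    refine sub_eq_zero.1 (((HXG T p X).tens V).proj_total _ fun y => ?_)
    rw [map_sub]
    by_cases hy : y = x
    · rw [hy]
      exact sub_eq_zero.2 (((HXG T p X).tens V).proj_proj x _).symm
    · rw [h4 y x v hy]
      exact (congrArg (0 - ·) (((HXG T p X).tens V).proj_proj_of_ne hy _)).trans (sub_zero 0)

theorem absorbing_HXG : Absorbing (HXG T p X) := fun M =>
  let ⟨V, e, _⟩ := exists_diagonal_emb M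
  ⟨V, ⟨e⟩⟩

theorem Emb.commute_push {M M' : UFModule (T.comap p) X} (e : Emb M M')
    (h : ∀ x v, e.j (M.proj x v) = M'.proj x (e.j v)) {S : M.H →L[ℂ] M.H}
    (hS : ∀ x, Commute (M.proj x) S) (x : X) : Commute (M'.proj x) (e.push S) := by
  have h' : ∀ v, adjoint e.j (M'.proj x v) = M.proj x (adjoint e.j v) := fun v => by
    refine ext_inner_left ℂ fun w => ?_
    rw [ContinuousLinearMap.adjoint_inner_right, ← M'.inner_proj, ← h,
      ← ContinuousLinearMap.adjoint_inner_right, M.inner_proj]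
  have hS' : ∀ v, S (M.proj x v) = M.proj x (S v) := fun v =>
    (congrArg (fun A : M.H →L[ℂ] M.H => A v) (hS x).eq).symm
  refine ContinuousLinearMap.ext fun v => ?_
  change M'.proj x (e.push S v) = e.push S (M'.proj x v)
  rw [push_apply, push_apply, map_add, ← M'.γ_proj, map_sub, ← h, ← h, h', hS']

/-- A matrix over the block diagonal algebra is a block diagonal operator on `ℋ_{X,G} ⊗ V`.
Conversely, a block diagonal symmetry of any module stays block diagonal under a block diagonal
embedding, so its matrix entries lie in `c_b(X, 𝕂)^Π`. This is where stabilisation of phases meets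
the image of `ι_u`. -/
theorem mem_range_iotaStar (y : K0Roe hp T X) : y ∈ (iotaStar hp T X).range ↔
    ∃ (M : UFModule (T.comap p) X) (S : M.Sym),
      (∀ x, Commute (M.proj x) S.1) ∧ fcls hp absorbing_HXG M S = y := by
  constructor
  · rintro ⟨⟨V, d⟩, rfl⟩
    let s : Symm (T := T) ((HXG T p X).roeAct hp) V :=
      ⟨d.1.map (StarSubalgebra.inclusion (HXG T p X).diag_le_roe),
        K0.map_mem _ (fun _ _ => rfl) d.2⟩
    refine ⟨(HXG T p X).tens V, ⟨_, ((HXG T p X).mem_symm_iff hp V _).1 s.2⟩, fun x => ?_, ?_⟩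
    · refine ((HXG T p X).tmop_commute_proj x).2 fun i k => ?_
      exact (d.1 i k).2.2 x
    · rw [fcls_tens, kcls_tmop]
      rfl
  · rintro ⟨M, S, hS, rfl⟩
    obtain ⟨V, e, he⟩ := exists_diagonal_emb M
    have hc := e.commute_push he hS
    have hsym := e.push_mem_sym S.2
    let d : Matrix V.ι V.ι (cb T X p) := fun i k =>
      ⟨(HXG T p X).tmat V (e.push S.1) i k, by
        have h := UFModule.TwInvariant.mem_invAlg hsym.2.1
        rw [← (HXG T p X).tmop_tmat (e.push S.1)] at h
        exact (HXG T p X).tmop_mem_invAlg.1 h i k, fun x => by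
        have h := hc x
        rw [← (HXG T p X).tmop_tmat (e.push S.1)] at h
        exact ((HXG T p X).tmop_commute_proj x).1 h i k⟩
    have hd : (HXG T p X).tmop V (coeMat d) = e.push S.1 := (HXG T p X).tmop_tmat _
    have hmem : d ∈ Symm (T := T) (cbAct hp T X) V := by
      refine ((HXG T p X).mem_symmSet_iff hp _ (HXG T p X).diag_le_invAlg
        (fun g _ => (HXG T p X).ad_mem_diag g) V d).2 ?_
      rw [hd]
      exact hsym.2
    refine ⟨K0.mk _ V ⟨d, hmem⟩, ?_⟩
    rw [fcls_eq hp absorbing_HXG e]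
    rfl

variable (T) in
/-- Topological phases are K-theory classes of the uniform Roe algebra modulo those of its block
diagonal subalgebra. -/
def tpEquivUniform (X : Type u) [MetricSpace X] [MulAction G X] [IsIsometricSMul G X]
    [ProperSMul G X] : TP (T.comap p) X ≃+ K0Roe hp T X ⧸ (iotaStar hp T X).range :=
  tpEquiv hp absorbing_HXG (mem_range_iotaStar hp)

end diagonal

/-! ### Modules over larger spaces -/

section extend

variable {G : Type u} [Group G] {T : Twist G} {X Z : Type u} [MulAction G X] [MulAction G Z]

open Classical in
/-- The projections of a module over `X`, as projections indexed by a larger space. -/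
def UFModule.extendProj (N : UFModule T X) (i : X → Z) (z : Z) : N.H →L[ℂ] N.H :=
  if h : ∃ x, i x = z then N.proj h.choose else 0

theorem UFModule.extendProj_apply (N : UFModule T X) {i : X → Z} (hi : Function.Injective i) (x : X) :
    N.extendProj i (i x) = N.proj x := by
  have h : ∃ x', i x' = i x := ⟨x, rfl⟩
  rw [extendProj, dif_pos h, hi h.choose_spec]

theorem UFModule.extendProj_of_notMem (N : UFModule T X) {i : X → Z} {z : Z}
    (h : z ∉ Set.range i) : N.extendProj i z = 0 := dif_neg h

/-- A module over `X` as a module over a larger space. -/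
def UFModule.extend (N : UFModule T X) (i : X → Z) (hi : Function.Injective i)
    (hg : ∀ (g : G) x, i (g • x) = g • i x) : UFModule T Z where
  H := N.H
  γ := N.γ
  γ_star := N.γ_star
  γ_sq := N.γ_sq
  U := N.U
  U_norm := N.U_norm
  U_smul := N.U_smul
  U_mul := N.U_mul
  U_γ := N.U_γ
  proj := N.extendProj i
  proj_star z := by
    by_cases hz : z ∈ Set.range i
    · obtain ⟨x, rfl⟩ := hz
      rw [N.extendProj_apply hi]
      exact N.proj_star x
    · rw [N.extendProj_of_notMem hz]
      exact IsStarProjection.zero _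
  proj_orth z z' h := by
    by_cases hz : z ∈ Set.range i
    · by_cases hz' : z' ∈ Set.range i
      · obtain ⟨x, rfl⟩ := hz
        obtain ⟨x', rfl⟩ := hz'
        rw [N.extendProj_apply hi, N.extendProj_apply hi]
        exact N.proj_orth x x' fun e => h (congrArg i e)
      · rw [N.extendProj_of_notMem hz', mul_zero]
    · rw [N.extendProj_of_notMem hz, zero_mul]
  proj_total v hv := N.proj_total v fun x => by
    rw [← N.extendProj_apply hi]
    exact hv (i x)
  proj_γ z := by
    by_cases hz : z ∈ Set.range i
    · obtain ⟨x, rfl⟩ := hz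
      rw [N.extendProj_apply hi]
      exact N.proj_γ x
    · rw [N.extendProj_of_notMem hz]
      exact Commute.zero_right _
  U_proj g z v := by
    by_cases hz : z ∈ Set.range i
    · obtain ⟨x, rfl⟩ := hz
      rw [← hg, N.extendProj_apply hi, N.extendProj_apply hi]
      exact N.U_proj g x v
    · have hz' : g • z ∉ Set.range i := fun ⟨x, hx⟩ => hz ⟨g⁻¹ • x, by
        rw [hg, hx, inv_smul_smul]⟩
      rw [N.extendProj_of_notMem hz, N.extendProj_of_notMem hz']
      exact map_zero _
  uniformlyFinite := by
    obtain ⟨K, hK⟩ := N.uniformlyFinite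
    refine ⟨K, fun z => ?_⟩
    by_cases hz : z ∈ Set.range i
    · obtain ⟨x, rfl⟩ := hz
      rw [N.extendProj_apply hi]
      exact hK x
    · rw [N.extendProj_of_notMem hz]
      have h : LinearMap.range ((0 : N.H →L[ℂ] N.H) : N.H →ₗ[ℂ] N.H) = ⊥ := LinearMap.range_zero
      rw [h]
      exact ⟨inferInstance, by simp⟩

variable (N : UFModule T X) {i : X → Z} (hi : Function.Injective i)
  (hg : ∀ (g : G) x, i (g • x) = g • i x)

theorem UFModule.extend_proj_apply (x : X) : (N.extend i hi hg).proj (i x) = N.proj x :=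
  N.extendProj_apply hi x

theorem UFModule.extend_proj_of_notMem {z : Z} (h : z ∉ Set.range i) :
    (N.extend i hi hg).proj z = 0 := N.extendProj_of_notMem h

theorem UFModule.extend_controlled_iff [MetricSpace X] [MetricSpace Z] (hd : Isometry i)
    (S : N.H →L[ℂ] N.H) : (N.extend i hi hg).Controlled S ↔ N.Controlled S := by
  constructor
  · rintro ⟨R, hR, h⟩
    refine ⟨R, hR, fun x y hxy => ?_⟩
    have := h (i x) (i y) (by rwa [hd.dist_eq])
    rwa [N.extend_proj_apply hi hg, N.extend_proj_apply hi hg] at this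
  · rintro ⟨R, hR, h⟩
    refine ⟨R, hR, fun z z' hz => ?_⟩
    by_cases hm : z ∈ Set.range i
    · by_cases hm' : z' ∈ Set.range i
      · obtain ⟨x, rfl⟩ := hm
        obtain ⟨x', rfl⟩ := hm'
        rw [hd.dist_eq] at hz
        rw [N.extend_proj_apply hi hg, N.extend_proj_apply hi hg]
        exact h x x' hz
      · rw [N.extend_proj_of_notMem hi hg hm']
        exact (congrArg (· * _) (zero_mul _)).trans (zero_mul _)
    · rw [N.extend_proj_of_notMem hi hg hm]
      exact mul_zero _

end extend

/-! ### Roe algebras of extended modules. -/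

section roe

variable {G : Type u} [Group G] {Q : Type v} [Group Q] {T : Twist Q} {p : G →* Q}
  (hp : Function.Surjective p) {X Z : Type u} [MetricSpace X] [MulAction G X] [IsIsometricSMul G X]
  [MetricSpace Z] [MulAction G Z] [IsIsometricSMul G Z] (N : UFModule (T.phiOnly.comap p) X)
  {i : X → Z} (hd : Isometry i) (hg : ∀ (g : G) x, i (g • x) = g • i x)

/-- The new points carry zero projections and the inclusion is isometric, so exactly the same
operators are controlled; invariance does not involve the space. -/
theorem UFModule.extend_roe : (N.extend i hd.injective hg).roe = N.roe := by
  have h : (N.extend i hd.injective hg).algRoe = N.algRoe := by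
    refine SetLike.ext fun S => ?_
    exact and_congr Iff.rfl (and_congr (N.extend_controlled_iff hd.injective hg hd S)
      (iff_of_true (locallyCompact _ S) (N.locallyCompact S)))
  exact congrArg StarSubalgebra.topologicalClosure h

/-- The K-group of the Roe algebra is unchanged when the space is enlarged. -/
def kExtend : KRoe hp N ≃+ KRoe hp (N.extend i hd.injective hg) where
  toFun := K0.map (α := N.roeAct hp) (β := (N.extend i hd.injective hg).roeAct hp)
    (StarSubalgebra.inclusion (N.extend_roe hd hg).ge) fun _ _ => rfl
  invFun := K0.map (α := (N.extend i hd.injective hg).roeAct hp) (β := N.roeAct hp)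
    (StarSubalgebra.inclusion (N.extend_roe hd hg).le) fun _ _ => rfl
  left_inv := by
    rintro ⟨x⟩
    rfl
  right_inv := by
    rintro ⟨x⟩
    rfl
  map_add' := map_add _

end roe

/-! ### Comparison of Delone subsets through their union. -/

section delone

variable {G : Type u} [Group G] [TopologicalSpace G] [DiscreteTopology G] [BoundedFiniteSubgroups G]
  {Q : Type v} [Group Q] [Finite Q] {T : Twist Q} {p : G →* Q} (hp : Function.Surjective p)

/-- The relation of being at distance at most `R` is invariant. An isometry supported in it has
propagation at most `R` once its target is regarded as a module over `Z`. -/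
theorem absorbing_extend {X Z : Type u} [MetricSpace X] [MulAction G X] [IsIsometricSMul G X]
    [ProperSMul G X] [MetricSpace Z] [MulAction G Z] [IsIsometricSMul G Z] {i : X → Z}
    (hi : Function.Injective i) (hg : ∀ (g : G) x, i (g • x) = g • i x) {R : ℝ} {n : ℕ}
    (h1 : ∀ x, {z | dist (i x) z ≤ R}.encard ≤ n) (h2 : ∀ z, {x | dist (i x) z ≤ R}.Finite)
    (h3 : ∀ z, ∃ x, dist (i x) z ≤ R) : Absorbing ((HXG T p X).extend i hi hg) := fun M => by
  obtain ⟨V, j, e1, e2, e3, e4⟩ := exists_isometry M (r := fun x z => dist (i x) z ≤ R)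
    (fun g x z => by rw [hg, dist_smul]) h1 h2 h3
  refine ⟨V, ⟨⟨j, e1, e2, e3, R, fun z z' v hz => ?_⟩⟩⟩
  refine PiLp.ext fun k => (diagOp_apply _ _ _).trans ?_
  by_cases hm : z' ∈ Set.range i
  · obtain ⟨x, rfl⟩ := hm
    rw [UFModule.extend_proj_apply]
    have h := e4 x z v (by rwa [dist_comm, not_le])
    exact (diagOp_apply _ _ _).symm.trans
      (congrArg (fun w : PiLp 2 (fun _ : V.ι => (HXG T p X).H) => w k) h)
  · rw [UFModule.extend_proj_of_notMem _ _ _ hm]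
    rfl

variable {M : Type u} [MetricSpace M] [MulAction G M] [IsIsometricSMul G M] [ProperSMul G M]
  (X Y : SubMulAction G M)

/-- The union of two invariant subsets. -/
def unionAct : SubMulAction G M where
  carrier := X ∪ Y
  smul_mem' g _ h := h.imp (X.smul_mem g) (Y.smul_mem g)

variable {X Y}

/-- Bounded geometry speaks of balls centred in `X`, whereas the centre here is any point of the
ambient space. A ball of radius `R` that meets `X` is contained in a ball of radius `2R` about one
of its points in `X`. -/
theorem encard_ball_le {R : ℝ} {N : ℕ} (hN : ∀ x : X, (Metric.closedBall x (2 * R)).encard ≤ N)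
    (m : M) : {x : X | dist m x ≤ R}.encard ≤ N := by
  rcases {x : X | dist m x ≤ R}.eq_empty_or_nonempty with h | ⟨x₀, h₀⟩
  · rw [h, Set.encard_empty]
    exact zero_le
  · refine (Set.encard_le_encard fun x hx => ?_).trans (hN x₀)
    have h1 : dist m x ≤ R := hx
    have h2 : dist m x₀ ≤ R := h₀
    have h3 := dist_triangle_left (x : M) x₀ m
    rw [Metric.mem_closedBall]
    change dist (x : M) x₀ ≤ _
    linarith

/-- Relative density of `X` provides a point of `X` within `R` of each point of `Z`, and bounded
geometry of both sets bounds the points of `Z` near a point of `X`. The ambient set `Z` is kept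
general so that the lemma applies with the roles of `X` and `Y` exchanged. -/
theorem absorbing_union (Z : SubMulAction G M) (hXZ : ∀ m ∈ X, m ∈ Z)
    (hZ : ∀ m ∈ Z, m ∈ X ∨ m ∈ Y) (hX : IsDelone (X : Set M)) (hX' : BoundedGeometry X)
    (hY' : BoundedGeometry Y) : Absorbing ((HXG T p X).extend
      (fun x : X => (⟨x.1, hXZ _ x.2⟩ : Z)) (fun _ _ h => Subtype.ext (congrArg (fun z : Z => z.1) h))
      fun _ _ => rfl) := by
  obtain ⟨-, R, hR, hne⟩ := hX
  obtain ⟨n, hn⟩ := hX' (2 * R)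
  obtain ⟨n', hn'⟩ := hY' (2 * R)
  refine absorbing_extend (R := R) (n := n + n') _ _ (fun x => ?_) (fun z => ?_) fun z => ?_
  · have hsub : Subtype.val '' {z : Z | dist (⟨x.1, hXZ _ x.2⟩ : Z) z ≤ R}
        ⊆ Subtype.val '' {x' : X | dist x.1 x'.1 ≤ R} ∪ Subtype.val '' {y : Y | dist x.1 y.1 ≤ R} := by
      rintro _ ⟨z, hz, rfl⟩
      rcases hZ z.1 z.2 with h | h
      · exact Or.inl ⟨⟨z.1, h⟩, hz, rfl⟩
      · exact Or.inr ⟨⟨z.1, h⟩, hz, rfl⟩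
    rw [← Subtype.val_injective.encard_image]
    refine (Set.encard_le_encard hsub).trans ((Set.encard_union_le _ _).trans ?_)
    rw [Subtype.val_injective.encard_image, Subtype.val_injective.encard_image, Nat.cast_add]
    exact add_le_add (encard_ball_le hn x.1) (encard_ball_le hn' x.1)
  · refine Set.finite_of_encard_le_coe ((Set.encard_le_encard fun x hx => ?_).trans
      (encard_ball_le hn z.1))
    change dist z.1 x.1 ≤ R
    rw [dist_comm]
    exact hx
  · obtain ⟨m, hm, hmX⟩ := hne z.1
    exact ⟨⟨m, hmX⟩, hm⟩

variable (T) in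
/-- The K-groups of the uniform Roe algebras of two Delone subsets are isomorphic. -/
def k0DeloneEquiv (hX : IsDelone (X : Set M)) (hY : IsDelone (Y : Set M)) (hX' : BoundedGeometry X)
    (hY' : BoundedGeometry Y) : K0Roe hp T X ≃+ K0Roe hp T Y :=
  (kExtend hp (HXG T p X) (Z := unionAct X Y) (i := fun x : X => ⟨x.1, Or.inl x.2⟩)
    (fun _ _ => rfl) fun _ _ => rfl).trans
  ((kEquiv hp (absorbing_union (unionAct X Y) (fun _ => Or.inr) (fun _ => Or.symm) hY hY' hX')
    (absorbing_union (unionAct X Y) (fun _ => Or.inl) (fun _ => id) hX hX' hY')).trans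
  (kExtend hp (HXG T p Y) (Z := unionAct X Y) (i := fun y : Y => ⟨y.1, Or.inr y.2⟩)
    (fun _ _ => rfl) fun _ _ => rfl).symm)

end delone

end CTP

end

theorem mainTheorem3 {G : Type u} [Group G] [Countable G] [TopologicalSpace G] [DiscreteTopology G]
    [CTP.BoundedFiniteSubgroups G] {Q : Type v} [Group Q] [Finite Q]
    (p : G →* Q) (hp : Function.Surjective p) (T : CTP.Twist Q) :
    (∀ (X : Type u) [MetricSpace X] [ProperSpace X] [DiscreteTopology X] [MulAction G X]
        [IsIsometricSMul G X] [ProperSMul G X],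
      Nonempty (CTP.TP (T.comap p) X ≃+ CTP.K0Roe hp T X ⧸ (CTP.iotaStar hp T X).range)) ∧
    (∀ (M : Type u) [MetricSpace M] [MulAction G M] [IsIsometricSMul G M] [ProperSMul G M]
        (X Y : SubMulAction G M), CTP.IsDelone (X : Set M) → CTP.IsDelone (Y : Set M) →
        CTP.BoundedGeometry X → CTP.BoundedGeometry Y →
      ∃ e : CTP.K0Roe hp T X ≃+ CTP.K0Roe hp T Y,
        Nonempty (CTP.TP (T.comap p) X ≃+ CTP.K0Roe hp T X ⧸ (CTP.iotaStar hp T X).range) ∧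
        Nonempty (CTP.TP (T.comap p) Y ≃+
          CTP.K0Roe hp T X ⧸ (CTP.iotaStar hp T Y).range.comap e.toAddMonoidHom)) := by
  refine ⟨fun X _ _ _ _ _ _ => ⟨CTP.tpEquivUniform T hp X⟩, fun M _ _ _ _ X Y hX hY hX' hY' => ?_⟩
  let e := CTP.k0DeloneEquiv T hp hX hY hX' hY'
  refine ⟨e, ⟨CTP.tpEquivUniform T hp X⟩, ⟨(CTP.tpEquivUniform T hp Y).trans
    (QuotientAddGroup.congr _ _ e ?_).symm⟩⟩
  -- An isomorphism carries the preimage of the subgroup onto the subgroup, so the quotient for `Y`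
  -- can be formed in the K-group of `X`.
  exact AddSubgroup.map_comap_eq_self_of_surjective (f := e.toAddMonoidHom) e.surjective _
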